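/- Let $K$ be an imaginary quadratic field, $m\ge 2$, $V$ a $\mathbf Q$-vector space of dimension $2m$ that is also a $K$-vector space, and $Q$ a bilinear form on $V$ with $Q(xv,xw)=x\bar x\,Q(v,w)$ for $x\in K$, $v,w\in V$. Consider the Hodge structures $h$ of weight two on $V$ (with $V^{p,q}\neq 0$ only for $p,q\ge 0$) such that $\dim V^{2,0}=1$, $Q$ is a polarization of $(V,h)$ (so $Q$ is negative definite on the real plane $V_2$ with $V_2\otimes\mathbf C=V^{2,0}\oplus V^{0,2}$), and $K$ acts by endomorphisms of Hodge structure. Each $h$ is determined by $V^{2,0}$, a point of an open subset of $\mathbf P(V_{\mathbf C,\sigma})$, where $V_{\mathbf C,\sigma}\subset V_{\mathbf C}$ is the subspace on which $K$ acts through one of its two embeddings $\sigma:K\to\mathbf C$. "For general $h$" means: for all $h$ such that $V^{2,0}$ lies outside a countable union of hypersurfaces of $\mathbf P(V_{\mathbf C})$, depending only on $(V,Q,K)$, none of which contains $\mathbf P(V_{\mathbf C,\sigma})$ for either $\sigma$. Let $C^+(Q)$ be the even Clifford algebra of $Q$ (with $v^2=Q(v,v)$), with its Kuga-Satake Hodge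 structure of weight one: $a+bi\in\mathbf C^*$ acts on $C^+(Q)_{\mathbf R}$ by $x\mapsto (a-bJ)x$, where $J=f_1f_2$ for any $f_1,f_2\in V_{\mathbf R}$ with $V^{2,0}=\langle f_1+if_2\rangle$ and $Q(f_1,f_1)=-1$. Then for every such $h$ there are rational Hodge structures $S_0,\dots,S_m$ of weight one such that, with $S=S_0\oplus S_1\oplus\dots\oplus S_m$, $$C^+(Q)\cong S^{2^{m-2}},\qquad \dim_{\mathbf Q}S=2^{m+1},\qquad S_i\cong S_{m-i},\qquad \dim_{\mathbf Q}S_i=2\binom mi$$ (isomorphisms of Hodge structures); $K$ embeds in $\mathrm{End}_{Hod}(S_i)$ for each $i$; and there is an injective morphism of Hodge structures $V\hookrightarrow S_0\otimes S_1$. Moreover, for general $h$ each $S_i$ is a simple Hodge structure, except for $S_l$ if $2l=m$, $m\equiv 2 \pmod 4$ and $-\prod_{j=1}^m Q(b_j,b_j)$ is a norm from $K$; here $b_1,\dots,b_m$ is a $K$-basis of $V$ that is orthogonal for the $K$-Hermitian form $H$ on $V$ with $H(v,v)=Q(v,v)$ (the condition, that $-\det H\in N_{K/\mathbf Q}(K^*)$,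 does not depend on the basis). In this exceptional case $S_l\cong (S_l')^2$ for a Hodge structure $S'_l$ of weight one, which is simple for general $h$. -/

import Mathlib

open scoped TensorProduct DirectSum

universe u v

/-! ### Complexifications of rational vector spaces -/

/-- Complex conjugation `z ⊗ v ↦ conj z ⊗ v` on `V_ℂ = ℂ ⊗[ℚ] V`. Its fixed vectors are the
elements of `V_ℝ ⊆ V_ℂ`. -/
noncomputable def conjC (V : Type*) [AddCommGroup V] [Module ℚ V] :
    (ℂ ⊗[ℚ] V) →ₗ[ℚ] (ℂ ⊗[ℚ] V) :=
  LinearMap.rTensor V (Complex.conjAe.toLinearMap.restrictScalars ℚ)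

section ConjLemmas

variable {V : Type*} [AddCommGroup V] [Module ℚ V]

@[simp] theorem conjC_tmul (z : ℂ) (v : V) :
    conjC V (z ⊗ₜ[ℚ] v) = (starRingEnd ℂ z) ⊗ₜ[ℚ] v := rfl

theorem conjC_smul (z : ℂ) (x : ℂ ⊗[ℚ] V) :
    conjC V (z • x) = (starRingEnd ℂ z) • conjC V x := by
  induction x with
  | zero => simp
  | tmul a v => simp [TensorProduct.smul_tmul']
  | add x y hx hy => simp [smul_add, hx, hy]

@[simp] theorem conjC_conjC (x : ℂ ⊗[ℚ] V) : conjC V (conjC V x) = x := by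
  induction x with
  | zero => simp
  | tmul a v => simp
  | add x y hx hy => simp [hx, hy]

theorem conjC_baseChange {W : Type*} [AddCommGroup W] [Module ℚ W] (f : V →ₗ[ℚ] W)
    (x : ℂ ⊗[ℚ] V) : conjC W (f.baseChange ℂ x) = f.baseChange ℂ (conjC V x) := by
  induction x with
  | zero => simp
  | tmul a v => simp
  | add x y hx hy => simp [hx, hy]

theorem conjC_bilin {W : Type*} [AddCommGroup W] [Module ℚ W] (B : LinearMap.BilinMap ℚ V W)
    (x y : ℂ ⊗[ℚ] V) :
    conjC W (B.baseChange ℂ x y) = B.baseChange ℂ (conjC V x) (conjC V y) := by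
  induction x with
  | zero => simp
  | add x x' hx hx' => simp [hx, hx']
  | tmul a v =>
    induction y with
    | zero => simp
    | add y y' hy hy' => simp [hy, hy']
    | tmul b w => simp

theorem conjC_form (B : LinearMap.BilinForm ℚ V) (x y : ℂ ⊗[ℚ] V) :
    LinearMap.BilinForm.baseChange ℂ B (conjC V x) (conjC V y) =
      starRingEnd ℂ (LinearMap.BilinForm.baseChange ℂ B x y) := by
  induction x with
  | zero => simp
  | add x x' hx hx' => simp [hx, hx']
  | tmul a v =>
    induction y with
    | zero => simp
    | add y y' hy hy' => rw [map_add, map_add, hy, hy', map_add, map_add]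
    | tmul b w => simp [Algebra.smul_def]

/-- The preimage of a complex subspace under conjugation. -/
def conjSub (N : Submodule ℂ (ℂ ⊗[ℚ] V)) : Submodule ℂ (ℂ ⊗[ℚ] V) where
  carrier := {x | conjC V x ∈ N}
  add_mem' := fun hx hy => by
    simp only [Set.mem_ofPred_eq, map_add] at *
    exact N.add_mem hx hy
  zero_mem' := by simp
  smul_mem' := fun c x hx => by
    simp only [Set.mem_ofPred_eq, conjC_smul] at *
    exact N.smul_mem _ hx

theorem mem_conjSub (N : Submodule ℂ (ℂ ⊗[ℚ] V)) (x : ℂ ⊗[ℚ] V) :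
    x ∈ conjSub N ↔ conjC V x ∈ N := Iff.rfl

theorem conjC_mul {A : Type*} [Ring A] [Algebra ℚ A] (x y : ℂ ⊗[ℚ] A) :
    conjC A (x * y) = conjC A x * conjC A y := by
  induction x with
  | zero => simp
  | add x x' hx hx' => simp [add_mul, hx, hx']
  | tmul a v =>
    induction y with
    | zero => simp
    | add y y' hy hy' => simp [mul_add, hy, hy']
    | tmul b w => simp

end ConjLemmas

/-! ### Rational Hodge structures -/

/-- A rational Hodge structure of weight `k` on the `ℚ`-vector space `V`: a decomposition
`V_ℂ = ⨁_{p+q=k} V^{p,q}`, `p, q ≥ 0`, with `conj V^{p,q} = V^{q,p}`. -/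
structure HodgeStructure (V : Type*) [AddCommGroup V] [Module ℚ V] (k : ℕ) where
  /-- The subspace `V^{p,q}` of `V_ℂ`. -/
  comp : ℕ → ℕ → Submodule ℂ (ℂ ⊗[ℚ] V)
  comp_eq_bot : ∀ p q, p + q ≠ k → comp p q = ⊥
  isInternal : DirectSum.IsInternal (fun pq : ℕ × ℕ => comp pq.1 pq.2)
  conj_mem : ∀ p q x, x ∈ comp p q → conjC V x ∈ comp q p

namespace HodgeStructure

variable {V W : Type*} [AddCommGroup V] [Module ℚ V] [AddCommGroup W] [Module ℚ W] {k l : ℕ}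

/-- (Strict) morphisms of Hodge structures: `f_ℂ (V^{p,q}) ⊆ W^{p,q}`. -/
def IsHom (h : HodgeStructure V k) (h' : HodgeStructure W l) (f : V →ₗ[ℚ] W) : Prop :=
  ∀ p q, ∀ x ∈ h.comp p q, f.baseChange ℂ x ∈ h'.comp p q

/-- Two Hodge structures are isomorphic. -/
def IsIso (h : HodgeStructure V k) (h' : HodgeStructure W l) : Prop :=
  ∃ e : V ≃ₗ[ℚ] W, h.IsHom h' e.toLinearMap ∧ h'.IsHom h e.symm.toLinearMap

/-- A rational subspace `U` is a sub-Hodge structure if `U_ℂ = ⨁ (U_ℂ ∩ V^{p,q})`. -/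
def IsSub (h : HodgeStructure V k) (U : Submodule ℚ V) : Prop :=
  U.baseChange ℂ = ⨆ p, ⨆ q, U.baseChange ℂ ⊓ h.comp p q

/-- A Hodge structure is simple if it is nonzero and its only sub-Hodge structures are `0` and
itself. -/
def IsSimple (h : HodgeStructure V k) : Prop :=
  Nontrivial V ∧ ∀ U : Submodule ℚ V, h.IsSub U → U = ⊥ ∨ U = ⊤

/-- `Ψ` is a polarization of the weight `k` Hodge structure `h`: it is `(-1)^k`-symmetric,
`Ψ_ℂ(V^{p,q}, V^{r,s}) = 0` unless `(r,s) = (q,p)`, and `i^{p-q} Ψ_ℂ(conj x, x) > 0` for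
`0 ≠ x ∈ V^{p,q}`; here `i^{p-q}` is the eigenvalue of the Weil operator `h(i)` on `V^{p,q}`. -/
structure IsPolarization (h : HodgeStructure V k) (Ψ : LinearMap.BilinForm ℚ V) : Prop where
  symm : ∀ v w, Ψ v w = (-1) ^ k * Ψ w v
  orth : ∀ p q r s, (r, s) ≠ (q, p) → ∀ x ∈ h.comp p q, ∀ y ∈ h.comp r s,
    LinearMap.BilinForm.baseChange ℂ Ψ x y = 0
  pos : ∀ p q, ∀ x ∈ h.comp p q, x ≠ 0 → ∃ t : ℝ, 0 < t ∧
    Complex.I ^ p * (-Complex.I) ^ q * LinearMap.BilinForm.baseChange ℂ Ψ (conjC V x) x = t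

/-! #### Finite direct sums -/

section Pi

variable {ι : Type*} [DecidableEq ι] {S : ι → Type*}
  [∀ i, AddCommGroup (S i)] [∀ i, Module ℚ (S i)]

/-- The projection `(⨁ Sᵢ)_ℂ → (Sᵢ)_ℂ`. -/
noncomputable def projC {ι : Type*} (S : ι → Type*) [∀ i, AddCommGroup (S i)] [∀ i, Module ℚ (S i)] (i : ι) :
    (ℂ ⊗[ℚ] (∀ i, S i)) →ₗ[ℂ] (ℂ ⊗[ℚ] S i) :=
  (LinearMap.proj i : (∀ i, S i) →ₗ[ℚ] S i).baseChange ℂ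

theorem sum_single_projC [Fintype ι] (x : ℂ ⊗[ℚ] (∀ i, S i)) :
    ∑ i, (LinearMap.single ℚ S i).baseChange ℂ (projC S i x) = x := by
  induction x with
  | zero => simp
  | add x y hx hy =>
    rw [← hx, ← hy]
    simp only [map_add, Finset.sum_add_distrib, hx, hy]
  | tmul a v =>
    simp only [projC, LinearMap.baseChange_tmul, LinearMap.proj_apply, LinearMap.coe_single]
    rw [← TensorProduct.tmul_sum, Finset.univ_sum_single]

theorem eq_zero_of_projC [Fintype ι] {x : ℂ ⊗[ℚ] (∀ i, S i)} (hx : ∀ i, projC S i x = 0) : x = 0 := by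
  rw [← sum_single_projC x]
  simp [hx]

theorem projC_single (i j : ι) (y : ℂ ⊗[ℚ] S i) (N : Submodule ℂ (ℂ ⊗[ℚ] S j))
    (hN : ∀ h : i = j, h ▸ y ∈ N) :
    projC S j ((LinearMap.single ℚ S i).baseChange ℂ y) ∈ N := by
  rw [projC, ← LinearMap.comp_apply, ← LinearMap.baseChange_comp]
  by_cases hij : i = j
  · subst hij
    rw [LinearMap.proj_comp_single_same, LinearMap.baseChange_id]
    exact hN rfl
  · rw [LinearMap.proj_comp_single_ne _ _ _ _ (Ne.symm hij), LinearMap.baseChange_zero]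
    exact N.zero_mem

/-- The direct sum of finitely many Hodge structures of weight `k`. -/
noncomputable def pi [Fintype ι] (h : ∀ i, HodgeStructure (S i) k) : HodgeStructure (∀ i, S i) k where
  comp p q := ⨅ i, ((h i).comp p q).comap (projC S i)
  comp_eq_bot := by
    intro p q hpq
    rw [eq_bot_iff]
    intro x hx
    rw [Submodule.mem_bot]
    refine eq_zero_of_projC fun i => ?_
    have := (Submodule.mem_iInf _).1 hx i
    rwa [Submodule.mem_comap, (h i).comp_eq_bot p q hpq, Submodule.mem_bot] at this
  isInternal := by
    rw [DirectSum.isInternal_submodule_iff_iSupIndep_and_iSup_eq_top]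
    have key := fun i => (DirectSum.isInternal_submodule_iff_iSupIndep_and_iSup_eq_top _).1
      (h i).isInternal
    constructor
    · intro pq
      rw [Submodule.disjoint_def]
      intro x hx hx'
      refine eq_zero_of_projC fun i => ?_
      refine Submodule.disjoint_def.1 ((key i).1 pq) _ ((Submodule.mem_iInf _).1 hx i) ?_
      have h2 := Submodule.mem_map_of_mem (f := projC S i) hx'
      simp only [Submodule.map_iSup] at h2
      have h3 : ∀ j : ℕ × ℕ, Submodule.map (projC S i)
          (⨅ i, ((h i).comp j.1 j.2).comap (projC S i)) ≤ (h i).comp j.1 j.2 := by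
        intro j
        rw [Submodule.map_le_iff_le_comap]
        exact iInf_le _ i
      exact (show _ ≤ _ from iSup₂_mono fun j _ => h3 j) h2
    · rw [eq_top_iff]
      intro x _
      rw [← sum_single_projC x]
      refine Submodule.sum_mem _ fun i _ => ?_
      have h1 : projC S i x ∈ ⨆ pq : ℕ × ℕ, (h i).comp pq.1 pq.2 := by
        rw [(key i).2]; trivial
      have h2 := Submodule.mem_map_of_mem (f := (LinearMap.single ℚ S i).baseChange ℂ) h1
      rw [Submodule.map_iSup] at h2
      refine SetLike.le_def.1 (iSup_mono fun pq => ?_) h2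
      rw [Submodule.map_le_iff_le_comap]
      intro y hy
      rw [Submodule.mem_comap, Submodule.mem_iInf]
      intro j
      rw [Submodule.mem_comap]
      refine projC_single i j y _ ?_
      rintro rfl
      exact hy
  conj_mem := by
    intro p q x hx
    rw [Submodule.mem_iInf] at hx ⊢
    intro i
    have := (h i).conj_mem p q _ (hx i)
    rw [projC, conjC_baseChange] at this
    exact this

end Pi

/-! #### Tensor products -/

/-- The map `(x, y) ↦ x ⊗ y`, `V_ℂ × W_ℂ → (V ⊗ W)_ℂ`. -/
noncomputable def tmulC (V W : Type*) [AddCommGroup V] [Module ℚ V] [AddCommGroup W]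
    [Module ℚ W] :
    (ℂ ⊗[ℚ] V) →ₗ[ℂ] (ℂ ⊗[ℚ] W) →ₗ[ℂ] (ℂ ⊗[ℚ] (V ⊗[ℚ] W)) :=
  (TensorProduct.mk ℂ (ℂ ⊗[ℚ] V) (ℂ ⊗[ℚ] W)).compr₂
    (TensorProduct.AlgebraTensorModule.distribBaseChange ℚ ℂ V W).symm.toLinearMap

theorem tmulC_tmul (a b : ℂ) (v : V) (w : W) :
    tmulC V W (a ⊗ₜ v) (b ⊗ₜ w) = (a * b) ⊗ₜ[ℚ] (v ⊗ₜ[ℚ] w) := by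
  rw [tmulC, LinearMap.compr₂_apply, TensorProduct.mk_apply, LinearEquiv.coe_coe,
    TensorProduct.AlgebraTensorModule.distribBaseChange_symm_tmul]

theorem conjC_tmulC (x : ℂ ⊗[ℚ] V) (y : ℂ ⊗[ℚ] W) :
    conjC _ (tmulC V W x y) = tmulC V W (conjC V x) (conjC W y) := by
  induction x with
  | zero => simp
  | add x x' hx hx' => simp [hx, hx']
  | tmul a v =>
    induction y with
    | zero => simp
    | add y y' hy hy' => rw [map_add, map_add, hy, hy', map_add, map_add]
    | tmul b w => simp [tmulC_tmul]

theorem iSup_comp (h : HodgeStructure V k) : ⨆ pq : ℕ × ℕ, h.comp pq.1 pq.2 = ⊤ :=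
  ((DirectSum.isInternal_submodule_iff_iSupIndep_and_iSup_eq_top _).1 h.isInternal).2

theorem exists_scale (h : HodgeStructure V k) (c : ℕ × ℕ → ℂ) :
    ∃ T : (ℂ ⊗[ℚ] V) →ₗ[ℂ] (ℂ ⊗[ℚ] V), ∀ p q, ∀ x ∈ h.comp p q, T x = c (p, q) • x := by
  let e := LinearEquiv.ofBijective (DirectSum.coeLinearMap
    (fun pq : ℕ × ℕ => h.comp pq.1 pq.2)) h.isInternal
  refine ⟨(DirectSum.toModule ℂ (ℕ × ℕ) (ℂ ⊗[ℚ] V)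
    (fun pq => c pq • (h.comp pq.1 pq.2).subtype)) ∘ₗ e.symm.toLinearMap, ?_⟩
  intro p q x hx
  have h1 : e.symm x = DirectSum.lof ℂ (ℕ × ℕ) (fun pq : ℕ × ℕ => h.comp pq.1 pq.2) (p, q)
      ⟨x, hx⟩ := by
    rw [LinearEquiv.symm_apply_eq]
    exact (DirectSum.coeLinearMap_lof (fun pq : ℕ × ℕ => h.comp pq.1 pq.2) (p, q) ⟨x, hx⟩).symm
  simp [h1]

theorem two_pow_three_pow_inj {a b c d : ℕ} (h : (2 : ℂ) ^ a * 3 ^ b = 2 ^ c * 3 ^ d) :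
    (a, b) = (c, d) := by
  have h' : 2 ^ a * 3 ^ b = 2 ^ c * 3 ^ d := by exact_mod_cast h
  have h2 := congrArg (padicValNat 2) h'
  have h3 := congrArg (padicValNat 3) h'
  have : Fact (Nat.Prime 3) := ⟨Nat.prime_three⟩
  have e23 : padicValNat 2 3 = 0 := padicValNat.eq_zero_of_not_dvd (by norm_num)
  have e32 : padicValNat 3 2 = 0 := padicValNat.eq_zero_of_not_dvd (by norm_num)
  rw [padicValNat.mul (by positivity) (by positivity),
    padicValNat.mul (by positivity) (by positivity)] at h2 h3
  simp [padicValNat.pow, e23, e32] at h2 h3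
  rw [h2, h3]

/-- The tensor product of two Hodge structures:
`(V ⊗ W)^{p,q} = ∑_{p₁+p₂=p, q₁+q₂=q} V^{p₁,q₁} ⊗ W^{p₂,q₂}`. -/
noncomputable def tensor (h : HodgeStructure V k) (h' : HodgeStructure W l) :
    HodgeStructure (V ⊗[ℚ] W) (k + l) where
  comp p q := ⨆ (p₁ : ℕ) (q₁ : ℕ) (p₂ : ℕ) (q₂ : ℕ) (_ : p₁ + p₂ = p) (_ : q₁ + q₂ = q),
    Submodule.map₂ (tmulC V W) (h.comp p₁ q₁) (h'.comp p₂ q₂)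
  comp_eq_bot := by
    intro p q hpq
    simp only [iSup_eq_bot]
    intro p₁ q₁ p₂ q₂ hp hq
    by_cases h1 : p₁ + q₁ = k
    · rw [h'.comp_eq_bot p₂ q₂ (by omega), Submodule.map₂_bot_right]
    · rw [h.comp_eq_bot p₁ q₁ h1, Submodule.map₂_bot_left]
  isInternal := by
    rw [DirectSum.isInternal_submodule_iff_iSupIndep_and_iSup_eq_top]
    constructor
    · obtain ⟨T, hT⟩ := h.exists_scale (fun pq => 2 ^ pq.1 * 3 ^ pq.2)
      obtain ⟨T', hT'⟩ := h'.exists_scale (fun pq => 2 ^ pq.1 * 3 ^ pq.2)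
      let D := TensorProduct.AlgebraTensorModule.distribBaseChange ℚ ℂ V W
      let U : Module.End ℂ (ℂ ⊗[ℚ] (V ⊗[ℚ] W)) :=
        D.symm.toLinearMap ∘ₗ TensorProduct.map T T' ∘ₗ D.toLinearMap
      have hU : ∀ x y, U (tmulC V W x y) = tmulC V W (T x) (T' y) := by
        intro x y
        simp [U, D, tmulC]
      have ind : iSupIndep fun pq : ℕ × ℕ => U.eigenspace ((2 : ℂ) ^ pq.1 * 3 ^ pq.2) :=
        U.eigenspaces_iSupIndep.comp
          (f := fun pq : ℕ × ℕ => (2 : ℂ) ^ pq.1 * 3 ^ pq.2)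
          (fun a b hab => two_pow_three_pow_inj hab)
      refine ind.mono fun pq => ?_
      simp only [iSup_le_iff]
      intro p₁ q₁ p₂ q₂ hp hq
      rw [Submodule.map₂_le]
      intro x hx y hy
      rw [Module.End.mem_eigenspace_iff, hU, hT _ _ x hx, hT' _ _ y hy, ← hp, ← hq]
      simp only [map_smul, LinearMap.smul_apply, smul_smul]
      congr 1
      ring
    · have h1 : (⊤ : Submodule ℂ (ℂ ⊗[ℚ] (V ⊗[ℚ] W))) ≤ Submodule.map₂ (tmulC V W) ⊤ ⊤ := by
        intro x _
        induction x with
        | zero => exact Submodule.zero_mem _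
        | add x y hx hy => exact Submodule.add_mem _ (hx trivial) (hy trivial)
        | tmul a z =>
          induction z with
          | zero => simp
          | add x y hx hy => rw [TensorProduct.tmul_add]; exact Submodule.add_mem _ (hx trivial) (hy trivial)
          | tmul v w =>
            have : a ⊗ₜ[ℚ] (v ⊗ₜ[ℚ] w) = tmulC V W (a ⊗ₜ v) (1 ⊗ₜ w) := by
              rw [tmulC_tmul, mul_one]
            rw [this]
            exact Submodule.apply_mem_map₂ _ trivial trivial
      rw [eq_top_iff]
      refine h1.trans ?_
      rw [← h.iSup_comp, ← h'.iSup_comp, Submodule.map₂_iSup_left]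
      refine iSup_le fun a => ?_
      rw [Submodule.map₂_iSup_right]
      refine iSup_le fun b => ?_
      refine le_trans ?_ (le_iSup _ (a.1 + b.1, a.2 + b.2))
      refine le_iSup_of_le a.1 (le_iSup_of_le a.2 (le_iSup_of_le b.1 (le_iSup_of_le b.2 ?_)))
      exact le_iSup_of_le rfl (le_iSup_of_le rfl le_rfl)
  conj_mem := by
    intro p q x hx
    rw [← mem_conjSub]
    have hle : ∀ N N' : Submodule ℂ (ℂ ⊗[ℚ] (V ⊗[ℚ] W)), N ≤ N' → x ∈ N → x ∈ N' :=
      fun _ _ hN h0 => hN h0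
    refine hle _ _ ?_ hx
    simp only [iSup_le_iff]
    intro p₁ q₁ p₂ q₂ hp hq
    rw [Submodule.map₂_le]
    intro x hx y hy
    rw [mem_conjSub, conjC_tmulC]
    have h1 := Submodule.apply_mem_map₂ (tmulC V W) (h.conj_mem _ _ x hx) (h'.conj_mem _ _ y hy)
    refine SetLike.le_def.1 ?_ h1
    refine le_iSup_of_le q₁ (le_iSup_of_le p₁ (le_iSup_of_le q₂ (le_iSup_of_le p₂ ?_)))
    exact le_iSup_of_le hq (le_iSup_of_le hp le_rfl)

end HodgeStructure

/-! ### The Kuga-Satake Hodge structure on the even Clifford algebra -/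

section KugaSatake

variable {V : Type*} [AddCommGroup V] [Module ℚ V]

/-- The even Clifford algebra `C⁺(Q)` of the quadratic form `v ↦ Q(v, v)`. -/
abbrev EvenClifford (Q : LinearMap.BilinForm ℚ V) : Type _ :=
  CliffordAlgebra.even (LinearMap.BilinMap.toQuadraticMap Q)

/-- The product `f₁ f₂ ∈ C⁺(Q)_ℂ` of two vectors `f₁, f₂ ∈ V_ℂ`. -/
noncomputable def cliffordMulC (Q : LinearMap.BilinForm ℚ V) :
    LinearMap.BilinMap ℂ (ℂ ⊗[ℚ] V) (ℂ ⊗[ℚ] EvenClifford Q) :=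
  LinearMap.BilinMap.baseChange ℂ
    (CliffordAlgebra.even.ι (LinearMap.BilinMap.toQuadraticMap Q)).bilin

/-- `J` is the Kuga-Satake element: `J = f₁ f₂` with `f₁, f₂ ∈ V_ℝ` such that
`V^{2,0} = ⟨f₁ + i f₂⟩` and `Q(f₁) = -1`. -/
def IsKugaSatakeElement (h : HodgeStructure V 2) (Q : LinearMap.BilinForm ℚ V)
    (J : ℂ ⊗[ℚ] EvenClifford Q) : Prop :=
  ∃ f₁ f₂ : ℂ ⊗[ℚ] V, conjC V f₁ = f₁ ∧ conjC V f₂ = f₂ ∧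
    h.comp 2 0 = Submodule.span ℂ {f₁ + Complex.I • f₂} ∧
    LinearMap.BilinForm.baseChange ℂ Q f₁ f₁ = -1 ∧ J = cliffordMulC Q f₁ f₂

theorem cliffordMulC_swap (Q : LinearMap.BilinForm ℚ V) (a b : ℂ ⊗[ℚ] V) :
    cliffordMulC Q a b + cliffordMulC Q b a =
      (LinearMap.BilinForm.baseChange ℂ Q a b + LinearMap.BilinForm.baseChange ℂ Q b a) • 1 := by
  have base : ∀ v w : V, (CliffordAlgebra.even.ι Q.toQuadraticMap).bilin v w +
      (CliffordAlgebra.even.ι Q.toQuadraticMap).bilin w v = (Q v w + Q w v) • 1 := by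
    intro v w
    apply Subtype.ext
    have := CliffordAlgebra.ι_mul_ι_add_swap (Q := Q.toQuadraticMap) v w
    rw [LinearMap.BilinMap.polar_toQuadraticMap] at this
    simpa [CliffordAlgebra.even.ι, Algebra.algebraMap_eq_smul_one] using this
  induction a with
  | zero => simp
  | add x x' hx hx' =>
    simp only [map_add, LinearMap.add_apply]
    rw [add_add_add_comm, hx, hx', ← add_smul]
    congr 1
    ring
  | tmul s v =>
    induction b with
    | zero => simp
    | add y y' hy hy' =>
      simp only [map_add, LinearMap.add_apply]
      rw [add_add_add_comm, hy, hy', ← add_smul]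
      congr 1
      ring
    | tmul t w =>
      simp only [cliffordMulC, LinearMap.BilinMap.baseChange_tmul,
        LinearMap.BilinForm.baseChange_tmul]
      rw [mul_comm t s, ← TensorProduct.tmul_add, base, TensorProduct.tmul_smul, ← add_smul,
        Algebra.TensorProduct.one_def, TensorProduct.smul_tmul', TensorProduct.smul_tmul']
      simp

theorem cliffordMulC_mid (Q : LinearMap.BilinForm ℚ V) (a b c d : ℂ ⊗[ℚ] V) :
    cliffordMulC Q a b * cliffordMulC Q c d + cliffordMulC Q a c * cliffordMulC Q b d =
      (LinearMap.BilinForm.baseChange ℂ Q b c + LinearMap.BilinForm.baseChange ℂ Q c b) •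
        cliffordMulC Q a d := by
  have base : ∀ a b c d : V, (CliffordAlgebra.even.ι Q.toQuadraticMap).bilin a b *
      (CliffordAlgebra.even.ι Q.toQuadraticMap).bilin c d +
      (CliffordAlgebra.even.ι Q.toQuadraticMap).bilin a c *
      (CliffordAlgebra.even.ι Q.toQuadraticMap).bilin b d =
      (Q b c + Q c b) • (CliffordAlgebra.even.ι Q.toQuadraticMap).bilin a d := by
    intro a b c d
    apply Subtype.ext
    have := CliffordAlgebra.ι_mul_ι_add_swap (Q := Q.toQuadraticMap) b c
    rw [LinearMap.BilinMap.polar_toQuadraticMap] at this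
    have h2 := congrArg (fun x => CliffordAlgebra.ι Q.toQuadraticMap a * x *
      CliffordAlgebra.ι Q.toQuadraticMap d) this
    simp only [mul_add, add_mul, Algebra.algebraMap_eq_smul_one, mul_smul_comm, mul_one,
      smul_mul_assoc] at h2
    simpa [CliffordAlgebra.even.ι, mul_assoc] using h2
  induction a with
  | zero => simp
  | add x x' hx hx' =>
    simp only [map_add, LinearMap.add_apply, add_mul, smul_add]
    rw [add_add_add_comm, hx, hx']
  | tmul s₁ a =>
  induction d with
  | zero => simp
  | add x x' hx hx' =>
    simp only [map_add, mul_add, smul_add]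
    rw [add_add_add_comm, hx, hx']
  | tmul s₂ d =>
  induction b with
  | zero => simp
  | add x x' hx hx' =>
    simp only [map_add, LinearMap.add_apply, add_mul, mul_add]
    rw [add_add_add_comm, hx, hx', ← add_smul]
    congr 1
    ring
  | tmul s₃ b =>
  induction c with
  | zero => simp
  | add x x' hx hx' =>
    simp only [map_add, LinearMap.add_apply, add_mul, mul_add]
    rw [add_add_add_comm, hx, hx', ← add_smul]
    congr 1
    ring
  | tmul s₄ c =>
    simp only [cliffordMulC, LinearMap.BilinMap.baseChange_tmul,
      LinearMap.BilinForm.baseChange_tmul, Algebra.TensorProduct.tmul_mul_tmul]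
    rw [show s₁ * s₃ * (s₄ * s₂) = s₁ * s₂ * (s₃ * s₄) by ring,
      show s₁ * s₄ * (s₃ * s₂) = s₁ * s₂ * (s₃ * s₄) by ring, mul_comm s₄ s₃,
      ← TensorProduct.tmul_add, base, ← add_smul, TensorProduct.smul_tmul',
      ← TensorProduct.smul_tmul]
    congr 1
    simp only [Algebra.smul_def, Algebra.algebraMap_self, RingHom.id_apply]
    ring

variable {h : HodgeStructure V 2} {Q : LinearMap.BilinForm ℚ V}

theorem HodgeStructure.IsPolarization.symmC (hQ : h.IsPolarization Q) (x y : ℂ ⊗[ℚ] V) :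
    LinearMap.BilinForm.baseChange ℂ Q x y = LinearMap.BilinForm.baseChange ℂ Q y x := by
  have hs : ∀ v w, Q v w = Q w v := fun v w => by simpa using hQ.symm v w
  induction x with
  | zero => simp
  | add x x' hx hx' => simp only [map_add, LinearMap.add_apply, hx, hx']
  | tmul s v =>
    induction y with
    | zero => simp
    | add y y' hy hy' => simp only [map_add, LinearMap.add_apply, hy, hy']
    | tmul t w =>
      rw [LinearMap.BilinForm.baseChange_tmul, LinearMap.BilinForm.baseChange_tmul, hs v w,
        mul_comm]

theorem exists_isKugaSatakeElement (hQ : h.IsPolarization Q)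
    (h20 : Module.finrank ℂ (h.comp 2 0) = 1) : ∃ J, IsKugaSatakeElement h Q J := by
  obtain ⟨⟨ω, hω⟩, hne, hspan⟩ := finrank_eq_one_iff'.1 h20
  have hω0 : ω ≠ 0 := fun h0 => hne (Subtype.ext h0)
  have hcomp : h.comp 2 0 = Submodule.span ℂ {ω} := by
    apply le_antisymm
    · intro x hx
      obtain ⟨c, hc⟩ := hspan ⟨x, hx⟩
      exact Submodule.mem_span_singleton.2 ⟨c, congrArg Subtype.val hc⟩
    · rw [Submodule.span_singleton_le_iff_mem]
      exact hω
  obtain ⟨t, ht, htQ⟩ := hQ.pos 2 0 ω hω hω0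
  have h0 : LinearMap.BilinForm.baseChange ℂ Q ω ω = 0 :=
    hQ.orth 2 0 2 0 (by simp) ω hω ω hω
  have h0' : LinearMap.BilinForm.baseChange ℂ Q (conjC V ω) (conjC V ω) = 0 := by
    rw [conjC_form, h0, map_zero]
  have h1 : LinearMap.BilinForm.baseChange ℂ Q (conjC V ω) ω = -t := by
    rw [← htQ]; simp
  have h1' : LinearMap.BilinForm.baseChange ℂ Q ω (conjC V ω) = -t := by
    rw [hQ.symmC, h1]
  set s : ℝ := Real.sqrt (2 / t) with hs
  have hs0 : s ≠ 0 := (Real.sqrt_pos.2 (by positivity)).ne'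
  have hs2 : (s : ℂ) * s * t = 2 := by
    have : s * s = 2 / t := Real.mul_self_sqrt (by positivity)
    have h3 : s * s * t = 2 := by rw [this]; field_simp
    exact_mod_cast h3
  refine ⟨_, ((s : ℂ) / 2) • (ω + conjC V ω), (-Complex.I * (s : ℂ) / 2) • (ω - conjC V ω),
    ?_, ?_, ?_, ?_, rfl⟩
  · rw [conjC_smul, map_add, conjC_conjC, add_comm (conjC V ω)]
    simp only [map_div₀, Complex.conj_ofReal, map_ofNat]
  · rw [conjC_smul, map_sub, conjC_conjC, ← neg_sub ω, smul_neg, ← neg_smul]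
    congr 1
    simp only [map_div₀, map_mul, map_neg, Complex.conj_I, Complex.conj_ofReal, map_ofNat]
    ring
  · rw [hcomp, smul_smul]
    have : Complex.I * (-Complex.I * (s : ℂ) / 2) = (s : ℂ) / 2 := by
      linear_combination (-(s : ℂ) / 2) * Complex.I_mul_I
    rw [this, ← smul_add, add_add_sub_cancel, ← two_smul ℂ ω, smul_smul]
    have hu : IsUnit ((s : ℂ) / 2 * 2) := by
      rw [isUnit_iff_ne_zero]
      simpa using hs0
    rw [Submodule.span_singleton_smul_eq hu]
  · simp only [map_smul, LinearMap.smul_apply, map_add, LinearMap.add_apply, h0, h0', h1, h1',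
      smul_eq_mul]
    linear_combination (-1 / 2 : ℂ) * hs2

/-- The Gram matrix of `f₁, f₂`. -/
theorem gram_of_isotropic (hQ : h.IsPolarization Q) {f₁ f₂ : ℂ ⊗[ℚ] V}
    (h₁ : conjC V f₁ = f₁) (h₂ : conjC V f₂ = f₂)
    (hs : h.comp 2 0 = Submodule.span ℂ {f₁ + Complex.I • f₂}) :
    LinearMap.BilinForm.baseChange ℂ Q f₂ f₂ = LinearMap.BilinForm.baseChange ℂ Q f₁ f₁ ∧
      LinearMap.BilinForm.baseChange ℂ Q f₁ f₂ = 0 := by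
  have hm : f₁ + Complex.I • f₂ ∈ h.comp 2 0 := by
    rw [hs]; exact Submodule.mem_span_singleton_self _
  have h0 := hQ.orth 2 0 2 0 (by simp) _ hm _ hm
  have r11 := conjC_form Q f₁ f₁
  have r12 := conjC_form Q f₁ f₂
  have r22 := conjC_form Q f₂ f₂
  rw [h₁] at r11
  rw [h₁, h₂] at r12
  rw [h₂] at r22
  simp only [map_smul, LinearMap.smul_apply, map_add, LinearMap.add_apply, smul_eq_mul,
    hQ.symmC f₂ f₁] at h0
  generalize LinearMap.BilinForm.baseChange ℂ Q f₁ f₁ = a at *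
  generalize LinearMap.BilinForm.baseChange ℂ Q f₁ f₂ = b at *
  generalize LinearMap.BilinForm.baseChange ℂ Q f₂ f₂ = c at *
  have h0' := congrArg (starRingEnd ℂ) h0
  simp only [map_add, map_mul, ← r11, ← r12, ← r22, Complex.conj_I, map_zero] at h0'
  constructor
  · linear_combination (-1 / 2 : ℂ) * h0 + (-1 / 2 : ℂ) * h0' + c * Complex.I_mul_I
  · linear_combination (-Complex.I / 4 : ℂ) * h0 + (Complex.I / 4 : ℂ) * h0' +
      b * Complex.I_mul_I

theorem cliffordMulC_self (Q : LinearMap.BilinForm ℚ V) (a : ℂ ⊗[ℚ] V) :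
    cliffordMulC Q a a = LinearMap.BilinForm.baseChange ℂ Q a a • 1 := by
  have h1 := cliffordMulC_swap Q a a
  rw [← two_smul ℂ, ← two_mul, mul_smul] at h1
  exact smul_right_injective _ (two_ne_zero (α := ℂ)) h1

theorem IsKugaSatakeElement.mul_self (hQ : h.IsPolarization Q) {J : ℂ ⊗[ℚ] EvenClifford Q}
    (hJ : IsKugaSatakeElement h Q J) : J * J = -1 := by
  obtain ⟨f₁, f₂, h₁, h₂, hs, hn, rfl⟩ := hJ
  obtain ⟨e22, e12⟩ := gram_of_isotropic hQ h₁ h₂ hs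
  have h1 := cliffordMulC_mid Q f₁ f₂ f₁ f₂
  rw [cliffordMulC_self, cliffordMulC_self, e22, hn, hQ.symmC f₂ f₁, e12] at h1
  simp only [neg_smul, one_smul, mul_neg, mul_one, neg_neg, add_zero, zero_smul] at h1
  exact eq_neg_of_add_eq_zero_left h1

theorem IsKugaSatakeElement.conj {J : ℂ ⊗[ℚ] EvenClifford Q}
    (hJ : IsKugaSatakeElement h Q J) : conjC _ J = J := by
  obtain ⟨f₁, f₂, h₁, h₂, -, -, rfl⟩ := hJ
  rw [cliffordMulC, conjC_bilin, h₁, h₂]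

/-- The Kuga-Satake element `J` does not depend on the choice of `f₁, f₂`. -/
theorem IsKugaSatakeElement.unique (hQ : h.IsPolarization Q) {J J' : ℂ ⊗[ℚ] EvenClifford Q}
    (hJ : IsKugaSatakeElement h Q J) (hJ' : IsKugaSatakeElement h Q J') : J = J' := by
  obtain ⟨f₁, f₂, h₁, h₂, hs, hn, rfl⟩ := hJ
  obtain ⟨g₁, g₂, k₁, k₂, ks, kn, rfl⟩ := hJ'
  obtain ⟨e22, e12⟩ := gram_of_isotropic hQ h₁ h₂ hs
  have hm : g₁ + Complex.I • g₂ ∈ h.comp 2 0 := by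
    rw [ks]; exact Submodule.mem_span_singleton_self _
  rw [hs] at hm
  obtain ⟨c, hc⟩ := Submodule.mem_span_singleton.1 hm
  have hc' := congrArg (conjC V) hc
  simp only [conjC_smul, map_add, h₁, h₂, k₁, k₂, Complex.conj_I] at hc'
  have hI := Complex.I_mul_I
  set d := starRingEnd ℂ c with hd
  have eg₁ : g₁ = ((c + d) / 2) • f₁ + (Complex.I * (c - d) / 2) • f₂ := by
    have : (1 / 2 : ℂ) • (g₁ + Complex.I • g₂ + (g₁ + (-Complex.I) • g₂)) = g₁ := by module
    rw [← this, ← hc, ← hc']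
    module
  have eg₂ : g₂ = (-Complex.I * (c - d) / 2) • f₁ + ((c + d) / 2) • f₂ := by
    have : (-Complex.I / 2 : ℂ) • (g₁ + Complex.I • g₂ - (g₁ + (-Complex.I) • g₂)) = g₂ := by
      match_scalars
      · ring
      · linear_combination -hI
    rw [← this, ← hc, ← hc']
    match_scalars
    · ring
    · linear_combination (-(c + d) / 2) * hI
  have hcd : c * d = 1 := by
    rw [eg₁] at kn
    simp only [map_smul, LinearMap.smul_apply, map_add, LinearMap.add_apply, smul_eq_mul,
      hQ.symmC f₂ f₁, e22, e12, hn] at kn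
    linear_combination -kn - ((c - d) ^ 2 / 4) * hI
  have hsw := cliffordMulC_swap Q f₁ f₂
  rw [hQ.symmC f₂ f₁, e12, add_zero, zero_smul] at hsw
  have hsw' : cliffordMulC Q f₂ f₁ = -cliffordMulC Q f₁ f₂ := eq_neg_of_add_eq_zero_right hsw
  rw [eg₁, eg₂]
  simp only [map_smul, LinearMap.smul_apply, map_add, LinearMap.add_apply,
    cliffordMulC_self, e22, hn, hsw']
  have key : ((c + d) / 2) * ((c + d) / 2) +
      (Complex.I * (c - d) / 2) * (Complex.I * (c - d) / 2) = 1 := by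
    linear_combination hcd + ((c - d) ^ 2 / 4) * hI
  match_scalars
  · linear_combination -key
  · ring

theorem isInternal_of_two {M : Type*} [AddCommGroup M] [Module ℂ M]
    {A : ℕ × ℕ → Submodule ℂ M} (h0 : ∀ p q, p + q ≠ 1 → A (p, q) = ⊥)
    (hd : ∀ x ∈ A (1, 0), x ∈ A (0, 1) → x = 0)
    (ht : ∀ x, ∃ y z, y ∈ A (1, 0) ∧ z ∈ A (0, 1) ∧ x = y + z) : DirectSum.IsInternal A := by
  rw [DirectSum.isInternal_submodule_iff_iSupIndep_and_iSup_eq_top]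
  have hor : ∀ p q : ℕ, p + q = 1 → (p, q) = (1, 0) ∨ (p, q) = (0, 1) := by
    intro p q hpq
    simp only [Prod.mk.injEq]
    omega
  constructor
  · rintro ⟨p, q⟩
    by_cases hpq : p + q = 1
    · rcases hor p q hpq with e | e <;> rw [e]
      · refine (Submodule.disjoint_def.2 hd).mono_right (iSup₂_le ?_)
        rintro ⟨r, s⟩ hrs
        by_cases h1 : r + s = 1
        · rw [(hor r s h1).resolve_left hrs]
        · rw [h0 r s h1]; exact bot_le
      · refine (Submodule.disjoint_def.2 hd).symm.mono_right (iSup₂_le ?_)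
        rintro ⟨r, s⟩ hrs
        by_cases h1 : r + s = 1
        · rw [(hor r s h1).resolve_right hrs]
        · rw [h0 r s h1]; exact bot_le
    · rw [h0 p q hpq]; exact disjoint_bot_left
  · rw [eq_top_iff]
    intro x _
    obtain ⟨y, z, hy, hz, rfl⟩ := ht x
    exact Submodule.add_mem _ (Submodule.mem_iSup_of_mem _ hy) (Submodule.mem_iSup_of_mem _ hz)

/-- The weight one Hodge structure `h_s` on `C⁺(Q)` attached to the Kuga-Satake element `J`:
`a + bi` acts on `C⁺(Q)_ℝ` as multiplication `x ↦ (a - bJ) x`, so that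
`C⁺(Q)^{p,q} = {x | (a - bJ) x = z^p (conj z)^q x for all z = a + bi ≠ 0}`. -/
noncomputable def kugaSatake (h : HodgeStructure V 2) (Q : LinearMap.BilinForm ℚ V)
    (hQ : h.IsPolarization Q) (h20 : Module.finrank ℂ (h.comp 2 0) = 1) :
    HodgeStructure (EvenClifford Q) 1 where
  comp p q :=
    { carrier := {x | ∀ z : ℂ, z ≠ 0 →
        ((z.re : ℂ) • (1 : ℂ ⊗[ℚ] EvenClifford Q) -
          (z.im : ℂ) • (exists_isKugaSatakeElement hQ h20).choose) * x =
          (z ^ p * (starRingEnd ℂ z) ^ q) • x}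
      add_mem' := fun hx hy z hz => by rw [mul_add, smul_add, hx z hz, hy z hz]
      zero_mem' := fun z _ => by simp
      smul_mem' := fun c x hx z hz => by rw [mul_smul_comm, hx z hz, smul_comm] }
  comp_eq_bot := by
    intro p q hpq
    rw [eq_bot_iff]
    intro x hx
    have h2 := hx 2 two_ne_zero
    simp only [Complex.re_ofNat, Complex.im_ofNat, Complex.ofReal_zero, zero_smul, sub_zero,
      smul_mul_assoc, one_mul, map_ofNat, Complex.ofReal_ofNat, ← pow_add] at h2
    have h3 : ((2 : ℂ) - 2 ^ (p + q)) • x = 0 := by rw [sub_smul, h2, sub_self]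
    rcases smul_eq_zero.1 h3 with h4 | h4
    · exfalso
      have h5 : (2 : ℕ) ^ 1 = 2 ^ (p + q) := by
        have := sub_eq_zero.1 h4
        rw [pow_one]
        exact_mod_cast this
      exact hpq (Nat.pow_right_injective le_rfl h5).symm
    · exact h4
  isInternal := by
    set J := (exists_isKugaSatakeElement hQ h20).choose with hJdef
    have hJ : J * J = -1 := (exists_isKugaSatakeElement hQ h20).choose_spec.mul_self hQ
    apply isInternal_of_two
    · intro p q hpq
      rw [eq_bot_iff]
      intro x hx
      have h2 := hx 2 two_ne_zero
      simp only [Complex.re_ofNat, Complex.im_ofNat, Complex.ofReal_zero, zero_smul, sub_zero,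
        smul_mul_assoc, one_mul, map_ofNat, Complex.ofReal_ofNat, ← pow_add] at h2
      have h3 : ((2 : ℂ) - 2 ^ (p + q)) • x = 0 := by rw [sub_smul, h2, sub_self]
      rcases smul_eq_zero.1 h3 with h4 | h4
      · exfalso
        have h5 : (2 : ℕ) ^ 1 = 2 ^ (p + q) := by
          have := sub_eq_zero.1 h4
          rw [pow_one]
          exact_mod_cast this
        exact hpq (Nat.pow_right_injective le_rfl h5).symm
      · exact h4
    · intro x hx hx'
      have h1 := hx Complex.I Complex.I_ne_zero
      have h2 := hx' Complex.I Complex.I_ne_zero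
      rw [h1] at h2
      simp only [pow_one, pow_zero, mul_one, one_mul, Complex.conj_I] at h2
      have h3 : (2 * Complex.I) • x = 0 := by
        rw [two_mul, add_smul]
        nth_rw 1 [h2]
        rw [neg_smul, neg_add_cancel]
      exact (smul_eq_zero.1 h3).resolve_left (by simp)
    · intro x
      have e1 : ∀ z : ℂ, (z.re : ℂ) + z.im * Complex.I = z := Complex.re_add_im
      have e2 : ∀ z : ℂ, (z.re : ℂ) - z.im * Complex.I = starRingEnd ℂ z := fun z => by
        apply Complex.ext <;> simp
      refine ⟨(1 / 2 : ℂ) • (x + Complex.I • (J * x)), (1 / 2 : ℂ) • (x - Complex.I • (J * x)),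
        ?_, ?_, by module⟩
      · intro z _
        rw [pow_one, pow_zero, mul_one]
        have : J * (J * x) = -x := by rw [← mul_assoc, hJ, neg_one_mul]
        simp only [sub_mul, smul_mul_assoc, one_mul, mul_smul_comm, mul_add, this]
        match_scalars
        · linear_combination (1 / 2 : ℂ) * e1 z
        · linear_combination (Complex.I / 2) * e1 z - ((z.im : ℂ) / 2) * Complex.I_mul_I
      · intro z _
        rw [pow_one, pow_zero, one_mul]
        have : J * (J * x) = -x := by rw [← mul_assoc, hJ, neg_one_mul]
        simp only [sub_mul, smul_mul_assoc, one_mul, mul_smul_comm, mul_sub, this]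
        rw [← e2 z]
        match_scalars
        · ring
        · linear_combination (-(z.im : ℂ) / 2) * Complex.I_mul_I
  conj_mem := by
    intro p q x hx z hz
    have hJ := (exists_isKugaSatakeElement hQ h20).choose_spec.conj
    have h1 := congrArg (conjC _) (hx z hz)
    have hone : conjC (EvenClifford Q) 1 = 1 := by
      rw [Algebra.TensorProduct.one_def, conjC_tmul, map_one]
    rw [conjC_mul, map_sub, conjC_smul, conjC_smul, conjC_smul, hJ, hone, Complex.conj_ofReal,
      Complex.conj_ofReal, map_mul, map_pow, map_pow, Complex.conj_conj,
      mul_comm (starRingEnd ℂ z ^ p)] at h1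
    exact h1

end KugaSatake

/-! ### Hodge structures with an action of an imaginary quadratic field -/

/-- `(V, Q)` satisfies the discriminant condition with respect to `K`: the `K`-Hermitian form
`H` on `V` with `H(v,v) = Q(v,v)` has an orthogonal basis `b₁, …, b_m` such that
`-∏ H(bᵢ,bᵢ)` is a norm from `K`, i.e. `-det H` is trivial in `ℚ^* / N(K^*)`. The vectors
`v`, `w` are orthogonal for `H` if and only if `Q(x v, w) = 0` for all `x ∈ K`. -/
def NegDiscIsNorm (K : Type*) {V : Type*} [Field K] [Algebra ℚ K] [AddCommGroup V] [Module ℚ V]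
    [Module K V] (Q : LinearMap.BilinForm ℚ V) (m : ℕ) : Prop :=
  ∃ b : Module.Basis (Fin m) K V,
    (∀ i j, i ≠ j → ∀ x : K, Q (x • b i) (b j) = 0) ∧
    ∃ c : K, Algebra.norm ℚ c = -∏ i, Q (b i) (b i)

/-- The action of `x ∈ K` on a `K`-vector space `V`, as a `ℚ`-linear map. -/
noncomputable def kAct {K : Type*} (V : Type*) [Field K] [Algebra ℚ K] [AddCommGroup V] [Module ℚ V]
    [Module K V] [IsScalarTower ℚ K V] (x : K) : V →ₗ[ℚ] V :=
  Algebra.lsmul ℚ ℚ V x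

/-- For an embedding `σ : K → ℂ`, the subspace of `V_ℂ` on which `K` acts through `σ`. -/
noncomputable def eigenspaceC {K : Type*} (V : Type*) [Field K] [Algebra ℚ K] [AddCommGroup V] [Module ℚ V]
    [Module K V] [IsScalarTower ℚ K V] (σ : K →+* ℂ) : Submodule ℂ (ℂ ⊗[ℚ] V) :=
  ⨅ x : K, LinearMap.eqLocus ((kAct V x).baseChange ℂ) (σ x • LinearMap.id)

/-- The value at `x ∈ V_ℂ` of the polynomial `P` in the coordinates on `V_ℂ` given by a
`ℚ`-basis `b` of `V`. -/
noncomputable def evalC {V : Type*} [AddCommGroup V] [Module ℚ V] {n : ℕ}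
    (b : Module.Basis (Fin n) ℚ V) (P : MvPolynomial (Fin n) ℂ) (x : ℂ ⊗[ℚ] V) : ℂ :=
  MvPolynomial.eval (fun i => (b.baseChange ℂ).repr x i) P

/-- `E` is a countable set of homogeneous polynomial functions on `V_ℂ`, none of which vanishes
identically on a `K`-eigenspace `V_{ℂ,σ}`. The weight two Hodge structures with
`dim V^{2,0} = 1`, polarized by `Q`, for which `K` acts by Hodge endomorphisms, are parametrized
by `V^{2,0}`, a point of an open subset of `ℙ(V_{ℂ,σ})` for one of the two embeddings `σ` of `K`.
So `E` cuts out countably many proper analytic subsets of the space of these structures. -/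
def IsExceptionalFamily (K : Type*) {V : Type*} [Field K] [Algebra ℚ K] [AddCommGroup V]
    [Module ℚ V] [Module K V] [IsScalarTower ℚ K V] {n : ℕ} (b : Module.Basis (Fin n) ℚ V)
    (E : Set (MvPolynomial (Fin n) ℂ)) : Prop :=
  E.Countable ∧ ∀ P ∈ E, (∃ d, P.IsHomogeneous d) ∧
    ∀ σ : K →+* ℂ, ∃ ω ∈ eigenspaceC V σ, evalC b P ω ≠ 0

/-- The weight two Hodge structure `h` is general with respect to `E`: its point `V^{2,0}` lies
on none of the hypersurfaces `P = 0`, `P ∈ E`. -/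
def HodgeStructure.IsGeneral {V : Type*} [AddCommGroup V] [Module ℚ V] {n : ℕ}
    (h : HodgeStructure V 2) (b : Module.Basis (Fin n) ℚ V)
    (E : Set (MvPolynomial (Fin n) ℂ)) : Prop :=
  ∀ P ∈ E, ∀ ω ∈ h.comp 2 0, ω ≠ 0 → evalC b P ω ≠ 0

/-! Write K = ℚ(δ) with δ² = -d and conjugation τ, and choose an H-orthogonal basis b_j with h_j =
H(b_j, b_j). The exterior algebra M of K^m, with K-basis e_I, is a Clifford module: x b_j acts as x
times creation plus τ(x) h_j times annihilation. The Kuga-Satake element J acts on M and makes it a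
weight one Hodge structure of ℚ-dimension 2^(m+1). If ω spans V^{2,0}, then M^{1,0} = ker c(ω) and
M^{0,1} = ker c(ω̄).

Since ω and ω̄ are eigenvectors of δ for opposite eigenvalues, J is a complex combination of
operators c(v)c(w) + d⁻¹c(δv)c(δw), the `CliffordRep.unitary` ones. Whatever commutes with these is
a Hodge endomorphism for every h (`PeriodVector.baseChange_cplx`). Three kinds of operators do: the
projections to the degrees, because each unitary operator creates one index and annihilates one; the
scalars of K; and a τ-semilinear star operator, which sends e_I to a multiple of e_{Iᶜ}. So S_i is
taken to be the part of degree i, K acts on it, and star gives S_i ≅ S_{m-i}.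

C⁺(Q) is mapped to M^(2^(m-2)) by acting on 2^(m-2) suitable vectors. The map is onto because the
even Clifford algebra moves basis vectors around freely within a parity and isolates them up to
complement, and it is bijective by dimension (`HermBasis.isIso_kugaSatake`). The embedding of V is v
↦ 1 ⊗ c(v)1 + d⁻¹ δ ⊗ c(δv)1. On a k-eigenvector a of δ it becomes vac_k ⊗ c(a)1 with c(a) vac_k =
0, from which the Hodge types are read off.

Simplicity rests on ranks rather than on Mumford-Tate groups. A rational U is a sub-Hodge structure
only if rank c(ω)|U + rank c(ω̄)|U ≤ dim U. Ranks are bounded below by the nonvanishing of rational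
minors, of which there are countably many, so for general h the rank at ω is maximal on its
eigenspace, and the inequality holds for all pairs ω', η from the two eigenspaces. If ω' and η pair
nontrivially, ker c(ω') and ker c(η) meet in 0, so the inequality forces U to split and to be stable
under c(η)c(ω'). Hence U is stable under all unitary operators (`mem_of_rankC_le`).

Among the unitary operators are θ_j, acting on e_I by δ or -δ as j is in I or not. They separate the
e_I except e_I from e_{Iᶜ}. So a nonzero stable subspace of S_i is everything, or 2i = m and it
contains the image of 1 + star∘t for some t ∈ K (`HermBasis.IsStable.dichotomy`). That image is
proper only if (star∘t)² = N(t)·(-1)^{m(m-1)/2}∏h_j equals 1. Exactly one h_j is negative by the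
polarization, and norms from K are nonnegative, which excludes m ≡ 0 mod 4. For m ≡ 2 mod 4 the
equation says that -∏h_j is a norm, and then the fixed part of the involution star∘t is S'_l. -/

set_option linter.unusedSectionVars false

/-! ### Imaginary quadratic fields -/

/-- The structure of an imaginary quadratic field `K = ℚ(δ)`, `δ² = -d`, with conjugation `τ`. -/
structure ImagQuad (K : Type*) [Field K] [Algebra ℚ K] where
  τ : K ≃ₐ[ℚ] K
  δ : K
  d : ℚ
  d_pos : 0 < d
  δ_mul_δ : δ * δ = algebraMap ℚ K (-d)
  τ_δ : τ δ = -δ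
  τ_τ : ∀ x, τ (τ x) = x
  norm_eq : ∀ x, algebraMap ℚ K (Algebra.norm ℚ x) = x * τ x
  exists_eq : ∀ x, ∃ p q : ℚ, x = algebraMap ℚ K p + algebraMap ℚ K q * δ

theorem exists_imagQuad {K : Type v} [Field K] [NumberField K] [NumberField.IsTotallyComplex K]
    (hK : Module.finrank ℚ K = 2) : Nonempty (ImagQuad K) := by
  have : Algebra.IsQuadraticExtension ℚ K := ⟨hK⟩
  have hcard : Nat.card Gal(K/ℚ) = 2 := by rw [IsGalois.card_aut_eq_finrank, hK]
  obtain ⟨τ, hτ⟩ : ∃ τ : Gal(K/ℚ), τ ≠ 1 := by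
    have : Nontrivial Gal(K/ℚ) := by
      rw [← Finite.one_lt_card_iff_nontrivial, hcard]; norm_num
    exact exists_ne 1
  have hττ : τ * τ = 1 := by
    have := pow_card_eq_one' (x := τ)
    rwa [hcard, pow_two] at this
  have hττ' : ∀ x, τ (τ x) = x := fun x => by
    rw [← AlgEquiv.mul_apply, hττ, AlgEquiv.one_apply]
  classical
  have huniv : (Finset.univ : Finset Gal(K/ℚ)) = {1, τ} := by
    symm
    apply Finset.eq_univ_of_card
    rw [Finset.card_pair hτ.symm, ← Nat.card_eq_fintype_card, hcard]
  have hnorm : ∀ x, algebraMap ℚ K (Algebra.norm ℚ x) = x * τ x := fun x => by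
    rw [Algebra.norm_eq_prod_automorphisms, huniv, Finset.prod_pair hτ.symm, AlgEquiv.one_apply]
  have htrace : ∀ x, algebraMap ℚ K (Algebra.trace ℚ K x) = x + τ x := fun x => by
    rw [trace_eq_sum_automorphisms, huniv, Finset.sum_pair hτ.symm, AlgEquiv.one_apply]
  obtain ⟨y, hy⟩ : ∃ y, τ y ≠ y := by
    by_contra! hcon
    exact hτ (AlgEquiv.ext hcon)
  set δ := y - τ y with hδ
  have hδ0 : δ ≠ 0 := sub_ne_zero.2 hy.symm
  have hτδ : τ δ = -δ := by rw [hδ, map_sub, hττ']; ring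
  have hsq : δ * δ = algebraMap ℚ K (-(Algebra.norm ℚ δ)) := by
    rw [map_neg, hnorm, hτδ]; ring
  have hfix : ∀ x, τ x = x → ∃ p : ℚ, algebraMap ℚ K p = x := fun x hx =>
    ⟨Algebra.trace ℚ K x / 2, by rw [map_div₀, htrace, hx, map_ofNat]; ring⟩
  have hex : ∀ x, ∃ p q : ℚ, x = algebraMap ℚ K p + algebraMap ℚ K q * δ := by
    intro x
    obtain ⟨p, hp⟩ := hfix ((x + τ x) / 2) (by
      rw [map_div₀, map_add, hττ', add_comm, map_ofNat])
    obtain ⟨q, hq⟩ := hfix ((x - τ x) / (2 * δ)) (by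
      simp only [map_div₀, map_sub, map_mul, map_ofNat, hττ', hτδ]; field_simp; ring)
    exact ⟨p, q, by rw [hp, hq]; field_simp; ring⟩
  refine ⟨⟨τ, δ, Algebra.norm ℚ δ, ?_, hsq, hτδ, hττ', hnorm, hex⟩⟩
  -- If N(δ) = -δ² were ≤ 0, δ would have a real image under every embedding, hence so would all of
  -- K, against total complexity.
  by_contra! hle
  obtain ⟨φ⟩ : Nonempty (K →+* ℂ) := inferInstance
  have hreal : starRingEnd ℂ (φ δ) = φ δ := by
    have h1 : φ δ * φ δ = ((-(Algebra.norm ℚ δ) : ℚ) : ℂ) := by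
      rw [← map_mul, hsq]; simp
    obtain ⟨r, hr⟩ : ∃ r : ℝ, r * r = ((-(Algebra.norm ℚ δ) : ℚ) : ℝ) :=
      ⟨_, Real.mul_self_sqrt (by exact_mod_cast (by linarith : (0 : ℚ) ≤ -(Algebra.norm ℚ δ)))⟩
    have h2 : φ δ * φ δ = (r : ℂ) * r := by
      rw [h1]; rw [← Complex.ofReal_mul, hr]; simp
    rcases mul_self_eq_mul_self_iff.1 h2 with h3 | h3 <;> rw [h3] <;> simp
  have : NumberField.ComplexEmbedding.IsReal φ := by
    rw [NumberField.ComplexEmbedding.isReal_iff]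
    ext x
    obtain ⟨p, q, rfl⟩ := hex x
    simp [NumberField.ComplexEmbedding.conjugate, hreal]
  have h1 := NumberField.IsTotallyComplex.isComplex (NumberField.InfinitePlace.mk φ)
  rw [NumberField.InfinitePlace.isComplex_mk_iff] at h1
  exact h1 this

/-! ### Weight one Hodge structures from complex structures -/

namespace HodgeStructure

variable {X Y : Type*} [AddCommGroup X] [Module ℚ X] [AddCommGroup Y] [Module ℚ Y]

/-- The weight one Hodge structure for which `a + bi` acts on `X_ℝ` as `a - bJ`, where `J² = -1`. -/
noncomputable def ofComplexStructure (J : Module.End ℂ (ℂ ⊗[ℚ] X)) (hJ : J * J = -1)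
    (hc : ∀ x, conjC X (J x) = J (conjC X x)) : HodgeStructure X 1 where
  comp p q :=
    { carrier := {x | ∀ z : ℂ, z ≠ 0 →
        (z.re : ℂ) • x - (z.im : ℂ) • J x = (z ^ p * (starRingEnd ℂ z) ^ q) • x}
      add_mem' := fun {x y} hx hy z hz => by
        rw [map_add, smul_add (z ^ p * (starRingEnd ℂ z) ^ q), ← hx z hz, ← hy z hz]; module
      zero_mem' := fun z _ => by simp
      smul_mem' := fun c x hx z hz => by
        rw [map_smul, smul_comm (z ^ p * (starRingEnd ℂ z) ^ q), ← hx z hz]; module }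
  comp_eq_bot := by
    intro p q hpq
    rw [eq_bot_iff]
    intro x hx
    -- At the real point z = 2 the condition reads 2x = 2^(p+q) x, which fixes the weight.
    have h2 := hx 2 two_ne_zero
    simp only [Complex.re_ofNat, Complex.im_ofNat, Complex.ofReal_zero, zero_smul, sub_zero,
      map_ofNat, Complex.ofReal_ofNat, ← pow_add] at h2
    have h3 : ((2 : ℂ) - 2 ^ (p + q)) • x = 0 := by rw [sub_smul, h2, sub_self]
    rcases smul_eq_zero.1 h3 with h4 | h4
    · exfalso
      have h5 : (2 : ℕ) ^ 1 = 2 ^ (p + q) := by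
        have := sub_eq_zero.1 h4
        rw [pow_one]
        exact_mod_cast this
      exact hpq (Nat.pow_right_injective le_rfl h5).symm
    · exact h4
  isInternal := by
    have hJJ : ∀ x, J (J x) = -x := fun x => by rw [← Module.End.mul_apply, hJ]; simp
    apply isInternal_of_two
    · intro p q hpq
      rw [eq_bot_iff]
      intro x hx
      have h2 := hx 2 two_ne_zero
      simp only [Complex.re_ofNat, Complex.im_ofNat, Complex.ofReal_zero, zero_smul, sub_zero,
        map_ofNat, Complex.ofReal_ofNat, ← pow_add] at h2
      have h3 : ((2 : ℂ) - 2 ^ (p + q)) • x = 0 := by rw [sub_smul, h2, sub_self]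
      rcases smul_eq_zero.1 h3 with h4 | h4
      · exfalso
        have h5 : (2 : ℕ) ^ 1 = 2 ^ (p + q) := by
          have := sub_eq_zero.1 h4
          rw [pow_one]
          exact_mod_cast this
        exact hpq (Nat.pow_right_injective le_rfl h5).symm
      · exact h4
    · intro x hx hx'
      have h1 := hx Complex.I Complex.I_ne_zero
      have h2 := hx' Complex.I Complex.I_ne_zero
      rw [h1] at h2
      simp only [pow_one, pow_zero, mul_one, one_mul, Complex.conj_I] at h2
      have h3 : (2 * Complex.I) • x = 0 := by
        rw [two_mul, add_smul]
        nth_rw 1 [h2]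
        rw [neg_smul, neg_add_cancel]
      exact (smul_eq_zero.1 h3).resolve_left (by simp)
    · intro x
      have e1 : ∀ z : ℂ, (z.re : ℂ) + z.im * Complex.I = z := Complex.re_add_im
      have e2 : ∀ z : ℂ, (z.re : ℂ) - z.im * Complex.I = starRingEnd ℂ z := fun z => by
        apply Complex.ext <;> simp
      -- The projectors (1 ± iJ)/2 onto the eigenspaces J = -i, of type (1,0), and J = i, of type
      -- (0,1).
      refine ⟨(1 / 2 : ℂ) • (x + Complex.I • J x), (1 / 2 : ℂ) • (x - Complex.I • J x),
        ?_, ?_, by module⟩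
      · intro z _
        rw [pow_one, pow_zero, mul_one]
        simp only [map_smul, map_add, hJJ]
        match_scalars
        · linear_combination (1 / 2 : ℂ) * e1 z
        · linear_combination (Complex.I / 2) * e1 z - ((z.im : ℂ) / 2) * Complex.I_mul_I
      · intro z _
        rw [pow_one, pow_zero, one_mul]
        simp only [map_smul, map_sub, hJJ]
        rw [← e2 z]
        match_scalars
        · ring
        · linear_combination (-(z.im : ℂ) / 2) * Complex.I_mul_I
  conj_mem := by
    intro p q x hx z hz
    have h1 := congrArg (conjC _) (hx z hz)
    rw [map_sub, conjC_smul, conjC_smul, conjC_smul, hc, Complex.conj_ofReal,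
      Complex.conj_ofReal, map_mul, map_pow, map_pow, Complex.conj_conj,
      mul_comm (starRingEnd ℂ z ^ p)] at h1
    exact h1

variable {J : Module.End ℂ (ℂ ⊗[ℚ] X)} {hJ : J * J = -1}
  {hc : ∀ x, conjC X (J x) = J (conjC X x)}

theorem mem_ofComplexStructure {p q : ℕ} {x : ℂ ⊗[ℚ] X} :
    x ∈ (ofComplexStructure J hJ hc).comp p q ↔ ∀ z : ℂ, z ≠ 0 →
      (z.re : ℂ) • x - (z.im : ℂ) • J x = (z ^ p * (starRingEnd ℂ z) ^ q) • x := Iff.rfl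

theorem mem_ofComplexStructure_one_zero {x : ℂ ⊗[ℚ] X} :
    x ∈ (ofComplexStructure J hJ hc).comp 1 0 ↔ J x = -Complex.I • x := by
  rw [mem_ofComplexStructure]
  constructor
  · intro h
    have := h Complex.I Complex.I_ne_zero
    simp only [Complex.I_re, Complex.I_im, Complex.ofReal_zero, zero_smul, Complex.ofReal_one,
      one_smul, pow_one, pow_zero, mul_one, zero_sub] at this
    rw [neg_smul, ← this, neg_neg]
  · intro h z _
    rw [h, pow_one, pow_zero, mul_one]
    match_scalars
    linear_combination Complex.re_add_im z

theorem mem_ofComplexStructure_zero_one {x : ℂ ⊗[ℚ] X} :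
    x ∈ (ofComplexStructure J hJ hc).comp 0 1 ↔ J x = Complex.I • x := by
  rw [mem_ofComplexStructure]
  constructor
  · intro h
    have := h Complex.I Complex.I_ne_zero
    simp only [Complex.I_re, Complex.I_im, Complex.ofReal_zero, zero_smul, Complex.ofReal_one,
      one_smul, pow_one, pow_zero, one_mul, zero_sub, Complex.conj_I] at this
    rw [← neg_neg (J x), this, neg_smul, neg_neg]
  · intro h z _
    have e2 : (z.re : ℂ) - z.im * Complex.I = starRingEnd ℂ z := by
      apply Complex.ext <;> simp
    rw [h, pow_one, pow_zero, one_mul]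
    match_scalars
    linear_combination e2

theorem isHom_ofComplexStructure {J' : Module.End ℂ (ℂ ⊗[ℚ] Y)} {hJ' : J' * J' = -1}
    {hc' : ∀ x, conjC Y (J' x) = J' (conjC Y x)} {f : X →ₗ[ℚ] Y}
    (hf : ∀ x, f.baseChange ℂ (J x) = J' (f.baseChange ℂ x)) :
    (ofComplexStructure J hJ hc).IsHom (ofComplexStructure J' hJ' hc') f := by
  intro p q x hx
  rw [mem_ofComplexStructure] at hx ⊢
  intro z hz
  rw [← map_smul _ (z ^ p * _), ← hx z hz, map_sub, map_smul, map_smul, hf]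

theorem isSub_ofComplexStructure {U : Submodule ℚ X} (hU : (ofComplexStructure J hJ hc).IsSub U)
    {x : ℂ ⊗[ℚ] X} (hx : x ∈ U.baseChange ℂ) :
    ∃ y ∈ U.baseChange ℂ, ∃ z ∈ U.baseChange ℂ, J y = -Complex.I • y ∧ J z = Complex.I • z ∧
      x = y + z := by
  have h1 : U.baseChange ℂ ≤ (U.baseChange ℂ ⊓ (ofComplexStructure J hJ hc).comp 1 0) ⊔
      (U.baseChange ℂ ⊓ (ofComplexStructure J hJ hc).comp 0 1) := by
    rw [IsSub] at hU
    nth_rw 1 [hU]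
    refine iSup_le fun p => iSup_le fun q => ?_
    by_cases hpq : p + q = 1
    · have : p = 1 ∧ q = 0 ∨ p = 0 ∧ q = 1 := by omega
      rcases this with ⟨rfl, rfl⟩ | ⟨rfl, rfl⟩
      · exact le_sup_left
      · exact le_sup_right
    · rw [(ofComplexStructure J hJ hc).comp_eq_bot p q hpq, inf_bot_eq]
      exact bot_le
  obtain ⟨y, hy, z, hz, rfl⟩ := Submodule.mem_sup.1 (h1 hx)
  exact ⟨y, hy.1, z, hz.1, mem_ofComplexStructure_one_zero.1 hy.2,
    mem_ofComplexStructure_zero_one.1 hz.2, rfl⟩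

/-! ### Generalities on morphisms -/

variable {k l : ℕ}

/-- Strictness comes from the independence of the types in the target: the part of e⁻¹y outside type
(p,q) is sent both into type (p,q) and into the sum of the other types, so it vanishes. -/
theorem isHom_symm {h : HodgeStructure X k} {h' : HodgeStructure Y k} (e : X ≃ₗ[ℚ] Y)
    (he : h.IsHom h' e.toLinearMap) : h'.IsHom h e.symm.toLinearMap := by
  intro p q y hy
  have hinv : ∀ x, e.symm.toLinearMap.baseChange ℂ (e.toLinearMap.baseChange ℂ x) = x := by
    intro x
    rw [← LinearMap.comp_apply, ← LinearMap.baseChange_comp]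
    simp
  have hinv' : ∀ x, e.toLinearMap.baseChange ℂ (e.symm.toLinearMap.baseChange ℂ x) = x := by
    intro x
    rw [← LinearMap.comp_apply, ← LinearMap.baseChange_comp]
    simp
  have hind := ((DirectSum.isInternal_submodule_iff_iSupIndep_and_iSup_eq_top _).1 h'.isInternal).1
  have hx : e.symm.toLinearMap.baseChange ℂ y ∈
      h.comp p q ⊔ ⨆ (j : ℕ × ℕ) (_ : j ≠ (p, q)), h.comp j.1 j.2 := by
    have : (⊤ : Submodule ℂ (ℂ ⊗[ℚ] X)) ≤
        h.comp p q ⊔ ⨆ (j : ℕ × ℕ) (_ : j ≠ (p, q)), h.comp j.1 j.2 := by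
      rw [← h.iSup_comp]
      refine iSup_le fun j => ?_
      by_cases hj : j = (p, q)
      · subst hj; exact le_sup_left
      · exact le_sup_of_le_right (le_iSup₂_of_le j hj le_rfl)
    exact this trivial
  obtain ⟨x₁, h₁, x₂, h₂, h12⟩ := Submodule.mem_sup.1 hx
  have h2' : e.toLinearMap.baseChange ℂ x₂ ∈ ⨆ (j : ℕ × ℕ) (_ : j ≠ (p, q)), h'.comp j.1 j.2 := by
    have h3 := Submodule.mem_map_of_mem (f := e.toLinearMap.baseChange ℂ) h₂
    simp only [Submodule.map_iSup] at h3
    refine SetLike.le_def.1 (iSup₂_mono fun j _ => ?_) h3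
    rw [Submodule.map_le_iff_le_comap]
    exact fun z hz => he _ _ z hz
  have h4 : e.toLinearMap.baseChange ℂ x₂ = y - e.toLinearMap.baseChange ℂ x₁ := by
    rw [eq_sub_iff_add_eq', ← map_add, h12, hinv']
  have h5 : e.toLinearMap.baseChange ℂ x₂ = 0 := by
    refine Submodule.disjoint_def.1 (hind (p, q)) _ ?_ h2'
    rw [h4]
    exact Submodule.sub_mem _ hy (he _ _ _ h₁)
  have h6 : x₂ = 0 := by rw [← hinv x₂, h5, map_zero]
  rw [← h12, h6, add_zero]
  exact h₁

theorem isIso_of_isHom {h : HodgeStructure X k} {h' : HodgeStructure Y k} (e : X ≃ₗ[ℚ] Y)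
    (he : h.IsHom h' e.toLinearMap) : h.IsIso h' :=
  ⟨e, he, isHom_symm e he⟩

theorem isHom_pi {ι : Type*} [DecidableEq ι] [Fintype ι] {S : ι → Type*}
    [∀ i, AddCommGroup (S i)] [∀ i, Module ℚ (S i)] {h : HodgeStructure X k}
    {h' : ∀ i, HodgeStructure (S i) k} {f : X →ₗ[ℚ] (∀ i, S i)}
    (hf : ∀ i, h.IsHom (h' i) (LinearMap.proj i ∘ₗ f)) : h.IsHom (pi h') f := by
  intro p q x hx
  refine (Submodule.mem_iInf _).2 fun i => ?_
  have := hf i p q x hx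
  rw [LinearMap.baseChange_comp] at this
  exact this

end HodgeStructure

/-! ### Modules over the Clifford algebra and their complexification -/

section Clifford

variable {V M : Type*} [AddCommGroup V] [Module ℚ V] [AddCommGroup M] [Module ℚ M]

/-- The complexification `V_ℂ → End(M_ℂ)` of a linear map `V → End(M)`. -/
noncomputable def endC (c : V →ₗ[ℚ] Module.End ℚ M) :
    (ℂ ⊗[ℚ] V) →ₗ[ℂ] Module.End ℂ (ℂ ⊗[ℚ] M) :=
  LinearMap.liftBaseChange ℂ ((LinearMap.baseChangeHom ℚ ℂ M M).comp c)

theorem endC_tmul (c : V →ₗ[ℚ] Module.End ℚ M) (z : ℂ) (v : V) :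
    endC c (z ⊗ₜ v) = z • (c v).baseChange ℂ := by
  simp [endC]

theorem endC_tmul_tmul (c : V →ₗ[ℚ] Module.End ℚ M) (z t : ℂ) (v : V) (x : M) :
    endC c (z ⊗ₜ v) (t ⊗ₜ x) = (z * t) ⊗ₜ c v x := by
  rw [endC_tmul, LinearMap.smul_apply, LinearMap.baseChange_tmul, TensorProduct.smul_tmul',
    smul_eq_mul]

theorem conjC_endC (c : V →ₗ[ℚ] Module.End ℚ M) (x : ℂ ⊗[ℚ] V) (y : ℂ ⊗[ℚ] M) :
    conjC M (endC c x y) = endC c (conjC V x) (conjC M y) := by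
  induction x with
  | zero => simp
  | add x x' hx hx' => simp [hx, hx']
  | tmul z v =>
    induction y with
    | zero => simp
    | add y y' hy hy' => simp [hy, hy']
    | tmul t w => simp [endC_tmul_tmul]

/-- A module over the Clifford algebra of `v ↦ Q(v,v)`. -/
structure CliffordRep (Q : LinearMap.BilinForm ℚ V) (M : Type*) [AddCommGroup M] [Module ℚ M] where
  c : V →ₗ[ℚ] Module.End ℚ M
  anti : ∀ v w, c v * c w + c w * c v = (Q v w + Q w v) • 1

namespace CliffordRep

variable {Q : LinearMap.BilinForm ℚ V} (C : CliffordRep Q M)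

theorem anti_apply (v w : V) (x : M) :
    C.c v (C.c w x) + C.c w (C.c v x) = (Q v w + Q w v) • x := by
  simpa using LinearMap.congr_fun (C.anti v w) x

theorem sq_apply (v : V) (x : M) : C.c v (C.c v x) = Q v v • x := by
  have := C.anti_apply v v x
  rw [← two_smul ℚ, ← two_mul, mul_smul] at this
  exact smul_right_injective _ (two_ne_zero (α := ℚ)) this

theorem antiC (x y : ℂ ⊗[ℚ] V) (u : ℂ ⊗[ℚ] M) :
    endC C.c x (endC C.c y u) + endC C.c y (endC C.c x u) =
      (LinearMap.BilinForm.baseChange ℂ Q x y + LinearMap.BilinForm.baseChange ℂ Q y x) • u := by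
  induction x with
  | zero => simp
  | add x x' hx hx' =>
    simp only [map_add, LinearMap.add_apply]
    rw [add_add_add_comm, hx, hx', ← add_smul]
    congr 1
    ring
  | tmul z v =>
  induction y with
  | zero => simp
  | add y y' hy hy' =>
    simp only [map_add, LinearMap.add_apply]
    rw [add_add_add_comm, hy, hy', ← add_smul]
    congr 1
    ring
  | tmul t w =>
  induction u with
  | zero => simp
  | add u u' hu hu' =>
    simp only [map_add, smul_add]
    rw [add_add_add_comm, hu, hu']
  | tmul s u =>
    rw [endC_tmul_tmul, endC_tmul_tmul, endC_tmul_tmul, endC_tmul_tmul, ← mul_assoc, ← mul_assoc,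
      mul_comm t z, ← TensorProduct.tmul_add, C.anti_apply, LinearMap.BilinForm.baseChange_tmul,
      LinearMap.BilinForm.baseChange_tmul, TensorProduct.tmul_smul, TensorProduct.smul_tmul',
      TensorProduct.smul_tmul']
    congr 1
    simp only [smul_eq_mul, Algebra.smul_def, map_add, eq_ratCast]
    ring

/-- The action of the even Clifford algebra. -/
noncomputable def evenHom : EvenClifford Q →ₐ[ℚ] Module.End ℚ M :=
  (CliffordAlgebra.lift Q.toQuadraticMap ⟨C.c, fun v => by
    ext x
    rw [Module.End.mul_apply, C.sq_apply, Module.algebraMap_end_apply,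
      LinearMap.BilinMap.toQuadraticMap_apply]⟩).comp
    (CliffordAlgebra.even Q.toQuadraticMap).val

theorem evenHom_bilin (v w : V) :
    C.evenHom ((CliffordAlgebra.even.ι Q.toQuadraticMap).bilin v w) = C.c v * C.c w := by
  change CliffordAlgebra.lift Q.toQuadraticMap _ (CliffordAlgebra.ι _ v * CliffordAlgebra.ι _ w) = _
  rw [map_mul, CliffordAlgebra.lift_ι_apply, CliffordAlgebra.lift_ι_apply]

/-- The action on a vector, `x ↦ x s`. -/
noncomputable def evenAct (s : M) : EvenClifford Q →ₗ[ℚ] M :=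
  (LinearMap.applyₗ s).comp C.evenHom.toLinearMap

theorem evenAct_apply (s : M) (x : EvenClifford Q) : C.evenAct s x = C.evenHom x s := rfl

/-- Turns left multiplication in C⁺(Q)_ℂ, which defines the Kuga-Satake structure, into the Clifford
action on M_ℂ, where J can be compared with `PeriodVector.cplx`. -/
theorem evenActC (s : M) (a b : ℂ ⊗[ℚ] V) (y : ℂ ⊗[ℚ] EvenClifford Q) :
    (C.evenAct s).baseChange ℂ (cliffordMulC Q a b * y) =
      endC C.c a (endC C.c b ((C.evenAct s).baseChange ℂ y)) := by
  induction a with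
  | zero => simp
  | add a a' h h' => simp only [map_add, LinearMap.add_apply, add_mul, h, h']
  | tmul z v =>
  induction b with
  | zero => simp
  | add b b' h h' => simp only [map_add, LinearMap.add_apply, add_mul, h, h']
  | tmul t w =>
  induction y with
  | zero => simp
  | add y y' h h' => simp only [map_add, mul_add, h, h']
  | tmul r x =>
    rw [cliffordMulC, LinearMap.BilinMap.baseChange_tmul, Algebra.TensorProduct.tmul_mul_tmul,
      LinearMap.baseChange_tmul, LinearMap.baseChange_tmul, endC_tmul_tmul, endC_tmul_tmul,
      evenAct_apply, evenAct_apply, map_mul, evenHom_bilin]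
    congr 1
    ring

/-- The operators `c(v)c(w) + d⁻¹ c(δv)c(δw)`, which generate the image of the unitary Lie
algebra if `δ² = -d`. -/
noncomputable def unitary (D : V →ₗ[ℚ] V) (d : ℚ) (v w : V) : Module.End ℚ M :=
  C.c v * C.c w + d⁻¹ • (C.c (D v) * C.c (D w))

/-- `g` commutes with the image of the unitary Lie algebra. -/
def Commutes (D : V →ₗ[ℚ] V) (d : ℚ) (g : Module.End ℚ M) : Prop :=
  ∀ v w x, g (C.unitary D d v w x) = C.unitary D d v w (g x)

variable {C}

theorem Commutes.mul {D : V →ₗ[ℚ] V} {d : ℚ} {g g' : Module.End ℚ M} (h : C.Commutes D d g)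
    (h' : C.Commutes D d g') : C.Commutes D d (g * g') := fun v w x => by
  rw [Module.End.mul_apply, Module.End.mul_apply, h', h]

theorem Commutes.baseChange {D : V →ₗ[ℚ] V} {d : ℚ} {g : Module.End ℚ M} (hg : C.Commutes D d g)
    (a b : ℂ ⊗[ℚ] V) (u : ℂ ⊗[ℚ] M) :
    g.baseChange ℂ (endC C.c a (endC C.c b u) +
      (d⁻¹ : ℂ) • endC C.c (D.baseChange ℂ a) (endC C.c (D.baseChange ℂ b) u)) =
    endC C.c a (endC C.c b (g.baseChange ℂ u)) +
      (d⁻¹ : ℂ) • endC C.c (D.baseChange ℂ a) (endC C.c (D.baseChange ℂ b) (g.baseChange ℂ u)) := by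
  induction a with
  | zero => simp
  | add a a' h h' =>
    simp only [map_add, LinearMap.add_apply, smul_add] at h h' ⊢
    linear_combination (norm := module) h + h'
  | tmul z v =>
  induction b with
  | zero => simp
  | add b b' h h' =>
    simp only [map_add, LinearMap.add_apply, smul_add] at h h' ⊢
    linear_combination (norm := module) h + h'
  | tmul t w =>
  induction u with
  | zero => simp
  | add u u' h h' =>
    simp only [map_add, smul_add] at h h' ⊢
    linear_combination (norm := module) h + h'
  | tmul r x =>
    have key := congrArg (fun y : M => (z * (t * r)) ⊗ₜ[ℚ] y) (hg v w x)
    simp only [unitary, LinearMap.add_apply, LinearMap.smul_apply, Module.End.mul_apply, map_add,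
      map_smul, TensorProduct.tmul_add, TensorProduct.tmul_smul] at key
    have hd : ∀ y : ℂ ⊗[ℚ] M, (d⁻¹ : ℂ) • y = (d⁻¹ : ℚ) • y := fun y => by
      rw [← Rat.cast_inv, ← eq_ratCast (algebraMap ℚ ℂ), algebraMap_smul]
    simp only [LinearMap.baseChange_tmul, endC_tmul_tmul, map_add, hd,
      LinearMap.map_smul_of_tower]
    exact key

end CliffordRep

/-! ### Period vectors -/

/-- A period vector: an isotropic eigenvector `ω ∈ V_ℂ` of `δ` with `Q(ω, conj ω) = -2`. -/
structure PeriodVector (Q : LinearMap.BilinForm ℚ V) (D : V →ₗ[ℚ] V) (d : ℚ) where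
  ω : ℂ ⊗[ℚ] V
  l : ℂ
  l_mul_l : l * l = -d
  d_pos : 0 < d
  D_ω : D.baseChange ℂ ω = l • ω
  self : LinearMap.BilinForm.baseChange ℂ Q ω ω = 0
  conj : LinearMap.BilinForm.baseChange ℂ Q ω (conjC V ω) = -2
  conj' : LinearMap.BilinForm.baseChange ℂ Q (conjC V ω) ω = -2

theorem conj_of_mul_self {l : ℂ} {d : ℚ} (hd : 0 < d) (hl : l * l = -d) :
    starRingEnd ℂ l = -l := by
  have h1 : starRingEnd ℂ l * starRingEnd ℂ l = l * l := by
    rw [← map_mul, hl, map_neg]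
    simp
  rcases mul_self_eq_mul_self_iff.1 h1 with h2 | h2
  · exfalso
    obtain ⟨r, hr⟩ := Complex.conj_eq_iff_real.1 h2
    rw [hr] at hl
    have : r * r = -(d : ℝ) := by exact_mod_cast hl
    have hd' : (0 : ℝ) < d := by exact_mod_cast hd
    nlinarith [mul_self_nonneg r]
  · exact h2

namespace PeriodVector

variable {Q : LinearMap.BilinForm ℚ V} {D : V →ₗ[ℚ] V} {d : ℚ} (P : PeriodVector Q D d)

theorem conj_l : starRingEnd ℂ P.l = -P.l := conj_of_mul_self P.d_pos P.l_mul_l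

theorem D_conj : D.baseChange ℂ (conjC V P.ω) = -P.l • conjC V P.ω := by
  rw [← conjC_baseChange, P.D_ω, conjC_smul, P.conj_l]

theorem self' : LinearMap.BilinForm.baseChange ℂ Q (conjC V P.ω) (conjC V P.ω) = 0 := by
  rw [conjC_form, P.self, map_zero]

variable (C : CliffordRep Q M)

/-- The complex structure on `M_ℂ` given by the Kuga-Satake element. -/
noncomputable def cplx : Module.End ℂ (ℂ ⊗[ℚ] M) :=
  (-Complex.I / 4) • (endC C.c (conjC V P.ω) * endC C.c P.ω - endC C.c P.ω * endC C.c (conjC V P.ω))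

theorem cplx_apply (x : ℂ ⊗[ℚ] M) : P.cplx C x = (-Complex.I / 4) •
    (endC C.c (conjC V P.ω) (endC C.c P.ω x) - endC C.c P.ω (endC C.c (conjC V P.ω) x)) := rfl

theorem sq_ω (x : ℂ ⊗[ℚ] M) : endC C.c P.ω (endC C.c P.ω x) = 0 := by
  have := C.antiC P.ω P.ω x
  rw [P.self, add_zero, zero_smul, ← two_smul ℂ] at this
  exact (smul_eq_zero.1 this).resolve_left two_ne_zero

theorem sq_conj (x : ℂ ⊗[ℚ] M) : endC C.c (conjC V P.ω) (endC C.c (conjC V P.ω) x) = 0 := by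
  have := C.antiC (conjC V P.ω) (conjC V P.ω) x
  rw [P.self', add_zero, zero_smul, ← two_smul ℂ] at this
  exact (smul_eq_zero.1 this).resolve_left two_ne_zero

theorem anti_conj (x : ℂ ⊗[ℚ] M) : endC C.c P.ω (endC C.c (conjC V P.ω) x) =
    (-4 : ℂ) • x - endC C.c (conjC V P.ω) (endC C.c P.ω x) := by
  rw [eq_sub_iff_add_eq, C.antiC, P.conj, P.conj']
  norm_num

theorem cplx_mul_self : P.cplx C * P.cplx C = -1 := by
  refine LinearMap.ext fun x => ?_
  rw [Module.End.mul_apply, LinearMap.neg_apply, Module.End.one_apply]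
  simp only [cplx_apply, map_smul, map_sub, P.anti_conj, P.sq_ω, P.sq_conj, map_zero]
  match_scalars <;> first | ring1 | linear_combination Complex.I_mul_I

theorem conjC_cplx (x : ℂ ⊗[ℚ] M) : conjC M (P.cplx C x) = P.cplx C (conjC M x) := by
  simp only [cplx_apply, conjC_smul, map_sub, conjC_endC, conjC_conjC, map_div₀, map_neg,
    Complex.conj_I, map_ofNat]
  module

/-- For opposite eigenvalues c(Da)c(Db) = -l² c(a)c(b) = d c(a)c(b), so the complexified unitary
operator is just 2c(a)c(b). This is how products of eigenvectors are recognized as unitary. -/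
theorem endC_mul_endC {a b : ℂ ⊗[ℚ] V} {l : ℂ} (hl : l * l = -d) (hd : d ≠ 0)
    (ha : D.baseChange ℂ a = l • a) (hb : D.baseChange ℂ b = -l • b) (x : ℂ ⊗[ℚ] M) :
    endC C.c a (endC C.c b x) = (1 / 2 : ℂ) • (endC C.c a (endC C.c b x) +
      (d⁻¹ : ℂ) • endC C.c (D.baseChange ℂ a) (endC C.c (D.baseChange ℂ b) x)) := by
  have hd' : (d : ℂ) ≠ 0 := by exact_mod_cast hd
  rw [ha, hb]
  simp only [map_smul, LinearMap.smul_apply]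
  match_scalars
  field_simp
  linear_combination hl

/-- J is a combination of c(ω̄)c(ω) and c(ω)c(ω̄), each a unitary operator by `endC_mul_endC`. All
Hodge endomorphisms and all isomorphisms between summands are obtained from this. -/
theorem baseChange_cplx {g : Module.End ℚ M} (hg : C.Commutes D d g) (x : ℂ ⊗[ℚ] M) :
    g.baseChange ℂ (P.cplx C x) = P.cplx C (g.baseChange ℂ x) := by
  have hd := P.d_pos.ne'
  have hl' : -P.l * -P.l = -d := by rw [neg_mul_neg, P.l_mul_l]
  have h1 := fun x => endC_mul_endC C P.l_mul_l hd P.D_ω P.D_conj x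
  have h2 := fun x => endC_mul_endC C hl' hd P.D_conj (by rw [P.D_ω, neg_neg]) x
  rw [cplx_apply, cplx_apply, h1, h2, h1 (g.baseChange ℂ x), h2 (g.baseChange ℂ x)]
  simp only [map_smul, map_sub, hg.baseChange]

/-- The relation c(ω)c(ω̄) + c(ω̄)c(ω) = -4 gives J = -i - (i/2) c(ω̄)c(ω), and also c(ω)J = i c(ω).
Membership in a Hodge type thereby becomes a linear condition on ω, which the rank argument needs.
-/
theorem cplx_eq_neg_I_iff (x : ℂ ⊗[ℚ] M) :
    P.cplx C x = -Complex.I • x ↔ endC C.c P.ω x = 0 := by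
  constructor
  · intro h
    have h2 := congrArg (endC C.c P.ω) h
    simp only [cplx_apply, map_smul, map_sub, P.anti_conj, P.sq_ω, map_zero] at h2
    have h3 : (2 * Complex.I) • endC C.c P.ω x = 0 := by
      linear_combination (norm := module) h2
    exact (smul_eq_zero.1 h3).resolve_left (by simp)
  · intro h
    rw [cplx_apply, P.anti_conj, h]
    simp only [map_zero]
    module

theorem cplx_eq_I_iff (x : ℂ ⊗[ℚ] M) :
    P.cplx C x = Complex.I • x ↔ endC C.c (conjC V P.ω) x = 0 := by
  constructor
  · intro h
    have h2 := congrArg (endC C.c (conjC V P.ω)) h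
    simp only [cplx_apply, map_smul, map_sub, P.anti_conj, P.sq_conj] at h2
    have h3 : (2 * Complex.I) • endC C.c (conjC V P.ω) x = 0 := by
      linear_combination (norm := module) (-1 : ℂ) • h2
    exact (smul_eq_zero.1 h3).resolve_left (by simp)
  · intro h
    rw [cplx_apply, P.anti_conj]
    have h2 := P.anti_conj C x
    rw [h, map_zero] at h2
    have h3 : endC C.c (conjC V P.ω) (endC C.c P.ω x) = (-4 : ℂ) • x := by
      linear_combination (norm := module) h2
    rw [h3]
    module

end PeriodVector

/-! ### Hodge structures on direct summands -/

/-- `X` is a direct summand of `M`. -/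
structure Retract (M X : Type*) [AddCommGroup M] [Module ℚ M] [AddCommGroup X] [Module ℚ X] where
  ι : X →ₗ[ℚ] M
  π : M →ₗ[ℚ] X
  π_ι : ∀ x, π (ι x) = x

namespace Retract

variable {X Y : Type*} [AddCommGroup X] [Module ℚ X] [AddCommGroup Y] [Module ℚ Y]
  (R : Retract M X) (R' : Retract M Y)

/-- The idempotent of `M` with image `X`. -/
noncomputable def proj : Module.End ℚ M := R.ι ∘ₗ R.π

theorem proj_apply (x : M) : R.proj x = R.ι (R.π x) := rfl

theorem πC_ιC (x : ℂ ⊗[ℚ] X) : R.π.baseChange ℂ (R.ι.baseChange ℂ x) = x := by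
  rw [← LinearMap.comp_apply, ← LinearMap.baseChange_comp]
  have : R.π ∘ₗ R.ι = LinearMap.id := LinearMap.ext R.π_ι
  rw [this, LinearMap.baseChange_id, LinearMap.id_apply]

theorem ιC_πC (x : ℂ ⊗[ℚ] M) :
    R.ι.baseChange ℂ (R.π.baseChange ℂ x) = R.proj.baseChange ℂ x := by
  rw [← LinearMap.comp_apply, ← LinearMap.baseChange_comp, proj]

theorem ι_injective : Function.Injective R.ι := Function.LeftInverse.injective R.π_ι

variable {Q : LinearMap.BilinForm ℚ V} {D : V →ₗ[ℚ] V} {d : ℚ} (P : PeriodVector Q D d)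
  (C : CliffordRep Q M)

/-- The complex structure on `X_ℂ`. -/
noncomputable def cplx : Module.End ℂ (ℂ ⊗[ℚ] X) :=
  R.π.baseChange ℂ ∘ₗ P.cplx C ∘ₗ R.ι.baseChange ℂ

variable {C} (hR : C.Commutes D d R.proj) (hR' : C.Commutes D d R'.proj)

include hR in
theorem ιC_cplx (x : ℂ ⊗[ℚ] X) :
    R.ι.baseChange ℂ (R.cplx P C x) = P.cplx C (R.ι.baseChange ℂ x) := by
  rw [cplx, LinearMap.comp_apply, LinearMap.comp_apply, R.ιC_πC, P.baseChange_cplx C hR,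
    ← R.ιC_πC, R.πC_ιC]

include hR in
theorem πC_cplx (x : ℂ ⊗[ℚ] M) :
    R.π.baseChange ℂ (P.cplx C x) = R.cplx P C (R.π.baseChange ℂ x) := by
  rw [cplx, LinearMap.comp_apply, LinearMap.comp_apply, R.ιC_πC, ← P.baseChange_cplx C hR,
    ← R.ιC_πC, R.πC_ιC]

include hR in
theorem cplx_mul_self : R.cplx P C * R.cplx P C = -1 := by
  refine LinearMap.ext fun x => ?_
  rw [Module.End.mul_apply, ← R.πC_ιC (R.cplx P C (R.cplx P C x)), R.ιC_cplx P hR,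
    R.ιC_cplx P hR, ← Module.End.mul_apply, P.cplx_mul_self]
  simp [R.πC_ιC]

theorem conjC_cplx (x : ℂ ⊗[ℚ] X) : conjC X (R.cplx P C x) = R.cplx P C (conjC X x) := by
  simp only [cplx, LinearMap.comp_apply, conjC_baseChange, P.conjC_cplx]

/-- The weight one Hodge structure on the summand `X` of `M`. -/
noncomputable def hodge : HodgeStructure X 1 :=
  HodgeStructure.ofComplexStructure (R.cplx P C) (R.cplx_mul_self P hR) (R.conjC_cplx P)

theorem isHom_hodge {g : Module.End ℚ M} (hg : C.Commutes D d g) :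
    (R.hodge P hR).IsHom (R'.hodge P hR') (R'.π ∘ₗ g ∘ₗ R.ι) := by
  refine HodgeStructure.isHom_ofComplexStructure fun x => ?_
  simp only [LinearMap.baseChange_comp, LinearMap.comp_apply]
  rw [R.ιC_cplx P hR, P.baseChange_cplx C hg, R'.πC_cplx P hR']

theorem mem_hodge_one_zero {x : ℂ ⊗[ℚ] X} :
    x ∈ (R.hodge P hR).comp 1 0 ↔ endC C.c P.ω (R.ι.baseChange ℂ x) = 0 := by
  rw [hodge, HodgeStructure.mem_ofComplexStructure_one_zero, ← P.cplx_eq_neg_I_iff,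
    ← R.ιC_cplx P hR, ← map_smul]
  constructor
  · intro h; rw [h]
  · intro h; rw [← R.πC_ιC (R.cplx P C x), h, R.πC_ιC]

theorem mem_hodge_zero_one {x : ℂ ⊗[ℚ] X} :
    x ∈ (R.hodge P hR).comp 0 1 ↔ endC C.c (conjC V P.ω) (R.ι.baseChange ℂ x) = 0 := by
  rw [hodge, HodgeStructure.mem_ofComplexStructure_zero_one, ← P.cplx_eq_I_iff,
    ← R.ιC_cplx P hR, ← map_smul]
  constructor
  · intro h; rw [h]
  · intro h; rw [← R.πC_ιC (R.cplx P C x), h, R.πC_ιC]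

end Retract

/-! ### The Kuga-Satake Hodge structure -/

/-- `P` is a period vector of `h`. -/
def PeriodVector.IsPeriod {Q : LinearMap.BilinForm ℚ V} {D : V →ₗ[ℚ] V} {d : ℚ}
    (P : PeriodVector Q D d) (h : HodgeStructure V 2) : Prop :=
  h.comp 2 0 = Submodule.span ℂ {P.ω}

/-- With ω = f₁ + i f₂ and f₁² = f₂² = -1, the commutator ω̄ω - ωω̄ equals 4i f₁f₂, whence the
factor -i/4. The vector ω is an eigenvector of D because V^{2,0} is a D-stable line. -/
theorem exists_periodVector {Q : LinearMap.BilinForm ℚ V} {D : V →ₗ[ℚ] V} {d : ℚ}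
    (hd : 0 < d) (hD : ∀ v, D (D v) = -d • v) {h : HodgeStructure V 2} (hQ : h.IsPolarization Q)
    (h20 : Module.finrank ℂ (h.comp 2 0) = 1) (hDh : h.IsHom h D) :
    ∃ P : PeriodVector Q D d, P.IsPeriod h ∧ (exists_isKugaSatakeElement hQ h20).choose =
      (-Complex.I / 4) • (cliffordMulC Q (conjC V P.ω) P.ω - cliffordMulC Q P.ω (conjC V P.ω)) := by
  obtain ⟨f₁, f₂, h₁, h₂, hs, hn, hJ⟩ := (exists_isKugaSatakeElement hQ h20).choose_spec
  obtain ⟨e22, e12⟩ := gram_of_isotropic hQ h₁ h₂ hs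
  have hI := Complex.I_mul_I
  set ω := f₁ + Complex.I • f₂ with hω
  have hωm : ω ∈ h.comp 2 0 := by rw [hs]; exact Submodule.mem_span_singleton_self _
  have hω' : conjC V ω = f₁ - Complex.I • f₂ := by
    rw [hω, map_add, conjC_smul, h₁, h₂, Complex.conj_I]; module
  have hc : LinearMap.BilinForm.baseChange ℂ Q ω (conjC V ω) = -2 := by
    rw [hω', hω]
    simp only [map_smul, LinearMap.smul_apply, map_add, map_sub, LinearMap.add_apply, smul_eq_mul,
      hQ.symmC f₂ f₁, e22, e12, hn]
    linear_combination hI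
  have hω0 : ω ≠ 0 := by
    intro h0
    rw [h0, map_zero, LinearMap.zero_apply] at hc
    norm_num at hc
  obtain ⟨l, hl⟩ : ∃ l : ℂ, l • ω = D.baseChange ℂ ω := by
    have := hDh 2 0 ω hωm
    rw [hs] at this
    exact Submodule.mem_span_singleton.1 this
  have hll : l * l = -d := by
    have h3 : D.baseChange ℂ (D.baseChange ℂ ω) = (-d : ℂ) • ω := by
      rw [← LinearMap.comp_apply, ← LinearMap.baseChange_comp]
      have : D ∘ₗ D = (-d) • LinearMap.id := LinearMap.ext hD
      rw [this, LinearMap.baseChange_smul, LinearMap.baseChange_id, LinearMap.smul_apply,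
        LinearMap.id_apply, ← algebraMap_smul ℂ (-d)]
      simp
    rw [← hl, map_smul, ← hl, smul_smul] at h3
    exact smul_left_injective ℂ hω0 h3
  refine ⟨⟨ω, l, hll, hd, hl.symm, hQ.orth 2 0 2 0 (by simp) ω hωm ω hωm, hc, ?_⟩, hs, ?_⟩
  · rw [hQ.symmC, hc]
  · rw [hJ]
    change _ = (-Complex.I / 4) • (cliffordMulC Q (conjC V ω) ω - cliffordMulC Q ω (conjC V ω))
    rw [hω', hω]
    have hsw := cliffordMulC_swap Q f₁ f₂
    rw [hQ.symmC f₂ f₁, e12, add_zero, zero_smul] at hsw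
    have hsw' : cliffordMulC Q f₂ f₁ = -cliffordMulC Q f₁ f₂ := eq_neg_of_add_eq_zero_right hsw
    simp only [map_smul, LinearMap.smul_apply, map_add, map_sub, LinearMap.add_apply,
      LinearMap.sub_apply, cliffordMulC_self, e22, hn, hsw']
    match_scalars
    · linear_combination hI
    · ring

theorem isHom_evenAct {Q : LinearMap.BilinForm ℚ V} {D : V →ₗ[ℚ] V} {d : ℚ}
    {h : HodgeStructure V 2} (hQ : h.IsPolarization Q)
    (h20 : Module.finrank ℂ (h.comp 2 0) = 1) (P : PeriodVector Q D d)
    (hP : (exists_isKugaSatakeElement hQ h20).choose =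
      (-Complex.I / 4) • (cliffordMulC Q (conjC V P.ω) P.ω - cliffordMulC Q P.ω (conjC V P.ω)))
    {C : CliffordRep Q M} {X : Type*} [AddCommGroup X] [Module ℚ X] (R : Retract M X)
    (hR : C.Commutes D d R.proj) (s : M) :
    (kugaSatake h Q hQ h20).IsHom (R.hodge P hR) (R.π ∘ₗ C.evenAct s) := by
  have key : ∀ x, (R.π ∘ₗ C.evenAct s).baseChange ℂ
      ((exists_isKugaSatakeElement hQ h20).choose * x) =
      R.cplx P C ((R.π ∘ₗ C.evenAct s).baseChange ℂ x) := by
    intro x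
    rw [LinearMap.baseChange_comp, LinearMap.comp_apply, LinearMap.comp_apply,
      ← R.πC_cplx P hR, hP, P.cplx_apply]
    congr 1
    rw [smul_mul_assoc, map_smul, sub_mul, map_sub, C.evenActC, C.evenActC]
  intro p q x hx
  refine HodgeStructure.mem_ofComplexStructure.2 fun z hz => ?_
  have hx1 : ((z.re : ℂ) • (1 : ℂ ⊗[ℚ] EvenClifford Q) -
    (z.im : ℂ) • (exists_isKugaSatakeElement hQ h20).choose) * x =
    (z ^ p * (starRingEnd ℂ z) ^ q) • x := hx z hz
  rw [sub_mul, smul_mul_assoc, one_mul, smul_mul_assoc] at hx1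
  rw [← map_smul _ (z ^ p * _), ← hx1, map_sub, map_smul, map_smul, key]

end Clifford

/-! ### The Fock space -/

section Toggle

variable {m : ℕ}

/-- Toggle the membership of `j` in `I`. -/
def toggle (j : Fin m) (I : Finset (Fin m)) : Finset (Fin m) := symmDiff I {j}

theorem mem_toggle {j k : Fin m} {I : Finset (Fin m)} :
    k ∈ toggle j I ↔ (k = j ∧ j ∉ I ∨ k ≠ j ∧ k ∈ I) := by
  rw [toggle, Finset.mem_symmDiff, Finset.mem_singleton]
  by_cases h : k = j
  · subst h; tauto
  · tauto

theorem mem_toggle_self {j : Fin m} {I : Finset (Fin m)} : j ∈ toggle j I ↔ j ∉ I := by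
  simp [mem_toggle]

theorem mem_toggle_of_ne {j k : Fin m} {I : Finset (Fin m)} (h : k ≠ j) :
    k ∈ toggle j I ↔ k ∈ I := by
  simp [mem_toggle, h]

@[simp] theorem toggle_toggle (j : Fin m) (I : Finset (Fin m)) : toggle j (toggle j I) = I :=
  symmDiff_symmDiff_cancel_right _ _

theorem toggle_comm (j k : Fin m) (I : Finset (Fin m)) :
    toggle j (toggle k I) = toggle k (toggle j I) :=
  symmDiff_right_comm _ _ _

theorem toggle_eq_iff {j : Fin m} {I J : Finset (Fin m)} : toggle j I = J ↔ I = toggle j J := by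
  constructor <;> rintro rfl <;> simp

theorem toggle_of_mem {j : Fin m} {I : Finset (Fin m)} (h : j ∈ I) : toggle j I = I.erase j := by
  ext k
  rw [mem_toggle, Finset.mem_erase]
  tauto

theorem toggle_of_not_mem {j : Fin m} {I : Finset (Fin m)} (h : j ∉ I) :
    toggle j I = insert j I := by
  ext k
  rw [mem_toggle, Finset.mem_insert]
  by_cases hk : k = j
  · subst hk; tauto
  · tauto

theorem card_toggle_of_mem {j : Fin m} {I : Finset (Fin m)} (h : j ∈ I) :
    (toggle j I).card + 1 = I.card := by
  rw [toggle_of_mem h, Finset.card_erase_add_one h]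

theorem card_toggle_of_not_mem {j : Fin m} {I : Finset (Fin m)} (h : j ∉ I) :
    (toggle j I).card = I.card + 1 := by
  rw [toggle_of_not_mem h, Finset.card_insert_of_notMem h]

/-- The sign `(-1) ^ #{k ∈ I | k < j}`. -/
def fermiSign (j : Fin m) (I : Finset (Fin m)) : ℤ :=
  ∏ i : Fin m, if i < j ∧ i ∈ I then -1 else 1

theorem fermiSign_toggle (j k : Fin m) (I : Finset (Fin m)) :
    fermiSign j (toggle k I) = (if k < j then -1 else 1) * fermiSign j I := by
  have : ∀ i : Fin m, (if i < j ∧ i ∈ toggle k I then (-1 : ℤ) else 1) =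
      (if i = k then (if k < j then -1 else 1) else 1) * (if i < j ∧ i ∈ I then -1 else 1) := by
    intro i
    by_cases hik : i = k
    · subst hik
      by_cases h1 : i < j <;> by_cases h2 : i ∈ I <;> simp [h1, h2, mem_toggle]
    · simp [hik, mem_toggle]
  rw [fermiSign, Finset.prod_congr rfl fun i _ => this i, Finset.prod_mul_distrib,
    Finset.prod_ite_eq' Finset.univ k]
  simp [fermiSign]

theorem fermiSign_toggle_self (j : Fin m) (I : Finset (Fin m)) :
    fermiSign j (toggle j I) = fermiSign j I := by
  simp [fermiSign_toggle]

theorem fermiSign_mul_self (j : Fin m) (I : Finset (Fin m)) :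
    fermiSign j I * fermiSign j I = 1 := by
  rw [fermiSign, ← Finset.prod_mul_distrib]
  refine Finset.prod_eq_one fun i _ => ?_
  split_ifs <;> norm_num

theorem fermiSign_ne_zero (j : Fin m) (I : Finset (Fin m)) : fermiSign j I ≠ 0 :=
  left_ne_zero_of_mul (by rw [fermiSign_mul_self]; exact one_ne_zero)

/-- Two sets of equal size are joined by exchanging one element at a time; the induction is on the
size of I ∖ J. -/
theorem mem_of_swap_closed {R : Set (Finset (Fin m))}
    (hR : ∀ J ∈ R, ∀ k ∈ J, ∀ j ∉ J, toggle j (toggle k J) ∈ R) {I J : Finset (Fin m)}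
    (hJ : J ∈ R) (hIJ : I.card = J.card) : I ∈ R := by
  induction hn : (I \ J).card generalizing J with
  | zero =>
    have h1 : I ⊆ J := by rwa [Finset.card_eq_zero, Finset.sdiff_eq_empty_iff_subset] at hn
    rwa [Finset.eq_of_subset_of_card_le h1 hIJ.ge]
  | succ n ih =>
    have h1 : (J \ I).card = n + 1 := by
      rw [← hn, Finset.card_sdiff_comm hIJ.symm]
    obtain ⟨j, hj⟩ := Finset.card_pos.1 (show 0 < (I \ J).card by omega)
    obtain ⟨k, hk⟩ := Finset.card_pos.1 (show 0 < (J \ I).card by omega)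
    rw [Finset.mem_sdiff] at hj hk
    have hjk : j ≠ k := by rintro rfl; exact hj.2 hk.1
    have hj' : j ∉ toggle k J := by rw [mem_toggle_of_ne hjk]; exact hj.2
    refine ih (hR J hJ k hk.1 j hj.2) ?_ ?_
    · rw [card_toggle_of_not_mem hj', card_toggle_of_mem hk.1, hIJ]
    · have : I \ toggle j (toggle k J) = (I \ J).erase j := by
        ext i
        rw [Finset.mem_sdiff, Finset.mem_erase, Finset.mem_sdiff, mem_toggle, mem_toggle]
        by_cases h2 : i = j
        · subst h2; simp [hj', hj, hk.1]
        · by_cases h3 : i = k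
          · subst h3; simp [hk]
          · rw [mem_toggle_of_ne h3]
            simp [h2]
      rw [this, Finset.card_erase_of_mem (Finset.mem_sdiff.2 hj), hn, Nat.add_sub_cancel]

theorem mem_of_toggle_closed {R : Set (Finset (Fin m))} (hR : ∀ J ∈ R, ∀ j, toggle j J ∈ R)
    {I J : Finset (Fin m)} (hJ : J ∈ R) : I ∈ R := by
  have key : ∀ s : Finset (Fin m), symmDiff J s ∈ R := by
    intro s
    induction s using Finset.induction_on with
    | empty => rwa [← Finset.bot_eq_empty, symmDiff_bot]
    | insert a s ha ih =>
      have : symmDiff J (insert a s) = toggle a (symmDiff J s) := by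
        rw [← toggle_of_not_mem ha, toggle, toggle, symmDiff_assoc]
      rw [this]
      exact hR _ ih a
  have := key (symmDiff J I)
  rwa [symmDiff_symmDiff_cancel_left] at this

end Toggle

/-! ### Creation and annihilation operators -/

section Fock

variable {K : Type*} [Field K] {m : ℕ}

/-- The operator which sends `e_I` to `± e_{I ∪ j}` times `u` if `j ∉ I`, and to
`± e_{I ∖ j}` times `w` if `j ∈ I`. -/
def fermi (j : Fin m) (u w : K) : Module.End K (Finset (Fin m) → K) where
  toFun f I := (if j ∈ I then u else w) * (fermiSign j I * f (toggle j I))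
  map_add' f g := by ext I; simp only [Pi.add_apply]; ring
  map_smul' x f := by ext I; simp only [Pi.smul_apply, smul_eq_mul, RingHom.id_apply]; ring

theorem fermi_apply (j : Fin m) (u w : K) (f : Finset (Fin m) → K) (I : Finset (Fin m)) :
    fermi j u w f I = (if j ∈ I then u else w) * (fermiSign j I * f (toggle j I)) := rfl

theorem fermi_add (j : Fin m) (u w u' w' : K) :
    fermi j (u + u') (w + w') = fermi j u w + fermi j u' w' := by
  refine LinearMap.ext fun f => funext fun I => ?_
  simp only [fermi_apply, LinearMap.add_apply, Pi.add_apply]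
  split_ifs <;> ring

theorem fermi_smul (j : Fin m) (x u w : K) : fermi j (x * u) (x * w) = x • fermi j u w := by
  refine LinearMap.ext fun f => funext fun I => ?_
  simp only [fermi_apply, LinearMap.smul_apply, Pi.smul_apply, smul_eq_mul]
  split_ifs <;> ring

/-- Toggling the smaller index changes the sign attached to the larger one, and not conversely; the
two orders therefore differ by exactly one sign. -/
theorem fermi_anti {j k : Fin m} (hjk : j ≠ k) (u w u' w' : K) (f : Finset (Fin m) → K) :
    fermi j u w (fermi k u' w' f) = -fermi k u' w' (fermi j u w f) := by
  funext I
  simp only [fermi_apply, Pi.neg_apply, fermiSign_toggle, mem_toggle_of_ne hjk,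
    mem_toggle_of_ne hjk.symm, toggle_comm j k]
  rcases lt_or_gt_of_ne hjk with h | h
  · simp only [h, h.not_gt, if_true, if_false]
    push_cast
    ring
  · simp only [h, h.not_gt, if_true, if_false]
    push_cast
    ring

theorem fermi_self (j : Fin m) (u w u' w' : K) (f : Finset (Fin m) → K) (I : Finset (Fin m)) :
    fermi j u w (fermi j u' w' f) I = (if j ∈ I then u * w' else w * u') * f I := by
  have h : (fermiSign j I : K) * fermiSign j I = 1 := by
    rw [← Int.cast_mul, fermiSign_mul_self, Int.cast_one]
  simp only [fermi_apply, fermiSign_toggle_self, mem_toggle_self, toggle_toggle]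
  by_cases hj : j ∈ I
  · simp only [hj, if_true, not_true, if_false]
    linear_combination (u * w' * f I) * h
  · simp only [hj, if_true, not_false_iff, if_false]
    linear_combination (w * u' * f I) * h

theorem fermi_self_add (j : Fin m) (u w u' w' : K) (f : Finset (Fin m) → K) :
    fermi j u w (fermi j u' w' f) + fermi j u' w' (fermi j u w f) = (u * w' + w * u') • f := by
  funext I
  rw [Pi.add_apply, fermi_self, fermi_self, Pi.smul_apply, smul_eq_mul]
  split_ifs <;> ring

theorem fermi_single (j : Fin m) (u w : K) (I : Finset (Fin m)) (z : K) :
    fermi j u w (Pi.single I z) =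
      Pi.single (toggle j I) ((if j ∈ I then w else u) * (fermiSign j I * z)) := by
  funext L
  rw [fermi_apply]
  by_cases h : L = toggle j I
  · subst h
    simp only [Pi.single_eq_same, toggle_toggle, mem_toggle_self, fermiSign_toggle_self]
    split_ifs <;> simp_all
  · rw [Pi.single_eq_of_ne h, Pi.single_eq_of_ne (fun h' => h (toggle_eq_iff.1 h'))]
    simp

/-- Pointwise multiplication by a function. -/
def mulFun (φ : Finset (Fin m) → K) : Module.End K (Finset (Fin m) → K) where
  toFun f I := φ I * f I
  map_add' f g := by ext I; simp only [Pi.add_apply]; ring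
  map_smul' x f := by ext I; simp only [Pi.smul_apply, smul_eq_mul, RingHom.id_apply]; ring

theorem mulFun_apply (φ f : Finset (Fin m) → K) (I : Finset (Fin m)) :
    mulFun φ f I = φ I * f I := rfl

theorem mulFun_single (φ : Finset (Fin m) → K) (I : Finset (Fin m)) (z : K) :
    mulFun φ (Pi.single I z) = Pi.single I (φ I * z) := by
  funext L
  rw [mulFun_apply]
  by_cases h : L = I
  · subst h; simp
  · simp [h]

theorem fermi_mul_apply (j k : Fin m) (u w u' w' : K) (f : Finset (Fin m) → K)
    (I : Finset (Fin m)) : fermi j u w (fermi k u' w' f) I =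
    (if j ∈ I then u else w) * (if k ∈ toggle j I then u' else w') *
      (fermiSign j I * fermiSign k (toggle j I) * f (toggle k (toggle j I))) := by
  rw [fermi_apply, fermi_apply]
  ring

end Fock

/-- The scalar action of `ℚ` underlying an algebra structure, preferred to the one coming from
division rings of characteristic zero. -/
instance algebraDistribSMul {K : Type*} [Field K] [Algebra ℚ K] : DistribSMul ℚ K :=
  DistribMulAction.toDistribSMul

/-! ### The Fock space as a module over the Clifford algebra -/

namespace ImagQuad

variable {K : Type*} [Field K] [Algebra ℚ K] (q : ImagQuad K)

theorem τ_rat (r : ℚ) : q.τ (algebraMap ℚ K r) = algebraMap ℚ K r := q.τ.commutes r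

theorem δ_ne_zero : q.δ ≠ 0 := by
  intro h
  have := q.δ_mul_δ
  rw [h, zero_mul, map_neg, eq_comm, neg_eq_zero, map_eq_zero] at this
  exact q.d_pos.ne' this

theorem d_ne_zero : algebraMap ℚ K q.d ≠ 0 := by
  rw [Ne, map_eq_zero]
  exact q.d_pos.ne'

theorem δ_sq : q.δ * q.δ = -algebraMap ℚ K q.d := by rw [q.δ_mul_δ, map_neg]

theorem two_ne_zero (_q : ImagQuad K) : (2 : K) ≠ 0 := by
  have : algebraMap ℚ K 2 ≠ 0 := by rw [Ne, map_eq_zero]; norm_num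
  rwa [map_ofNat] at this

end ImagQuad

/-- An orthogonal basis for the `K`-Hermitian form attached to `Q`. -/
structure HermBasis {K : Type*} [Field K] [Algebra ℚ K] (q : ImagQuad K) {V : Type*}
    [AddCommGroup V] [Module ℚ V] [Module K V] (Q : LinearMap.BilinForm ℚ V) (m : ℕ) where
  b : Module.Basis (Fin m) K V
  h : Fin m → ℚ
  h_ne_zero : ∀ j, h j ≠ 0
  polar : ∀ v w, algebraMap ℚ K (Q v w + Q w v) = ∑ j, algebraMap ℚ K (h j) *
    (b.repr v j * q.τ (b.repr w j) + q.τ (b.repr v j) * b.repr w j)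

section FockRep

variable {K : Type*} [Field K] [Algebra ℚ K] {q : ImagQuad K} {V : Type*} [AddCommGroup V]
  [Module ℚ V] [Module K V] [IsScalarTower ℚ K V] {Q : LinearMap.BilinForm ℚ V} {m : ℕ}

/-- The Fock space of `K^m`, i.e. the exterior algebra of `K^m`. -/
abbrev FockSpace (K : Type*) (m : ℕ) : Type _ := Finset (Fin m) → K

namespace HermBasis

variable (B : HermBasis q Q m)

/-- The `j`-th summand of the Clifford action. -/
def op (j : Fin m) (x : K) : Module.End K (FockSpace K m) :=
  fermi j x (q.τ x * algebraMap ℚ K (B.h j))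

theorem op_add (j : Fin m) (x y : K) : B.op j (x + y) = B.op j x + B.op j y := by
  rw [op, op, op, ← fermi_add, map_add, add_mul]

theorem op_rat_smul (j : Fin m) (r : ℚ) (x : K) : B.op j (r • x) = (algebraMap ℚ K r) • B.op j x := by
  rw [op, op, ← fermi_smul, Algebra.smul_def, map_mul, q.τ_rat, mul_assoc]

/-- The Clifford action on the Fock space. -/
noncomputable def cliff : V →ₗ[ℚ] Module.End ℚ (FockSpace K m) where
  toFun v := ∑ j, (B.op j (B.b.repr v j)).restrictScalars ℚ
  map_add' v w := by
    rw [← Finset.sum_add_distrib]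
    refine Finset.sum_congr rfl fun j _ => ?_
    rw [map_add, Finsupp.add_apply, op_add]
    rfl
  map_smul' r v := by
    rw [RingHom.id_apply, Finset.smul_sum]
    refine Finset.sum_congr rfl fun j _ => ?_
    rw [← algebraMap_smul K r v, map_smul, Finsupp.smul_apply, smul_eq_mul, ← Algebra.smul_def,
      op_rat_smul]
    refine LinearMap.ext fun f => ?_
    exact algebraMap_smul K r (B.op j (B.b.repr v j) f)

theorem cliff_apply (v : V) (f : FockSpace K m) :
    B.cliff v f = ∑ j, B.op j (B.b.repr v j) f := by
  simp [cliff, LinearMap.sum_apply]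

theorem cliff_smul_basis (x : K) (j : Fin m) (f : FockSpace K m) :
    B.cliff (x • B.b j) f = B.op j x f := by
  rw [cliff_apply, Finset.sum_eq_single j]
  · simp
  · intro k _ hk
    have : B.b.repr (x • B.b j) k = 0 := by simp [Finsupp.single_eq_of_ne hk]
    rw [this]
    funext I
    simp [op, fermi_apply]
  · simp

/-- Cross terms with j ≠ k anticommute. The diagonal ones give h_j(x τ(y) + τ(x) y), which is the
trace form of H recorded in `HermBasis.polar`. -/
theorem cliff_anti (v w : V) (f : FockSpace K m) :
    B.cliff v (B.cliff w f) + B.cliff w (B.cliff v f) = (Q v w + Q w v) • f := by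
  have h1 : ∀ v w, B.cliff v (B.cliff w f) =
      ∑ j, ∑ k, B.op j (B.b.repr v j) (B.op k (B.b.repr w k) f) := by
    intro v w
    rw [cliff_apply]
    refine Finset.sum_congr rfl fun j _ => ?_
    rw [cliff_apply, map_sum]
  rw [h1 v w, h1 w v, Finset.sum_comm (f := fun j k => B.op j (B.b.repr w j) _),
    ← Finset.sum_add_distrib, ← algebraMap_smul K, B.polar, Finset.sum_smul]
  refine Finset.sum_congr rfl fun j _ => ?_
  rw [← Finset.sum_add_distrib, Finset.sum_eq_single j]
  · rw [op, op, fermi_self_add]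
    congr 1
    ring
  · intro k _ hk
    rw [op, op, fermi_anti hk.symm, neg_add_cancel]
  · simp

/-- The Fock space as a module over the Clifford algebra. -/
noncomputable def rep : CliffordRep Q (FockSpace K m) where
  c := B.cliff
  anti v w := LinearMap.ext fun f => B.cliff_anti v w f

/-- The generators of the image of the unitary Lie algebra. -/
noncomputable abbrev gen (v w : V) : Module.End ℚ (FockSpace K m) :=
  B.rep.unitary (kAct V q.δ) q.d v w

theorem gen_apply (v w : V) (f : FockSpace K m) : B.gen v w f =
    B.cliff v (B.cliff w f) + q.d⁻¹ • B.cliff (q.δ • v) (B.cliff (q.δ • w) f) := rfl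

/-- Replacing v by δv multiplies its creation part by δ and its annihilation part by -δ. In the sum
with weight d⁻¹ the terms with two creations or two annihilations cancel, as δ²/d = -1, and the
mixed terms double. -/
theorem gen_smul_basis (x y : K) (j k : Fin m) (f : FockSpace K m) :
    B.gen (x • B.b j) (y • B.b k) f =
      (2 : K) • (fermi j x 0 (fermi k 0 (q.τ y * algebraMap ℚ K (B.h k)) f) +
        fermi j 0 (q.τ x * algebraMap ℚ K (B.h j)) (fermi k y 0 f)) := by
  have hd := q.d_ne_zero
  funext I
  rw [gen_apply, smul_smul, smul_smul, cliff_smul_basis, cliff_smul_basis, cliff_smul_basis,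
    cliff_smul_basis, ← algebraMap_smul K, map_inv₀]
  simp only [Pi.add_apply, Pi.smul_apply, smul_eq_mul, op, fermi_mul_apply, map_mul, q.τ_δ]
  by_cases hj : j ∈ I <;> by_cases hk : k ∈ toggle j I <;> simp only [hj, hk, if_true, if_false] <;>
    field_simp
  · linear_combination (x * y * fermiSign j I * fermiSign k (toggle j I) *
      f (toggle k (toggle j I))) * q.δ_sq
  · linear_combination -(x * q.τ y * fermiSign j I * fermiSign k (toggle j I) *
      f (toggle k (toggle j I)) * algebraMap ℚ K (B.h k)) * q.δ_sq
  · linear_combination -(q.τ x * y * fermiSign j I * fermiSign k (toggle j I) *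
      f (toggle k (toggle j I)) * algebraMap ℚ K (B.h j)) * q.δ_sq
  · linear_combination (q.τ x * q.τ y * fermiSign j I * fermiSign k (toggle j I) *
      f (toggle k (toggle j I)) * algebraMap ℚ K (B.h k) * algebraMap ℚ K (B.h j)) * q.δ_sq

theorem vector_induction {p : V → Prop} (h0 : p 0) (hadd : ∀ v w, p v → p w → p (v + w))
    (hb : ∀ (x : K) j, p (x • B.b j)) (v : V) : p v := by
  rw [← B.b.sum_repr v]
  exact Finset.sum_induction _ p hadd h0 fun j _ => hb _ j

theorem gen_add_left (v v' w : V) (f : FockSpace K m) :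
    B.gen (v + v') w f = B.gen v w f + B.gen v' w f := by
  simp only [gen_apply, map_add, smul_add, LinearMap.add_apply]
  module

theorem gen_add_right (v w w' : V) (f : FockSpace K m) :
    B.gen v (w + w') f = B.gen v w f + B.gen v w' f := by
  simp only [gen_apply, map_add, smul_add, LinearMap.add_apply]
  module

theorem gen_zero_left (w : V) (f : FockSpace K m) : B.gen 0 w f = 0 := by
  simp [gen_apply]

theorem gen_zero_right (v : V) (f : FockSpace K m) : B.gen v 0 f = 0 := by
  simp [gen_apply]

/-- `g` commutes with the image of the unitary Lie algebra. -/
abbrev Commutes (g : Module.End ℚ (FockSpace K m)) : Prop :=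
  B.rep.Commutes (kAct V q.δ) q.d g

theorem commutes_of_basis {g : Module.End ℚ (FockSpace K m)}
    (hg : ∀ (x y : K) (j k : Fin m) f, g (B.gen (x • B.b j) (y • B.b k) f) =
      B.gen (x • B.b j) (y • B.b k) (g f)) : B.Commutes g := by
  intro v w f
  change g (B.gen v w f) = B.gen v w (g f)
  induction v using B.vector_induction with
  | h0 => rw [gen_zero_left, gen_zero_left, map_zero]
  | hadd v v' hv hv' => rw [gen_add_left, gen_add_left, map_add, hv, hv']
  | hb x j =>
    induction w using B.vector_induction with
    | h0 => rw [gen_zero_right, gen_zero_right, map_zero]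
    | hadd v v' hv hv' => rw [gen_add_right, gen_add_right, map_add, hv, hv']
    | hb y k => exact hg x y j k f

theorem commutes_of_semicommutes {g : Module.End ℚ (FockSpace K m)} {s : ℚ} (hs : s * s = 1)
    (hg : ∀ v f, g (B.cliff v f) = s • B.cliff v (g f)) : B.Commutes g := by
  intro v w f
  change g (B.gen v w f) = B.gen v w (g f)
  simp only [gen_apply, map_add, map_smul, hg, smul_smul, hs, one_smul]

/-! ### Scalars, grading and the star operator -/

/-- Multiplication by an element of `K`. -/
def scalar (m : ℕ) (x : K) : Module.End ℚ (FockSpace K m) :=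
  (x • (LinearMap.id : Module.End K (FockSpace K m))).restrictScalars ℚ

theorem scalar_apply (x : K) (f : FockSpace K m) : scalar m x f = x • f := rfl

theorem commutes_scalar (x : K) : B.Commutes (scalar m x) := by
  refine B.commutes_of_semicommutes (one_mul 1) fun v f => ?_
  rw [one_smul, scalar_apply, scalar_apply, cliff_apply, cliff_apply, Finset.smul_sum]
  exact Finset.sum_congr rfl fun j _ => by rw [map_smul]

theorem commutes_one : B.Commutes 1 := fun v w f => by
  rw [Module.End.one_apply, Module.End.one_apply]

/-- The projection to the part of degree `i`. -/
def grade (K : Type*) [Field K] [Algebra ℚ K] (m i : ℕ) : Module.End ℚ (FockSpace K m) :=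
  (mulFun fun I => if I.card = i then 1 else 0).restrictScalars ℚ

theorem grade_apply (i : ℕ) (f : FockSpace K m) (I : Finset (Fin m)) :
    grade K m i f I = if I.card = i then f I else 0 := by
  change (if I.card = i then 1 else 0) * f I = _
  split_ifs <;> simp

theorem grade_single (i : ℕ) (I : Finset (Fin m)) (z : K) :
    grade K m i (Pi.single I z) = if I.card = i then Pi.single I z else 0 := by
  funext L
  rw [grade_apply]
  by_cases hL : L = I
  · subst hL; split_ifs <;> simp
  · split_ifs <;> simp [hL]

theorem grade_grade (i : ℕ) (f : FockSpace K m) : grade K m i (grade K m i f) = grade K m i f := by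
  funext I
  simp only [grade_apply]
  split_ifs <;> rfl

theorem grade_grade_of_ne {i j : ℕ} (hij : i ≠ j) (f : FockSpace K m) :
    grade K m i (grade K m j f) = 0 := by
  funext I
  simp only [grade_apply]
  split_ifs with h1 h2
  · exact absurd (h1.symm.trans h2) hij
  · rfl
  · rfl

theorem commutes_grade (i : ℕ) : B.Commutes (grade K m i) := by
  refine B.commutes_of_basis fun x y j k f => funext fun I => ?_
  rw [grade_apply, gen_smul_basis, gen_smul_basis]
  simp only [Pi.add_apply, Pi.smul_apply, smul_eq_mul, fermi_mul_apply, grade_apply]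
  -- Only terms pairing one creation with one annihilation survive, and these preserve the degree.
  have hcard : (j ∈ I ↔ k ∉ toggle j I) → (toggle k (toggle j I)).card = I.card := by
    intro h
    by_cases hj : j ∈ I
    · rw [card_toggle_of_not_mem (h.1 hj), card_toggle_of_mem hj]
    · have hk : k ∈ toggle j I := by tauto
      have := card_toggle_of_mem hk
      rw [card_toggle_of_not_mem hj] at this
      omega
  by_cases hj : j ∈ I <;> by_cases hk : k ∈ toggle j I
  · simp [hj, hk]
  · rw [hcard (by tauto)]; split_ifs <;> simp
  · rw [hcard (by tauto)]; split_ifs <;> simp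
  · simp [hj, hk]

/-- Coordinatewise conjugation. -/
def conjF (q : ImagQuad K) (m : ℕ) : Module.End ℚ (FockSpace K m) where
  toFun f I := q.τ (f I)
  map_add' f g := by funext I; simp
  map_smul' r f := by funext I; simp

theorem conjF_apply (f : FockSpace K m) (I : Finset (Fin m)) : conjF q m f I = q.τ (f I) := rfl

theorem conjF_op (j : Fin m) (x : K) (f : FockSpace K m) :
    conjF q m (B.op j x f) = B.op j (q.τ x) (conjF q m f) := by
  funext I
  simp only [conjF_apply, op, fermi_apply, map_mul, map_intCast]
  split_ifs
  · rfl
  · rw [map_mul, q.τ_rat]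

/-- The product of the operators `c(b_j)`, `j ∈ L`. -/
noncomputable def listOp : List (Fin m) → Module.End ℚ (FockSpace K m)
  | [] => 1
  | j :: L => (B.op j 1).restrictScalars ℚ * listOp L

theorem listOp_cons (j : Fin m) (L : List (Fin m)) (f : FockSpace K m) :
    B.listOp (j :: L) f = B.op j 1 (B.listOp L f) := rfl

theorem op_one_op_self (j : Fin m) (x : K) (f : FockSpace K m) :
    B.op j 1 (B.op j x f) = B.op j (q.τ x) (B.op j 1 f) := by
  funext I
  rw [op, op, op, fermi_self, fermi_self, q.τ_τ, map_one]
  split_ifs <;> ring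

theorem op_op_of_ne {j k : Fin m} (hjk : j ≠ k) (x y : K) (f : FockSpace K m) :
    B.op j x (B.op k y f) = (-1 : ℚ) • B.op k y (B.op j x f) := by
  rw [neg_one_smul]
  exact fermi_anti hjk _ _ _ _ f

/-- Each c(b_j) with j ≠ k contributes a sign when c(x b_k) passes it; c(b_k) itself contributes no
sign but conjugates x. This explains the extra exponent when k occurs in the list. -/
theorem listOp_op {L : List (Fin m)} (hL : L.Nodup) (k : Fin m) (x : K) (f : FockSpace K m) :
    B.listOp L (B.op k x f) = ((-1 : ℚ) ^ (L.length + if k ∈ L then 1 else 0)) •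
      B.op k (if k ∈ L then q.τ x else x) (B.listOp L f) := by
  induction L with
  | nil => simp [listOp]
  | cons j L ih =>
    rw [List.nodup_cons] at hL
    rw [listOp_cons, ih hL.2, listOp_cons, LinearMap.map_smul_of_tower]
    by_cases hjk : j = k
    · subst hjk
      rw [if_neg hL.1, if_neg hL.1, if_pos List.mem_cons_self, if_pos List.mem_cons_self,
        op_one_op_self, List.length_cons, add_assoc, pow_add _ _ (1 + 1)]
      norm_num
    · have hk : k ∈ j :: L ↔ k ∈ L := by
        rw [List.mem_cons]; exact ⟨fun h => h.resolve_left (Ne.symm hjk), Or.inr⟩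
      simp only [hk]
      rw [B.op_op_of_ne hjk, smul_smul, List.length_cons]
      congr 1
      ring

theorem conjF_listOp (L : List (Fin m)) (f : FockSpace K m) :
    conjF q m (B.listOp L f) = B.listOp L (conjF q m f) := by
  induction L with
  | nil => rfl
  | cons j L ih => rw [listOp_cons, conjF_op, ih, map_one, listOp_cons]

theorem op_one_op_one (j : Fin m) (f : FockSpace K m) :
    B.op j 1 (B.op j 1 f) = B.h j • f := by
  funext I
  rw [op, fermi_self, map_one, Pi.smul_apply, Algebra.smul_def]
  split_ifs <;> ring

/-- Bringing the leading factor of the second copy next to that of the first costs one sign for each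
remaining factor; the totals add up to 0 + 1 + ⋯ + (length - 1). -/
theorem listOp_listOp {L : List (Fin m)} (hL : L.Nodup) (f : FockSpace K m) :
    B.listOp L (B.listOp L f) =
      ((-1 : ℚ) ^ (∑ i ∈ Finset.range L.length, i) * (L.map B.h).prod) • f := by
  induction L generalizing f with
  | nil => simp [listOp]
  | cons j L ih =>
    rw [List.nodup_cons] at hL
    rw [listOp_cons, listOp_cons, B.listOp_op hL.2, if_neg hL.1, if_neg hL.1,
      LinearMap.map_smul_of_tower, op_one_op_one, ih hL.2, smul_smul, smul_smul, List.length_cons,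
      Finset.sum_range_succ, List.map_cons, List.prod_cons, pow_add]
    congr 1
    ring

theorem exists_listOp_apply {L : List (Fin m)} (hL : L.Nodup) : ∃ φ : Finset (Fin m) → K,
    ∀ f I, B.listOp L f I = φ I * f (symmDiff I L.toFinset) := by
  induction L with
  | nil =>
    refine ⟨1, fun f I => ?_⟩
    rw [List.toFinset_nil, ← Finset.bot_eq_empty, symmDiff_bot]
    simp [listOp]
  | cons j L ih =>
    rw [List.nodup_cons] at hL
    obtain ⟨φ, hφ⟩ := ih hL.2
    refine ⟨fun I => (if j ∈ I then 1 else q.τ 1 * algebraMap ℚ K (B.h j)) * (fermiSign j I *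
      φ (toggle j I)), fun f I => ?_⟩
    have : symmDiff (toggle j I) L.toFinset = symmDiff I (j :: L).toFinset := by
      rw [List.toFinset_cons, ← toggle_of_not_mem (by simpa using hL.1), toggle, toggle,
        symmDiff_assoc, symmDiff_comm L.toFinset]
    rw [listOp_cons, op, fermi_apply, hφ, this]
    ring

/-- The semilinear star operator on the Fock space. -/
noncomputable def star : Module.End ℚ (FockSpace K m) := B.listOp (List.finRange m) * conjF q m

theorem star_apply (f : FockSpace K m) :
    B.star f = B.listOp (List.finRange m) (conjF q m f) := rfl

/-- Coordinatewise conjugation turns x into τ(x), and passing the product of all c(b_j) turns it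
back. So star commutes with every c(v) up to a sign, and exactly with products of two of them. -/
theorem star_op (k : Fin m) (x : K) (f : FockSpace K m) :
    B.star (B.op k x f) = ((-1 : ℚ) ^ (m + 1)) • B.op k x (B.star f) := by
  rw [star_apply, conjF_op, B.listOp_op (List.nodup_finRange m), if_pos (List.mem_finRange k),
    if_pos (List.mem_finRange k), List.length_finRange, q.τ_τ, ← star_apply]

theorem commutes_star : B.Commutes B.star := by
  refine B.commutes_of_semicommutes (s := (-1) ^ (m + 1)) ?_ fun v f => ?_
  · rw [← mul_pow]; norm_num
  · rw [cliff_apply, cliff_apply, map_sum, Finset.smul_sum]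
    exact Finset.sum_congr rfl fun j _ => B.star_op _ _ _

theorem exists_star_apply : ∃ φ : Finset (Fin m) → K, ∀ f I, B.star f I = φ I * q.τ (f Iᶜ) := by
  obtain ⟨φ, hφ⟩ := B.exists_listOp_apply (List.nodup_finRange m)
  refine ⟨φ, fun f I => ?_⟩
  have : symmDiff I (List.finRange m).toFinset = Iᶜ := by
    ext i
    simp [Finset.mem_symmDiff]
  rw [star_apply, hφ, this, conjF_apply]

theorem star_single (I : Finset (Fin m)) (z : K) :
    ∃ w, B.star (Pi.single I z) = Pi.single Iᶜ w := by
  obtain ⟨φ, hφ⟩ := B.exists_star_apply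
  refine ⟨φ Iᶜ * q.τ z, funext fun L => ?_⟩
  rw [hφ]
  by_cases h : L = Iᶜ
  · subst h; simp
  · have h' : Lᶜ ≠ I := by rintro rfl; simp at h
    rw [Pi.single_eq_of_ne h, Pi.single_eq_of_ne h', map_zero, mul_zero]

theorem star_grade {i j : ℕ} (hij : i + j = m) (f : FockSpace K m) :
    B.star (grade K m i f) = grade K m j (B.star f) := by
  obtain ⟨φ, hφ⟩ := B.exists_star_apply
  funext I
  rw [hφ, grade_apply, grade_apply, hφ, Finset.card_compl, Fintype.card_fin]
  have h1 : I.card ≤ m := by simpa using Finset.card_le_univ I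
  by_cases h : I.card = j
  · rw [if_pos h, if_pos (by omega)]
  · rw [if_neg h, if_neg (by omega), map_zero, mul_zero]

theorem star_smul (x : K) (f : FockSpace K m) : B.star (x • f) = q.τ x • B.star f := by
  obtain ⟨φ, hφ⟩ := B.exists_star_apply
  funext I
  rw [hφ, Pi.smul_apply, Pi.smul_apply, hφ, smul_eq_mul, smul_eq_mul, map_mul]
  ring

/-- The scalar by which the square of the star operator acts. -/
def starSq : ℚ := (-1) ^ (∑ i ∈ Finset.range m, i) * ∏ j, B.h j

theorem star_star (f : FockSpace K m) : B.star (B.star f) = B.starSq • f := by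
  have h1 : conjF q m (conjF q m f) = f := funext fun I => by
    rw [conjF_apply, conjF_apply, q.τ_τ]
  rw [star_apply, star_apply, conjF_listOp, h1, B.listOp_listOp (List.nodup_finRange m),
    List.length_finRange, starSq]
  rw [← List.ofFn_eq_map, List.prod_ofFn]

theorem starSq_ne_zero : B.starSq ≠ 0 :=
  mul_ne_zero (pow_ne_zero _ (by norm_num)) (Finset.prod_ne_zero_iff.2 fun j _ => B.h_ne_zero j)

end HermBasis

end FockRep

section Stable

variable {K : Type*} [Field K] [Algebra ℚ K] {q : ImagQuad K} {V : Type*} [AddCommGroup V]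
  [Module ℚ V] [Module K V] [IsScalarTower ℚ K V] {Q : LinearMap.BilinForm ℚ V} {m : ℕ}

namespace HermBasis

variable (B : HermBasis q Q m)

/-! ### Subspaces stable under the unitary Lie algebra -/

/-- A rational subspace of the Fock space stable under the unitary Lie algebra. -/
def IsStable (W : Submodule ℚ (FockSpace K m)) : Prop := ∀ v w, ∀ f ∈ W, B.gen v w f ∈ W

/-- The operator which is multiplication by `δ` on `e_I` for `j ∈ I` and by `-δ` otherwise. -/
def theta (q : ImagQuad K) (j : Fin m) : Module.End ℚ (FockSpace K m) :=
  (mulFun fun I => if j ∈ I then q.δ else -q.δ).restrictScalars ℚ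

theorem theta_apply (j : Fin m) (f : FockSpace K m) (I : Finset (Fin m)) :
    theta q j f I = (if j ∈ I then q.δ else -q.δ) * f I := rfl

theorem theta_single (j : Fin m) (I : Finset (Fin m)) (z : K) :
    theta q j (Pi.single I z) = Pi.single I ((if j ∈ I then q.δ else -q.δ) * z) :=
  mulFun_single _ _ _

/-- In the generator for δb_j and b_j, annihilating and then creating j gives 2h_jδ, creating and
then annihilating gives -2h_jδ. -/
theorem theta_eq (j : Fin m) :
    theta q j = (2 * B.h j)⁻¹ • B.gen (q.δ • B.b j) ((1 : K) • B.b j) := by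
  have h2 := q.two_ne_zero
  have hh : algebraMap ℚ K (B.h j) ≠ 0 := by
    rw [Ne, map_eq_zero]; exact B.h_ne_zero j
  refine LinearMap.ext fun f => funext fun I => ?_
  change _ = (2 * B.h j)⁻¹ • B.gen (q.δ • B.b j) ((1 : K) • B.b j) f I
  rw [gen_smul_basis, Pi.smul_apply, Pi.add_apply, fermi_self, fermi_self, Algebra.smul_def,
    theta_apply, q.τ_δ, map_one, map_inv₀, map_mul, map_ofNat, smul_eq_mul]
  by_cases hj : j ∈ I
  · simp only [hj, if_true]; field_simp; ring
  · simp only [hj, if_false]; field_simp; ring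

theorem gen_single {j k : Fin m} {J : Finset (Fin m)} (hk : k ∈ J) (hj : j ∉ J) :
    ∃ a : K, a ≠ 0 ∧ ∀ z, B.gen ((1 : K) • B.b j) ((1 : K) • B.b k) (Pi.single J z) =
      Pi.single (toggle j (toggle k J)) (a * z) := by
  have h2 := q.two_ne_zero
  have h0 : CharZero K := algebraRat.charZero K
  have hh : algebraMap ℚ K (B.h k) ≠ 0 := by
    rw [Ne, map_eq_zero]; exact B.h_ne_zero k
  have hjk : j ≠ k := by rintro rfl; exact hj hk
  refine ⟨2 * (fermiSign j (toggle k J) * algebraMap ℚ K (B.h k) * fermiSign k J), ?_, ?_⟩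
  · refine mul_ne_zero h2 (mul_ne_zero (mul_ne_zero ?_ hh) ?_)
    · exact_mod_cast fermiSign_ne_zero _ _
    · exact_mod_cast fermiSign_ne_zero _ _
  · intro z
    rw [gen_smul_basis, fermi_single, fermi_single, fermi_single, fermi_single, if_pos hk,
      if_pos hk, if_neg (by rwa [mem_toggle_of_ne hjk]), if_neg (by rwa [mem_toggle_of_ne hjk]),
      ← Pi.single_add, ← Pi.single_smul]
    congr 1
    rw [map_one, smul_eq_mul]
    ring

variable {B}

theorem IsStable.theta_mem {W : Submodule ℚ (FockSpace K m)} (hW : B.IsStable W) (j : Fin m)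
    {f : FockSpace K m} (hf : f ∈ W) : theta q j f ∈ W := by
  rw [B.theta_eq]
  exact W.smul_mem _ (hW _ _ _ hf)

/-- θ_j acts on the line K e_J as δ or -δ, so a stable rational subspace meeting this line in a
nonzero vector contains all of it. -/
theorem IsStable.single_mem_self {W : Submodule ℚ (FockSpace K m)} (hW : B.IsStable W) (j : Fin m)
    {J : Finset (Fin m)} {z : K} (hz : z ≠ 0) (hJ : Pi.single J z ∈ W) (y : K) :
    Pi.single J y ∈ W := by
  have h1 : Pi.single J (q.δ * z) ∈ W := by
    have := hW.theta_mem j hJ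
    rw [theta_single] at this
    split_ifs at this with h
    · exact this
    · have h2 := W.neg_mem this
      rwa [← Pi.single_neg, neg_mul, neg_neg] at h2
  obtain ⟨a, b, hab⟩ := q.exists_eq (y / z)
  have h2 : y = a • z + b • (q.δ * z) := by
    rw [Algebra.smul_def, Algebra.smul_def, ← mul_assoc, ← add_mul, ← hab, div_mul_cancel₀ _ hz]
  rw [h2, Pi.single_add, Pi.single_smul, Pi.single_smul]
  exact W.add_mem (W.smul_mem _ hJ) (W.smul_mem _ h1)

theorem IsStable.single_mem {W : Submodule ℚ (FockSpace K m)} (hW : B.IsStable W) (j : Fin m)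
    {J : Finset (Fin m)} {z : K} (hz : z ≠ 0) (hJ : Pi.single J z ∈ W) {I : Finset (Fin m)}
    (hI : I.card = J.card) (y : K) : Pi.single I y ∈ W := by
  suffices h : ∀ J ∈ {I : Finset (Fin m) | ∀ y : K, Pi.single I y ∈ W}, ∀ k ∈ J, ∀ j ∉ J,
      toggle j (toggle k J) ∈ {I : Finset (Fin m) | ∀ y : K, Pi.single I y ∈ W} from
    mem_of_swap_closed h (J := J) (fun y => hW.single_mem_self j hz hJ y) hI y
  intro J hJ k hk j hj y
  obtain ⟨a, ha, h⟩ := B.gen_single hk hj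
  have h1 := hW ((1 : K) • B.b j) ((1 : K) • B.b k) _ (hJ (a⁻¹ * y))
  rwa [h, mul_inv_cancel_left₀ ha] at h1

theorem grade_mem {W : Submodule ℚ (FockSpace K m)} {i : ℕ}
    (h : ∀ I : Finset (Fin m), I.card = i → ∀ y : K, Pi.single I y ∈ W) (f : FockSpace K m) :
    grade K m i f ∈ W := by
  rw [← Finset.univ_sum_single (grade K m i f)]
  refine W.sum_mem fun I _ => ?_
  rw [grade_apply]
  split_ifs with hI
  · exact h I hI _
  · simp

theorem IsStable.comap {W : Submodule ℚ (FockSpace K m)} (hW : B.IsStable W)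
    {g : Module.End ℚ (FockSpace K m)} (hg : B.Commutes g) : B.IsStable (W.comap g) := by
  intro v w f hf
  rw [Submodule.mem_comap] at hf ⊢
  rw [hg v w f]
  exact hW v w _ hf

/-- The preimage of W under g is again stable, and it contains a nonzero multiple of e_J; exchanges
of indices then put all of degree |J| in it. -/
theorem IsStable.apply_grade_mem {W : Submodule ℚ (FockSpace K m)} (hW : B.IsStable W) (j : Fin m)
    {g : Module.End ℚ (FockSpace K m)} (hg : B.Commutes g) {J : Finset (Fin m)} {z : K}
    (hz : z ≠ 0) (hJ : g (Pi.single J z) ∈ W) (f : FockSpace K m) :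
    g (grade K m J.card f) ∈ W :=
  grade_mem (W := W.comap g) (fun _ hI y => (hW.comap hg).single_mem j hz hJ hI y) f

/-! ### Coordinate projections -/

/-- The projection to the coordinates `J` and `Jᶜ`. -/
def pairProj (K : Type*) [Field K] [Algebra ℚ K] (J : Finset (Fin m)) :
    Module.End ℚ (FockSpace K m) :=
  (mulFun fun I => if I = J ∨ I = Jᶜ then 1 else 0).restrictScalars ℚ

theorem pairProj_apply (J : Finset (Fin m)) (f : FockSpace K m) (I : Finset (Fin m)) :
    pairProj K J f I = if I = J ∨ I = Jᶜ then f I else 0 := by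
  change (if I = J ∨ I = Jᶜ then 1 else 0) * f I = _
  split_ifs <;> simp

theorem pairProj_eq {J : Finset (Fin m)} (hJ : J ≠ Jᶜ) (f : FockSpace K m) :
    pairProj K J f = Pi.single J (f J) + Pi.single Jᶜ (f Jᶜ) := by
  funext I
  rw [pairProj_apply, Pi.add_apply]
  by_cases h1 : I = J
  · subst h1
    simp [Pi.single_eq_of_ne hJ]
  · by_cases h2 : I = Jᶜ
    · subst h2
      simp [Pi.single_eq_of_ne hJ.symm]
    · simp [h1, h2]

/-- The index is needed only to exclude m = 0, where ∅ is its own complement. -/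
theorem ne_compl (j : Fin m) (J : Finset (Fin m)) : J ≠ Jᶜ := by
  intro h
  by_cases hj : j ∈ J
  · have := h ▸ hj
    exact (Finset.mem_compl.1 this) hj
  · exact hj (h ▸ Finset.mem_compl.2 hj)

/-- θ_iθ_j is -d on e_I if i and j lie on the same side of I and d otherwise, so (1 ∓ θ_iθ_j/d)/2
tests whether I and J agree on the pair {i, j}. With i fixed, the product over j determines I up to
complement. The rational algebra of the θ_j cannot do better: e_J and e_{Jᶜ} carry conjugate
characters. -/
theorem pairProj_mem {S : Subalgebra ℚ (Module.End ℚ (FockSpace K m))}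
    (hS : ∀ j, theta q j ∈ S) (i : Fin m) (J : Finset (Fin m)) : pairProj K J ∈ S := by
  have h2 := q.two_ne_zero
  have hd := q.d_ne_zero
  have hδ := q.δ_sq
  have key : ∀ j, ((mulFun fun I : Finset (Fin m) =>
      if (i ∈ I ↔ j ∈ I) ↔ (i ∈ J ↔ j ∈ J) then (1 : K) else 0).restrictScalars ℚ) ∈ S := by
    intro j
    by_cases hJ : i ∈ J ↔ j ∈ J
    · have h1 : (1 / 2 : ℚ) • (1 + (-q.d⁻¹) • (theta q i * theta q j)) ∈ S :=
        S.smul_mem (S.add_mem S.one_mem (S.smul_mem (S.mul_mem (hS i) (hS j)) _)) _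
      refine (congrArg (· ∈ S) (LinearMap.ext fun f => funext fun I => ?_)).mpr h1
      change (if (i ∈ I ↔ j ∈ I) ↔ (i ∈ J ↔ j ∈ J) then (1 : K) else 0) * f I =
        (1 / 2 : ℚ) • (f I + (-q.d⁻¹) • theta q i (theta q j f) I)
      simp only [theta_apply, Algebra.smul_def, map_neg, map_inv₀, map_div₀, map_one, map_ofNat, hJ,
        iff_true]
      by_cases hi : i ∈ I <;> by_cases hj : j ∈ I <;> simp only [hi, hj, if_true, if_false, iff_self,
        iff_false, not_true, false_iff] <;> field_simp <;>
        first | linear_combination f I * hδ | linear_combination -f I * hδ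
    · have h1 : (1 / 2 : ℚ) • (1 + q.d⁻¹ • (theta q i * theta q j)) ∈ S :=
        S.smul_mem (S.add_mem S.one_mem (S.smul_mem (S.mul_mem (hS i) (hS j)) _)) _
      refine (congrArg (· ∈ S) (LinearMap.ext fun f => funext fun I => ?_)).mpr h1
      change (if (i ∈ I ↔ j ∈ I) ↔ (i ∈ J ↔ j ∈ J) then (1 : K) else 0) * f I =
        (1 / 2 : ℚ) • (f I + q.d⁻¹ • theta q i (theta q j f) I)
      simp only [theta_apply, Algebra.smul_def, map_inv₀, map_div₀, map_one, map_ofNat, hJ,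
        iff_false]
      by_cases hi : i ∈ I <;> by_cases hj : j ∈ I <;> simp only [hi, hj, if_true, if_false, iff_self,
        iff_false, not_true, not_false_iff, false_iff] <;> field_simp <;>
        first | linear_combination f I * hδ | linear_combination -f I * hδ
  have hprod : ∀ s : Finset (Fin m), ((mulFun fun I : Finset (Fin m) =>
      if ∀ j ∈ s, ((i ∈ I ↔ j ∈ I) ↔ (i ∈ J ↔ j ∈ J)) then (1 : K) else 0).restrictScalars ℚ)
        ∈ S := by
    intro s
    induction s using Finset.induction_on with
    | empty =>
      refine (congrArg (· ∈ S) (LinearMap.ext fun f => funext fun I => ?_)).mpr S.one_mem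
      change (if ∀ j ∈ ∅, ((i ∈ I ↔ j ∈ I) ↔ (i ∈ J ↔ j ∈ J)) then (1 : K) else 0) * f I = f I
      simp
    | insert a s _ ih =>
      refine (congrArg (· ∈ S) (LinearMap.ext fun f => funext fun I => ?_)).mpr
        (S.mul_mem (key a) ih)
      change _ * f I = (if (i ∈ I ↔ a ∈ I) ↔ (i ∈ J ↔ a ∈ J) then (1 : K) else 0) *
        ((if ∀ j ∈ s, ((i ∈ I ↔ j ∈ I) ↔ (i ∈ J ↔ j ∈ J)) then (1 : K) else 0) * f I)
      rw [← mul_assoc, ite_zero_mul_ite_zero, mul_one]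
      simp only [Finset.forall_mem_insert]
  refine (congrArg (· ∈ S) (LinearMap.ext fun f => funext fun I => ?_)).mpr (hprod Finset.univ)
  change (if I = J ∨ I = Jᶜ then 1 else 0) * f I =
    (if ∀ j ∈ Finset.univ, ((i ∈ I ↔ j ∈ I) ↔ (i ∈ J ↔ j ∈ J)) then (1 : K) else 0) * f I
  have : (I = J ∨ I = Jᶜ) ↔ ∀ j ∈ Finset.univ, ((i ∈ I ↔ j ∈ I) ↔ (i ∈ J ↔ j ∈ J)) := by
    constructor
    · rintro (rfl | rfl) j _
      · rfl
      · simp only [Finset.mem_compl]; tauto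
    · intro h
      by_cases hi : i ∈ I ↔ i ∈ J
      · left; ext j; have := h j (Finset.mem_univ j); tauto
      · right; ext j; have := h j (Finset.mem_univ j); rw [Finset.mem_compl]; tauto
  simp only [this]

theorem IsStable.pairProj_mem {W : Submodule ℚ (FockSpace K m)} (hW : B.IsStable W) (i : Fin m)
    (J : Finset (Fin m)) {f : FockSpace K m} (hf : f ∈ W) : pairProj K J f ∈ W := by
  let S : Subalgebra ℚ (Module.End ℚ (FockSpace K m)) :=
    { carrier := {g | ∀ f ∈ W, g f ∈ W}
      mul_mem' := fun ha hb f hf => ha _ (hb _ hf)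
      add_mem' := fun ha hb f hf => W.add_mem (ha _ hf) (hb _ hf)
      algebraMap_mem' := fun r f hf => W.smul_mem r hf }
  exact HermBasis.pairProj_mem (S := S) (fun j f hf => hW.theta_mem j hf) i J f hf

/-! ### Classification of stable subspaces -/

/-- A nonzero stable subspace of the part of degree `i` is either everything, or `2 i = m` and it
contains the image of `1 + star ∘ t` for some `t ∈ K`. -/
theorem IsStable.dichotomy {W : Submodule ℚ (FockSpace K m)} (hW : B.IsStable W) (j : Fin m)
    {i : ℕ} (hWi : ∀ f ∈ W, grade K m i f = f) (hbot : W ≠ ⊥) :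
    (∀ f, grade K m i f ∈ W) ∨ (2 * i = m ∧ ∃ t : K, ∀ f,
      (1 + B.star * scalar m t) (grade K m i f) ∈ W) := by
  obtain ⟨f, hf, hf0⟩ := W.ne_bot_iff.1 hbot
  obtain ⟨J, hJ⟩ := Function.ne_iff.1 hf0
  rw [Pi.zero_apply] at hJ
  have hcard : J.card = i := by
    by_contra hne
    rw [← hWi f hf, grade_apply, if_neg hne] at hJ
    exact hJ rfl
  have hp := hW.pairProj_mem j J hf
  rw [pairProj_eq (ne_compl j J)] at hp
  subst hcard
  by_cases hcase : ∃ J' : Finset (Fin m), J'.card = J.card ∧ ∃ z : K, z ≠ 0 ∧ Pi.single J' z ∈ W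
  · obtain ⟨J', hJ', z, hz, hzW⟩ := hcase
    rw [← hJ']
    exact Or.inl fun f => hW.apply_grade_mem j B.commutes_one hz hzW f
  · right
    have hJc : f Jᶜ ≠ 0 := by
      intro h0
      rw [h0, Pi.single_zero, add_zero] at hp
      exact hcase ⟨J, rfl, f J, hJ, hp⟩
    have hcardc : Jᶜ.card = J.card := by
      by_contra hne
      rw [← hWi f hf, grade_apply, if_neg hne] at hJc
      exact hJc rfl
    rw [Finset.card_compl, Fintype.card_fin] at hcardc
    have hm : 2 * J.card = m := by
      have := Finset.card_le_univ J
      rw [Fintype.card_fin] at this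
      omega
    obtain ⟨φ, hφ⟩ := B.exists_star_apply
    have hstar : ∀ z, B.star (Pi.single J z) = Pi.single Jᶜ (φ Jᶜ * q.τ z) := by
      intro z
      obtain ⟨w, hw⟩ := B.star_single J z
      rw [hw]
      have := congrFun hw Jᶜ
      rw [hφ, compl_compl, Pi.single_eq_same, Pi.single_eq_same] at this
      rw [this]
    have hφ0 : φ Jᶜ ≠ 0 := by
      intro h0
      have h1 := B.star_star (Pi.single J (1 : K))
      rw [hstar, h0, zero_mul, Pi.single_zero, map_zero] at h1
      have h2 := congrFun h1 J
      rw [Pi.zero_apply, Pi.smul_apply, Pi.single_eq_same, eq_comm, smul_eq_zero] at h2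
      exact h2.elim B.starSq_ne_zero one_ne_zero
    -- Chosen so that star(t · f(J) e_J) = f(Jᶜ) e_{Jᶜ}; the surviving pair of coordinates is then
    -- the image of f(J) e_J under 1 + star∘t.
    set t : K := q.τ (f Jᶜ / φ Jᶜ) / f J with htdef
    have hg : B.Commutes (1 + B.star * scalar m t) := by
      intro v w x
      have := (B.commutes_star.mul (B.commutes_scalar t)) v w x
      rw [LinearMap.add_apply, LinearMap.add_apply, this, map_add]
      rfl
    have hgJ : (1 + B.star * scalar m t) (Pi.single J (f J)) ∈ W := by
      convert hp using 1
      rw [LinearMap.add_apply, Module.End.one_apply, Module.End.mul_apply, scalar_apply,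
        ← Pi.single_smul, hstar]
      congr 2
      rw [smul_eq_mul, htdef, div_mul_cancel₀ _ hJ, q.τ_τ, mul_div_cancel₀ _ hφ0]
    exact ⟨hm, t, hW.apply_grade_mem j hg hJ hgJ⟩

theorem exists_card_eq {i : ℕ} (hi : i ≤ m) : ∃ J : Finset (Fin m), J.card = i := by
  obtain ⟨J, -, hJ⟩ := Finset.exists_subset_card_eq (s := (Finset.univ : Finset (Fin m)))
    (n := i) (by simpa using hi)
  exact ⟨J, hJ⟩

theorem star_injective {f g : FockSpace K m} (h : B.star f = B.star g) : f = g := by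
  have := congrArg B.star h
  rw [star_star, star_star] at this
  exact smul_right_injective _ B.starSq_ne_zero this

/-- The involution `star ∘ t` has square `N(t) star²`. -/
theorem star_scalar_star_scalar (t : K) (f : FockSpace K m) :
    B.star (t • B.star (t • f)) = (algebraMap ℚ K B.starSq * (t * q.τ t)) • f := by
  rw [star_smul, star_star, ← algebraMap_smul K B.starSq, smul_smul, smul_smul]
  congr 1
  ring

/-- If (star∘t)² is a scalar other than 1, the image of 1 + star∘t already contains a nonzero
multiple of a basis vector, so the second alternative of the dichotomy collapses into the first. -/
theorem IsStable.eq_bot_or_top {W : Submodule ℚ (FockSpace K m)} (hW : B.IsStable W) (j : Fin m)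
    {i : ℕ} (him : i ≤ m) (hWi : ∀ f ∈ W, grade K m i f = f)
    (hi : 2 * i = m → ∀ t : K, algebraMap ℚ K B.starSq * (t * q.τ t) ≠ 1) :
    W = ⊥ ∨ ∀ f, grade K m i f ∈ W := by
  by_cases hbot : W = ⊥
  · exact Or.inl hbot
  right
  rcases hW.dichotomy j hWi hbot with h | ⟨hm, t, ht⟩
  · exact h
  have hJ : ∀ z : K, ∀ J : Finset (Fin m), J.card = i → Pi.single J z ∈ W := by
    obtain ⟨J, hJ⟩ := exists_card_eq him
    -- Applying 1 + s, with s = star∘t, to e_J and to s e_J and subtracting leaves e_J - s² e_J.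
    have h1 := ht (Pi.single J 1)
    have h2 := ht (B.star (t • Pi.single J 1))
    rw [grade_single, if_pos hJ] at h1
    rw [← B.star_grade (i := i) (by omega), ← Pi.single_smul, grade_single, if_pos hJ,
      Pi.single_smul] at h2
    have h3 := W.sub_mem h1 h2
    rw [LinearMap.add_apply, LinearMap.add_apply, Module.End.one_apply, Module.End.one_apply,
      Module.End.mul_apply, Module.End.mul_apply, scalar_apply, scalar_apply,
      star_scalar_star_scalar, add_comm (Pi.single J 1), add_sub_add_left_eq_sub] at h3
    have h4 : (Pi.single J 1 : FockSpace K m) -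
        (algebraMap ℚ K B.starSq * (t * q.τ t)) • Pi.single J 1 =
        Pi.single J (1 - algebraMap ℚ K B.starSq * (t * q.τ t)) := by
      rw [← Pi.single_smul, ← Pi.single_sub, smul_eq_mul, mul_one]
    rw [h4] at h3
    intro z J' hJ'
    exact hW.single_mem j (sub_ne_zero.2 (hi hm t).symm) h3 (hJ'.trans hJ.symm) z
  exact fun f => grade_mem (fun I hI y => hJ y I hI) f

/-- All of degree i cannot be fixed by star∘t, which moves e_J to the coordinate Jᶜ. So W contains
the image of 1 + star∘t', and comparing coordinates in the fixed-point equation forces t' = t. -/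
theorem IsStable.eq_bot_or_fixed {W : Submodule ℚ (FockSpace K m)} (hW : B.IsStable W) (j : Fin m)
    {i : ℕ} (him : 2 * i = m) (hWi : ∀ f ∈ W, grade K m i f = f) (t : K)
    (ht : ∀ f ∈ W, B.star (t • f) = f) :
    W = ⊥ ∨ ∀ f, (1 + B.star * scalar m t) (grade K m i f) ∈ W := by
  by_cases hbot : W = ⊥
  · exact Or.inl hbot
  right
  obtain ⟨J, hJ⟩ := exists_card_eq (show i ≤ m by omega)
  have hstar : ∀ z : K, B.star (Pi.single J z) J = 0 := by
    intro z
    obtain ⟨w, hw⟩ := B.star_single J z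
    rw [hw, Pi.single_eq_of_ne (ne_compl j J)]
  rcases hW.dichotomy j hWi hbot with h | ⟨-, t', ht'⟩
  · exfalso
    have h1 := ht _ (h (Pi.single J 1))
    rw [grade_single, if_pos hJ, ← Pi.single_smul] at h1
    have h2 := congrFun h1 J
    rw [hstar, Pi.single_eq_same] at h2
    exact zero_ne_one h2
  · have h1 := ht _ (ht' (Pi.single J 1))
    rw [grade_single, if_pos hJ, LinearMap.add_apply, Module.End.one_apply, Module.End.mul_apply,
      scalar_apply, smul_add, map_add] at h1
    have h2 : t = t' := by
      have h4 := congrArg (fun g => (B.star g) J) h1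
      simp only [map_add, Pi.add_apply] at h4
      rw [star_star, B.star_star (t' • _), B.star_star (t • B.star _), hstar, zero_add] at h4
      simp only [Pi.smul_apply, ← Pi.single_smul, hstar, smul_zero, add_zero,
        Pi.single_eq_same] at h4
      have h5 := smul_right_injective K B.starSq_ne_zero h4
      simpa using h5
    rw [h2]
    exact ht'

end HermBasis

end Stable

/-! ### Dimension of the even Clifford algebra -/

section Dim

variable {V : Type*} [AddCommGroup V] [Module ℚ V]

theorem finrank_cliffordAlgebra {n : ℕ} (b : Module.Basis (Fin n) ℚ V) (Q : QuadraticForm ℚ V) :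
    Module.Finite ℚ (CliffordAlgebra Q) ∧ Module.finrank ℚ (CliffordAlgebra Q) = 2 ^ n := by
  have : Invertible (2 : ℚ) := invertibleOfNonzero two_ne_zero
  let B := b.ExteriorAlgebra.map (CliffordAlgebra.equivExterior Q).symm
  refine ⟨Module.Finite.of_basis B, ?_⟩
  rw [Module.finrank_eq_card_basis B, Fintype.card_finset, Fintype.card_fin]

/-- Multiplication by an anisotropic vector embeds the even part into the odd part. The upper bound
suffices, since the lower one comes from a surjection onto copies of the Fock space. -/
theorem finrank_even_le {n : ℕ} (b : Module.Basis (Fin n) ℚ V) (Q : QuadraticForm ℚ V) {v : V}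
    (hv : Q v ≠ 0) : Module.Finite ℚ (CliffordAlgebra.even Q) ∧
      2 * Module.finrank ℚ (CliffordAlgebra.even Q) ≤ 2 ^ n := by
  obtain ⟨hfin, hdim⟩ := finrank_cliffordAlgebra b Q
  have hinj : Function.Injective (LinearMap.mulLeft ℚ (CliffordAlgebra.ι Q v)) := by
    intro x y hxy
    have h1 := congrArg (fun z => CliffordAlgebra.ι Q v * z) hxy
    simp only [LinearMap.mulLeft_apply, ← mul_assoc, CliffordAlgebra.ι_sq_scalar] at h1
    rw [← Algebra.smul_def, ← Algebra.smul_def] at h1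
    exact smul_right_injective _ hv h1
  have hmap : (CliffordAlgebra.evenOdd Q 0).map (LinearMap.mulLeft ℚ (CliffordAlgebra.ι Q v)) ≤
      CliffordAlgebra.evenOdd Q 1 := by
    rw [Submodule.map_le_iff_le_comap]
    intro x hx
    have h1 := CliffordAlgebra.evenOdd_mul_le Q 1 0
      (Submodule.mul_mem_mul (CliffordAlgebra.ι_mem_evenOdd_one Q v) hx)
    rwa [add_zero] at h1
  have h1 := Submodule.finrank_mono hmap
  rw [← (Submodule.equivMapOfInjective _ hinj _).finrank_eq] at h1
  have h2 := Submodule.finrank_add_eq_of_isCompl (CliffordAlgebra.evenOdd_isCompl Q)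
  have h3 : Module.finrank ℚ (CliffordAlgebra.even Q) =
      Module.finrank ℚ (CliffordAlgebra.evenOdd Q 0) := by
    rw [← CliffordAlgebra.even_toSubmodule]; rfl
  refine ⟨?_, by omega⟩
  exact Module.Finite.of_injective (CliffordAlgebra.even Q).val.toLinearMap Subtype.val_injective

end Dim

/-! ### Transitivity of the even Clifford algebra on the Fock space -/

section Surj

variable {m : ℕ}

theorem mem_of_pair_closed' {R : Set (Finset (Fin m))}
    (hR : ∀ J ∈ R, ∀ j k, j ≠ k → toggle j (toggle k J) ∈ R) {I J : Finset (Fin m)} (z : Fin m)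
    (hJ : J ∈ R) (hIJ : Even I.card ↔ Even J.card) : I ∈ R := by
  have hR' : ∀ J ∈ R, ∀ j k, toggle j (toggle k J) ∈ R := by
    intro J hJ j k
    by_cases hjk : j = k
    · subst hjk; rwa [toggle_toggle]
    · exact hR J hJ j k hjk
  have hpar : ∀ (j : Fin m) (L : Finset (Fin m)), Even (toggle j L).card ↔ ¬ Even L.card := by
    intro j L
    by_cases hj : j ∈ L
    · rw [← card_toggle_of_mem hj, Nat.even_add_one, not_not]
    · rw [card_toggle_of_not_mem hj, Nat.even_add_one]
  -- The fixed index z corrects the parity: the sets L for which L, or else L toggled at z, lies in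
  -- R according to parity are closed under single toggles.
  have := mem_of_toggle_closed (I := I)
    (R := {L | ((Even L.card ↔ Even J.card) → L ∈ R) ∧
      (¬ (Even L.card ↔ Even J.card) → toggle z L ∈ R)}) ?_ ⟨fun _ => hJ, fun h => absurd Iff.rfl h⟩
  · exact this.1 hIJ
  · rintro L ⟨h1, h2⟩ j
    refine ⟨fun h => ?_, fun h => ?_⟩
    · rw [hpar] at h
      have := hR' _ (h2 (by tauto)) j z
      rwa [toggle_toggle] at this
    · rw [hpar] at h
      exact hR' _ (h1 (by tauto)) _ _

variable {K : Type*} [Field K] [Algebra ℚ K] {q : ImagQuad K} {V : Type*} [AddCommGroup V]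
  [Module ℚ V] [Module K V] [IsScalarTower ℚ K V] {Q : LinearMap.BilinForm ℚ V}

namespace HermBasis

variable (B : HermBasis q Q m)

/-! ### The action of the even Clifford algebra on the Fock space -/

theorem cliff_mul_cliff_mem (v w : V) : B.cliff v * B.cliff w ∈ B.rep.evenHom.range :=
  ⟨_, B.rep.evenHom_bilin v w⟩

theorem theta_mem_range (j : Fin m) : theta q j ∈ B.rep.evenHom.range := by
  rw [B.theta_eq]
  refine Subalgebra.smul_mem _ (Subalgebra.add_mem _ (B.cliff_mul_cliff_mem _ _)
    (Subalgebra.smul_mem _ (B.cliff_mul_cliff_mem _ _) _)) _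

theorem op_single (j : Fin m) (J : Finset (Fin m)) : ∃ a : K, a ≠ 0 ∧ ∀ z,
    B.op j 1 (Pi.single J z) = Pi.single (toggle j J) (a * z) := by
  have h0 : CharZero K := algebraRat.charZero K
  have hh : algebraMap ℚ K (B.h j) ≠ 0 := by
    rw [Ne, map_eq_zero]; exact B.h_ne_zero j
  refine ⟨(if j ∈ J then algebraMap ℚ K (B.h j) else 1) * fermiSign j J, ?_, fun z => ?_⟩
  · refine mul_ne_zero ?_ (by exact_mod_cast fermiSign_ne_zero _ _)
    split_ifs
    · exact hh
    · exact one_ne_zero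
  · rw [op, fermi_single, map_one, one_mul, mul_assoc]

/-- The θ_j give all K-multiples of e_J, and c(b_j)c(b_k) with j ≠ k toggles two indices, so every
e_I of the same parity is reached. -/
theorem exists_mem_range_single {I J : Finset (Fin m)} (hIJ : Even I.card ↔ Even J.card)
    (z : Fin m) (y : K) :
    ∃ g ∈ B.rep.evenHom.range, g (Pi.single J 1) = Pi.single I y := by
  set S := B.rep.evenHom.range
  have hself : ∀ y : K, ∃ g ∈ S, g (Pi.single J 1) = Pi.single J y := by
    intro y
    obtain ⟨a, b, hab⟩ := q.exists_eq y
    by_cases hz : z ∈ J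
    · refine ⟨a • 1 + b • theta q z, Subalgebra.add_mem _ (Subalgebra.smul_mem _ S.one_mem _)
        (Subalgebra.smul_mem _ (B.theta_mem_range z) _), ?_⟩
      rw [LinearMap.add_apply, LinearMap.smul_apply, LinearMap.smul_apply, theta_single, if_pos hz,
        Module.End.one_apply, ← Pi.single_smul, ← Pi.single_smul, ← Pi.single_add, hab,
        Algebra.smul_def, Algebra.smul_def, mul_one, mul_one]
    · refine ⟨a • 1 + (-b) • theta q z, Subalgebra.add_mem _ (Subalgebra.smul_mem _ S.one_mem _)
        (Subalgebra.smul_mem _ (B.theta_mem_range z) _), ?_⟩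
      rw [LinearMap.add_apply, LinearMap.smul_apply, LinearMap.smul_apply, theta_single, if_neg hz,
        Module.End.one_apply, ← Pi.single_smul, ← Pi.single_smul, ← Pi.single_add, hab,
        Algebra.smul_def, Algebra.smul_def, mul_one, mul_one, map_neg, neg_mul_neg]
  suffices h : ∀ L ∈ {L : Finset (Fin m) | ∀ y : K, ∃ g ∈ S, g (Pi.single J 1) = Pi.single L y},
      ∀ j k, j ≠ k → toggle j (toggle k L) ∈
        {L : Finset (Fin m) | ∀ y : K, ∃ g ∈ S, g (Pi.single J 1) = Pi.single L y} from
    mem_of_pair_closed' h z (J := J) hself hIJ y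
  intro L hL j k _ y
  obtain ⟨a, ha, h1⟩ := B.op_single k L
  obtain ⟨a', ha', h2⟩ := B.op_single j (toggle k L)
  obtain ⟨g, hg, h3⟩ := hL (a⁻¹ * (a'⁻¹ * y))
  refine ⟨B.cliff ((1 : K) • B.b j) * B.cliff ((1 : K) • B.b k) * g,
    S.mul_mem (B.cliff_mul_cliff_mem _ _) hg, ?_⟩
  rw [Module.End.mul_apply, Module.End.mul_apply, h3, cliff_smul_basis, cliff_smul_basis, h1, h2,
    mul_inv_cancel_left₀ ha, mul_inv_cancel_left₀ ha']

theorem pairProj_single (J L : Finset (Fin m)) (y : K) :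
    pairProj K J (Pi.single L y) = if L = J ∨ L = Jᶜ then Pi.single L y else 0 := by
  funext I
  rw [pairProj_apply]
  by_cases hI : I = L
  · subst hI; split_ifs <;> simp
  · split_ifs <;> simp [hI]

/-- The vectors generating the Fock space over the even Clifford algebra. -/
def seed (K : Type*) [Field K] (p : Fin m) (T : Finset (Fin m)) : FockSpace K m :=
  Pi.single T 1 + Pi.single (toggle p T) 1

/-- Each seed has a component in both parities, so even elements can reach every e_I from it. All
index sets occurring avoid z, so no two of them are complementary and `pairProj` isolates a single
component of a single seed. -/
theorem exists_even_seed {p z : Fin m} (hpz : p ≠ z) {T₀ : Finset (Fin m)}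
    (hT₀ : p ∉ T₀ ∧ z ∉ T₀) (I : Finset (Fin m)) (y : K) :
    ∃ g ∈ B.rep.evenHom.range, ∀ T : Finset (Fin m), p ∉ T ∧ z ∉ T →
      g (seed K p T) = if T = T₀ then Pi.single I y else 0 := by
  set S := B.rep.evenHom.range
  have hproj : ∀ J : Finset (Fin m), (J = T₀ ∨ J = toggle p T₀) →
      ∀ T : Finset (Fin m), p ∉ T ∧ z ∉ T →
        pairProj K J (seed K p T) = if T = T₀ then Pi.single J 1 else 0 := by
    intro J hJ T hT
    have hz1 : z ∉ toggle p T := by rw [mem_toggle_of_ne hpz.symm]; exact hT.2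
    have hz0 : z ∉ toggle p T₀ := by rw [mem_toggle_of_ne hpz.symm]; exact hT₀.2
    have hzJ : z ∉ J := by
      rcases hJ with rfl | rfl
      · exact hT₀.2
      · exact hz0
    have hzJc : z ∈ Jᶜ := Finset.mem_compl.2 hzJ
    have n1 : T ≠ Jᶜ := by rintro rfl; exact hT.2 hzJc
    have n2 : toggle p T ≠ Jᶜ := by intro h; rw [h] at hz1; exact hz1 hzJc
    rw [seed, map_add, pairProj_single, pairProj_single]
    rcases hJ with rfl | rfl
    · have n3 : toggle p T ≠ J := by
        intro h
        exact hT₀.1 (h ▸ mem_toggle_self.2 hT.1)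
      by_cases h : T = J
      · simp [h, h ▸ n3, h ▸ n2]
      · simp [h, n1, n2, n3]
    · have n3 : T ≠ toggle p T₀ := by
        intro h
        exact hT.1 (h ▸ mem_toggle_self.2 hT₀.1)
      by_cases h : T = T₀
      · subst h; simp [n1, n3]
      · have n4 : toggle p T ≠ toggle p T₀ := by
          intro h'
          rw [toggle_eq_iff, toggle_toggle] at h'
          exact h h'
        simp [h, n1, n2, n3, n4]
  obtain ⟨J, hJ, hJI⟩ : ∃ J : Finset (Fin m), (J = T₀ ∨ J = toggle p T₀) ∧
      (Even I.card ↔ Even J.card) := by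
    by_cases h : Even I.card ↔ Even T₀.card
    · exact ⟨T₀, Or.inl rfl, h⟩
    · refine ⟨toggle p T₀, Or.inr rfl, ?_⟩
      rw [card_toggle_of_not_mem hT₀.1, Nat.even_add_one]
      tauto
  obtain ⟨g, hg, h1⟩ := B.exists_mem_range_single hJI z y
  refine ⟨g * pairProj K J, S.mul_mem hg (HermBasis.pairProj_mem (fun j => B.theta_mem_range j) z J),
    fun T hT => ?_⟩
  rw [Module.End.mul_apply, hproj J hJ T hT]
  split_ifs
  · exact h1
  · exact map_zero g

theorem exists_even_forall_seed {p z : Fin m} (hpz : p ≠ z) {κ : Type*} [Fintype κ]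
    {T : κ → Finset (Fin m)} (hT : Function.Injective T) (hT' : ∀ k, p ∉ T k ∧ z ∉ T k)
    (Y : κ → FockSpace K m) :
    ∃ x : EvenClifford Q, ∀ k, B.rep.evenHom x (seed K p (T k)) = Y k := by
  classical
  choose g hg h1 using fun (k : κ) (I : Finset (Fin m)) =>
    B.exists_even_seed hpz (hT' k) I (Y k I)
  choose x hx using hg
  refine ⟨∑ k, ∑ I, x k I, fun k => ?_⟩
  simp only [map_sum, LinearMap.sum_apply]
  have hx' : ∀ k I, B.rep.evenHom (x k I) = g k I := hx
  simp only [hx']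
  rw [Finset.sum_eq_single k]
  · have : ∀ I, g k I (seed K p (T k)) = Pi.single I (Y k I) := fun I => by
      rw [h1 k I _ (hT' k), if_pos rfl]
    rw [Finset.sum_congr rfl fun I _ => this I, Finset.univ_sum_single]
  · intro k' _ hk'
    refine Finset.sum_eq_zero fun I _ => ?_
    rw [h1 k' I _ (hT' k), if_neg fun h => hk' (hT h).symm]
  · simp

end HermBasis

end Surj

/-! ### Ranks of Clifford multiplications and general Hodge structures -/

section Generic

theorem exists_linearIndependent_of_le_finrank_span {E : Type*} [AddCommGroup E] [Module ℂ E]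
    [FiniteDimensional ℂ E] {s : Set E} {k : ℕ}
    (hk : k ≤ Module.finrank ℂ (Submodule.span ℂ s)) :
    ∃ f : Fin k → E, (∀ i, f i ∈ s) ∧ LinearIndependent ℂ f := by
  obtain ⟨f, hf, -, hli⟩ := Submodule.exists_fun_fin_finrank_span_eq ℂ s
  exact ⟨f ∘ Fin.castLE hk, fun i => hf _, hli.comp _ (Fin.castLE_injective hk)⟩

theorem exists_minor_ne_zero {k N : ℕ} {A : Matrix (Fin k) (Fin N) ℂ}
    (hA : LinearIndependent ℂ A.row) : ∃ t : Fin k → Fin N, (A.submatrix id t).det ≠ 0 := by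
  have h1 : k ≤ Module.finrank ℂ (Submodule.span ℂ (Set.range A.col)) := by
    rw [← Matrix.rank_eq_finrank_span_cols, hA.rank_matrix, Fintype.card_fin]
  obtain ⟨f, hf, hli⟩ := exists_linearIndependent_of_le_finrank_span h1
  choose t ht using hf
  refine ⟨t, ?_⟩
  have h2 : LinearIndependent ℂ (A.submatrix id t).col := by
    have : (A.submatrix id t).col = f := by
      funext j
      rw [← ht j]
      rfl
    rwa [this]
  rw [Matrix.linearIndependent_cols_iff_isUnit, Matrix.isUnit_iff_isUnit_det] at h2
  exact h2.ne_zero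

theorem isHomogeneous_det {k n : ℕ} {A : Matrix (Fin k) (Fin k) (MvPolynomial (Fin n) ℚ)}
    (hA : ∀ i j, (A i j).IsHomogeneous 1) : A.det.IsHomogeneous k := by
  rw [Matrix.det_apply]
  refine MvPolynomial.IsHomogeneous.sum _ _ _ fun σ _ => ?_
  have h := MvPolynomial.IsHomogeneous.prod Finset.univ (fun i => A (σ i) i) (fun _ => 1)
    fun i _ => hA _ _
  rw [Finset.sum_const, Finset.card_univ, Fintype.card_fin, smul_eq_mul, mul_one] at h
  rw [Units.smul_def, ← Int.cast_smul_eq_zsmul ℚ, MvPolynomial.smul_eq_C_mul]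
  have h2 := (MvPolynomial.isHomogeneous_C (Fin n) (((Equiv.Perm.sign σ : ℤ) : ℚ))).mul h
  rwa [zero_add] at h2

variable {V M : Type*} [AddCommGroup V] [Module ℚ V] [AddCommGroup M] [Module ℚ M]

/-- The rank on `W_ℂ` of the operator `c(ω)`. -/
noncomputable def rankC (c : V →ₗ[ℚ] Module.End ℚ M) (W : Submodule ℚ M) (ω : ℂ ⊗[ℚ] V) : ℕ :=
  Module.finrank ℂ ((W.baseChange ℂ).map (endC c ω))

theorem map_endC_eq_span (c : V →ₗ[ℚ] Module.End ℚ M) (W : Submodule ℚ M) (ω : ℂ ⊗[ℚ] V) :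
    (W.baseChange ℂ).map (endC c ω) =
      Submodule.span ℂ ((fun w : M => endC c ω (1 ⊗ₜ w)) '' W) := by
  rw [Submodule.baseChange_eq_span, Submodule.map_span]
  congr 1
  ext x
  simp

theorem repr_endC {n N : ℕ} (b : Module.Basis (Fin n) ℚ V) (e : Module.Basis (Fin N) ℚ M)
    (c : V →ₗ[ℚ] Module.End ℚ M) (ω : ℂ ⊗[ℚ] V) (w : M) (t : Fin N) :
    (e.baseChange ℂ).repr (endC c ω (1 ⊗ₜ w)) t =
      ∑ s, (b.baseChange ℂ).repr ω s * algebraMap ℚ ℂ (e.repr (c (b s) w) t) := by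
  conv_lhs => rw [← (b.baseChange ℂ).sum_repr ω]
  simp only [map_sum, map_smul, LinearMap.sum_apply, LinearMap.smul_apply,
    Module.Basis.baseChange_apply, endC_tmul_tmul, Finsupp.coe_finsetSum, Finset.sum_apply,
    Finsupp.smul_apply, Module.Basis.baseChange_repr_tmul, smul_eq_mul]
  simp [Algebra.smul_def]

/-- Rank at least k is certified by a nonzero k × k minor of the matrix of c(ω) on vectors of W. The
entries are linear forms in ω with rational coefficients because W is rational, so only countably
many minors arise over all W. -/
theorem exists_polynomial_le_rankC [FiniteDimensional ℚ M] {n : ℕ}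
    (b : Module.Basis (Fin n) ℚ V) (c : V →ₗ[ℚ] Module.End ℚ M) (W : Submodule ℚ M)
    (ω' : ℂ ⊗[ℚ] V) {k : ℕ} (hk : k ≤ rankC c W ω') :
    ∃ P : MvPolynomial (Fin n) ℚ, P.IsHomogeneous k ∧
      evalC b (P.map (algebraMap ℚ ℂ)) ω' ≠ 0 ∧
      ∀ ω, evalC b (P.map (algebraMap ℚ ℂ)) ω ≠ 0 → k ≤ rankC c W ω := by
  rw [rankC, map_endC_eq_span] at hk
  obtain ⟨f, hf, hli⟩ := exists_linearIndependent_of_le_finrank_span hk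
  choose w hw hwf using hf
  let e := Module.finBasis ℚ M
  let A (ω : ℂ ⊗[ℚ] V) : Matrix (Fin k) (Fin (Module.finrank ℚ M)) ℂ :=
    Matrix.of fun i t => (e.baseChange ℂ).repr (endC c ω (1 ⊗ₜ w i)) t
  have hA : LinearIndependent ℂ (A ω').row := by
    have h1 := hli.map' ((Finsupp.linearEquivFunOnFinite ℂ ℂ _).toLinearMap ∘ₗ
      (e.baseChange ℂ).repr.toLinearMap) (by
        rw [LinearMap.ker_eq_bot]
        exact (Finsupp.linearEquivFunOnFinite ℂ ℂ _).injective.comp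
          (e.baseChange ℂ).repr.injective)
    have e1 : (A ω').row = ((Finsupp.linearEquivFunOnFinite ℂ ℂ _).toLinearMap ∘ₗ
        (e.baseChange ℂ).repr.toLinearMap) ∘ f := by
      funext i
      rw [Function.comp_apply, ← hwf i]
      rfl
    rw [e1]
    exact h1
  obtain ⟨t, ht⟩ := exists_minor_ne_zero hA
  -- The same minor with the coordinates of ω as indeterminates; rows w_i and columns t_j were
  -- chosen at ω'.
  let P : Matrix (Fin k) (Fin k) (MvPolynomial (Fin n) ℚ) := Matrix.of fun i j =>
    ∑ s, MvPolynomial.X s * MvPolynomial.C (e.repr (c (b s) (w i)) (t j))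
  have hP : ∀ ω, evalC b (P.det.map (algebraMap ℚ ℂ)) ω = ((A ω).submatrix id t).det := by
    intro ω
    rw [evalC, RingHom.map_det, RingHom.map_det]
    congr 1
    ext i j
    simp only [P, A, RingHom.mapMatrix_apply, Matrix.map_apply, Matrix.of_apply,
      Matrix.submatrix_apply, id, map_sum, map_mul, MvPolynomial.map_X, MvPolynomial.map_C,
      MvPolynomial.eval_X, MvPolynomial.eval_C, repr_endC b e]
  refine ⟨P.det, isHomogeneous_det fun i j => ?_, by rwa [hP], fun ω hω => ?_⟩
  · simp only [P, Matrix.of_apply]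
    refine MvPolynomial.IsHomogeneous.sum _ _ _ fun s _ => ?_
    exact (MvPolynomial.isHomogeneous_X ℚ s).mul (MvPolynomial.isHomogeneous_C _ _)
  · rw [hP] at hω
    have h1 : LinearIndependent ℂ ((A ω).submatrix id t).row := by
      rw [Matrix.linearIndependent_rows_iff_isUnit, Matrix.isUnit_iff_isUnit_det]
      exact isUnit_iff_ne_zero.2 hω
    have h2 : LinearIndependent ℂ fun i => endC c ω (1 ⊗ₜ w i) := by
      refine LinearIndependent.of_comp (LinearMap.funLeft ℂ ℂ t ∘ₗ
        (Finsupp.linearEquivFunOnFinite ℂ ℂ _).toLinearMap ∘ₗ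
        (e.baseChange ℂ).repr.toLinearMap) ?_
      exact h1
    have h3 := finrank_span_eq_card h2
    rw [Fintype.card_fin] at h3
    rw [rankC, map_endC_eq_span, ← h3]
    refine Submodule.finrank_mono (Submodule.span_mono ?_)
    rintro _ ⟨i, rfl⟩
    exact ⟨w i, hw i, rfl⟩

theorem repr_conjC {n : ℕ} (b : Module.Basis (Fin n) ℚ V) (x : ℂ ⊗[ℚ] V) (i : Fin n) :
    (b.baseChange ℂ).repr (conjC V x) i = starRingEnd ℂ ((b.baseChange ℂ).repr x i) := by
  induction x with
  | zero => simp
  | add x y hx hy => simp [hx, hy]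
  | tmul z v => simp [Module.Basis.baseChange_repr_tmul, Algebra.smul_def]

theorem evalC_map_conjC {n : ℕ} (b : Module.Basis (Fin n) ℚ V) (P : MvPolynomial (Fin n) ℚ)
    (x : ℂ ⊗[ℚ] V) : evalC b (P.map (algebraMap ℚ ℂ)) (conjC V x) =
      starRingEnd ℂ (evalC b (P.map (algebraMap ℚ ℂ)) x) := by
  simp only [evalC, repr_conjC, MvPolynomial.eval_map]
  rw [MvPolynomial.hom_eval₂]
  congr 1
  exact Subsingleton.elim _ _

/-- The certifying minor has rational coefficients, so its value at ω̄ is the conjugate of its value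
at ω. -/
theorem rankC_le_conjC [FiniteDimensional ℚ M] {n : ℕ} (b : Module.Basis (Fin n) ℚ V)
    (c : V →ₗ[ℚ] Module.End ℚ M) (W : Submodule ℚ M) (ω : ℂ ⊗[ℚ] V) :
    rankC c W ω ≤ rankC c W (conjC V ω) := by
  obtain ⟨P, -, h1, h2⟩ := exists_polynomial_le_rankC b c W ω le_rfl
  refine h2 _ ?_
  rw [evalC_map_conjC]
  simpa using h1

/-! ### Maximality of ranks at a general period -/

section Field

variable {K : Type*} [Field K] [Algebra ℚ K] [Module K V] [IsScalarTower ℚ K V]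

/-- The rational homogeneous polynomials that vanish on no eigenspace of `K`. -/
def exceptionalFamily (K : Type*) {V : Type*} [Field K] [Algebra ℚ K] [AddCommGroup V]
    [Module ℚ V] [Module K V] [IsScalarTower ℚ K V] {n : ℕ} (b : Module.Basis (Fin n) ℚ V) :
    Set (MvPolynomial (Fin n) ℂ) :=
  {P | (∃ P₀ : MvPolynomial (Fin n) ℚ, P₀.map (algebraMap ℚ ℂ) = P) ∧
    (∃ d, P.IsHomogeneous d) ∧ ∀ σ : K →+* ℂ, ∃ ω ∈ eigenspaceC V σ, evalC b P ω ≠ 0}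

theorem isExceptionalFamily {n : ℕ} (b : Module.Basis (Fin n) ℚ V) :
    IsExceptionalFamily K b (exceptionalFamily K b) := by
  have : Countable (MvPolynomial (Fin n) ℚ) := by
    rw [← Cardinal.mk_le_aleph0_iff]
    refine MvPolynomial.cardinalMk_le_max.trans ?_
    simp
  refine ⟨(Set.countable_range (MvPolynomial.map (algebraMap ℚ ℂ))).mono ?_, fun P hP => hP.2⟩
  rintro P ⟨⟨P₀, rfl⟩, -⟩
  exact ⟨P₀, rfl⟩

theorem ImagQuad.mem_eigenspaceC (q : ImagQuad K) (σ : K →+* ℂ) {x : ℂ ⊗[ℚ] V}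
    (hx : (kAct V q.δ).baseChange ℂ x = σ q.δ • x) : x ∈ eigenspaceC V σ := by
  rw [eigenspaceC, Submodule.mem_iInf]
  intro y
  obtain ⟨r, s, rfl⟩ := q.exists_eq y
  have h1 : kAct V (algebraMap ℚ K r + algebraMap ℚ K s * q.δ) =
      r • LinearMap.id + s • kAct V q.δ := by
    ext v
    simp only [kAct, Algebra.lsmul_coe, LinearMap.add_apply, LinearMap.smul_apply,
      LinearMap.id_apply, add_smul, mul_smul, algebraMap_smul]
  have h2 : ∀ r : ℚ, σ (algebraMap ℚ K r) = r := fun r => by simp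
  rw [LinearMap.mem_eqLocus, h1, LinearMap.baseChange_add, LinearMap.baseChange_smul,
    LinearMap.baseChange_smul, LinearMap.baseChange_id]
  simp only [LinearMap.add_apply, LinearMap.smul_apply, LinearMap.id_apply, hx, map_add, map_mul,
    h2]
  have h3 : ∀ (r : ℚ) (y : ℂ ⊗[ℚ] V), r • y = (r : ℂ) • y := fun r y => by
    rw [← eq_ratCast (algebraMap ℚ ℂ), algebraMap_smul]
  rw [h3, h3]
  module

/-- The minor certifying the rank at ω' belongs to the exceptional family, so it does not vanish at
the general ω. -/
theorem rankC_le_of_isGeneral [FiniteDimensional ℚ M] (q : ImagQuad K) {n : ℕ}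
    {b : Module.Basis (Fin n) ℚ V} {h : HodgeStructure V 2}
    (hg : h.IsGeneral b (exceptionalFamily K b)) (c : V →ₗ[ℚ] Module.End ℚ M)
    (W : Submodule ℚ M) {ω ω' : ℂ ⊗[ℚ] V} (hω : ω ∈ h.comp 2 0) (hω0 : ω ≠ 0) {l : ℂ}
    (hl : l * l = -q.d) (hω' : (kAct V q.δ).baseChange ℂ ω' = l • ω') :
    rankC c W ω' ≤ rankC c W ω := by
  obtain ⟨P, hP, h1, h2⟩ := exists_polynomial_le_rankC b c W ω' le_rfl
  refine h2 _ (hg _ ⟨⟨P, rfl⟩, ⟨_, hP.map _⟩, fun σ => ?_⟩ ω hω hω0)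
  have hσ : σ q.δ * σ q.δ = l * l := by
    rw [← map_mul, q.δ_mul_δ, hl]
    simp
  -- The family demands nonvanishing on the eigenspaces of both embeddings; ω' serves one of them
  -- and its conjugate the other.
  rcases mul_self_eq_mul_self_iff.1 hσ with hσ | hσ
  · exact ⟨ω', q.mem_eigenspaceC σ (by rw [hω', hσ]), h1⟩
  · refine ⟨conjC V ω', q.mem_eigenspaceC σ ?_, ?_⟩
    · rw [← conjC_baseChange, hω', conjC_smul, conj_of_mul_self q.d_pos hl, hσ]
    · rw [evalC_map_conjC]
      simpa using h1

end Field

/-! ### From rank inequalities to stability -/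

theorem tmul_mem_baseChange_iff (W : Submodule ℚ M) (x : M) :
    (1 : ℂ) ⊗ₜ[ℚ] x ∈ W.baseChange ℂ ↔ x ∈ W := by
  refine ⟨fun h => ?_, fun h => Submodule.tmul_mem_baseChange_of_mem _ h⟩
  have h1 : W.baseChange ℂ ≤ LinearMap.ker (W.mkQ.baseChange ℂ) := by
    rw [Submodule.baseChange_eq_span, Submodule.span_le]
    rintro _ ⟨y, hy, rfl⟩
    have : W.mkQ y = 0 := by simpa using hy
    simp [this]
  have h2 := h1 h
  rw [LinearMap.mem_ker, LinearMap.baseChange_tmul] at h2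
  have h3 := Module.Flat.tensorProduct_mk_injective (R := ℚ) (S := ℂ) (M := M ⧸ W)
  have h4 : W.mkQ x = 0 := h3 (by rw [map_zero]; exact h2)
  simpa using h4

theorem finrank_map_add_finrank_inf_ker {E F : Type*} [AddCommGroup E] [Module ℂ E]
    [AddCommGroup F] [Module ℂ F] [FiniteDimensional ℂ E] (f : E →ₗ[ℂ] F)
    (N : Submodule ℂ E) : Module.finrank ℂ (N.map f) + Module.finrank ℂ ↥(N ⊓ LinearMap.ker f) =
      Module.finrank ℂ N := by
  have h := (f.domRestrict N).finrank_range_add_finrank_ker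
  rw [LinearMap.range_domRestrict] at h
  rw [← h, LinearMap.ker_domRestrict]
  congr 1
  rw [← Submodule.map_comap_subtype]
  exact (Submodule.equivSubtypeMap N _).finrank_eq.symm

variable {Q : LinearMap.BilinForm ℚ V} (C : CliffordRep Q M)

/-- If the two kernels span W_ℂ, their dimensions add up to at least dim W_ℂ. In this form the Hodge
condition involves only ranks, and so spreads from a general period to the whole eigenspaces. -/
theorem rankC_add_rankC_le [FiniteDimensional ℚ M] {W : Submodule ℚ M} {ω η : ℂ ⊗[ℚ] V}
    (hW : ∀ x ∈ W.baseChange ℂ, ∃ y ∈ W.baseChange ℂ, ∃ z ∈ W.baseChange ℂ,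
      endC C.c ω y = 0 ∧ endC C.c η z = 0 ∧ x = y + z) :
    rankC C.c W ω + rankC C.c W η ≤ Module.finrank ℂ (W.baseChange ℂ) := by
  have h1 := finrank_map_add_finrank_inf_ker (endC C.c ω) (W.baseChange ℂ)
  have h2 := finrank_map_add_finrank_inf_ker (endC C.c η) (W.baseChange ℂ)
  have h3 : W.baseChange ℂ ≤ (W.baseChange ℂ ⊓ LinearMap.ker (endC C.c ω)) ⊔
      (W.baseChange ℂ ⊓ LinearMap.ker (endC C.c η)) := by
    intro x hx
    obtain ⟨y, hy, z, hz, hy', hz', rfl⟩ := hW x hx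
    exact Submodule.add_mem_sup ⟨hy, hy'⟩ ⟨hz, hz'⟩
  have h4 := (Submodule.finrank_mono h3).trans (Submodule.finrank_add_le_finrank_add_finrank _ _)
  unfold rankC
  omega

/-- The anticommutator of c(ω) and c(η) is a nonzero scalar, so their kernels are disjoint and the
rank bound makes them span W_ℂ. Then c(η)c(ω) is 0 on one kernel and that scalar on the other. -/
theorem endC_endC_mem [FiniteDimensional ℚ M] {W : Submodule ℚ M} {ω η : ℂ ⊗[ℚ] V}
    (hW : rankC C.c W ω + rankC C.c W η ≤ Module.finrank ℂ (W.baseChange ℂ))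
    (hs : LinearMap.BilinForm.baseChange ℂ Q ω η + LinearMap.BilinForm.baseChange ℂ Q η ω ≠ 0)
    {x : ℂ ⊗[ℚ] M} (hx : x ∈ W.baseChange ℂ) :
    endC C.c η (endC C.c ω x) ∈ W.baseChange ℂ := by
  have h1 := finrank_map_add_finrank_inf_ker (endC C.c ω) (W.baseChange ℂ)
  have h2 := finrank_map_add_finrank_inf_ker (endC C.c η) (W.baseChange ℂ)
  have h3 : (W.baseChange ℂ ⊓ LinearMap.ker (endC C.c ω)) ⊓
      (W.baseChange ℂ ⊓ LinearMap.ker (endC C.c η)) = ⊥ := by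
    rw [eq_bot_iff]
    rintro x ⟨⟨-, h3⟩, -, h4⟩
    have := C.antiC ω η x
    rw [LinearMap.mem_ker.1 h3, LinearMap.mem_ker.1 h4, map_zero, map_zero, add_zero] at this
    exact (smul_eq_zero.1 this.symm).resolve_left hs
  have h4 := Submodule.finrank_sup_add_finrank_inf_eq
    (W.baseChange ℂ ⊓ LinearMap.ker (endC C.c ω)) (W.baseChange ℂ ⊓ LinearMap.ker (endC C.c η))
  rw [h3, finrank_bot] at h4
  have h5 : (W.baseChange ℂ ⊓ LinearMap.ker (endC C.c ω)) ⊔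
      (W.baseChange ℂ ⊓ LinearMap.ker (endC C.c η)) = W.baseChange ℂ := by
    refine Submodule.eq_of_le_of_finrank_le (sup_le inf_le_left inf_le_left) ?_
    unfold rankC at hW
    omega
  rw [← h5] at hx
  obtain ⟨y, ⟨-, hy⟩, z, ⟨hz, hz'⟩, rfl⟩ := Submodule.mem_sup.1 hx
  have := C.antiC ω η z
  rw [LinearMap.mem_ker.1 hz', map_zero, zero_add] at this
  rw [map_add, LinearMap.mem_ker.1 hy, zero_add, this]
  exact Submodule.smul_mem _ _ hz

/-! ### Eigencomponents of rational vectors -/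

/-- The component of `1 ⊗ v` in the `l`-eigenspace of `D`, if `D² = l²`. -/
noncomputable def eigenpart (D : V →ₗ[ℚ] V) (l : ℂ) (v : V) : ℂ ⊗[ℚ] V :=
  (1 / 2 : ℂ) • (1 ⊗ₜ v + l⁻¹ ⊗ₜ D v)

variable {D : V →ₗ[ℚ] V} {d : ℚ} {l : ℂ}

theorem baseChange_eigenpart (hl : l * l = -d) (hd : 0 < d) (hD : ∀ v, D (D v) = -d • v) (v : V) :
    D.baseChange ℂ (eigenpart D l v) = l • eigenpart D l v := by
  have hl0 : l ≠ 0 := by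
    rintro rfl
    simp at hl
    exact hd.ne' hl
  have h1 : l⁻¹ * (-d : ℂ) = l := by rw [← hl]; field_simp
  simp only [eigenpart, map_add, LinearMap.baseChange_tmul, hD, smul_add,
    TensorProduct.tmul_smul, TensorProduct.smul_tmul', smul_eq_mul]
  have h2 : (-d : ℚ) • (1 / 2 * l⁻¹ : ℂ) = l * (1 / 2 * 1) := by
    rw [Algebra.smul_def]
    simp only [map_neg, eq_ratCast]
    linear_combination (1/2 : ℂ) * h1
  have h3 : l * (1 / 2 * l⁻¹) = 1 / 2 * 1 := by field_simp
  rw [h3, h2, add_comm]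

theorem conjC_eigenpart (hl : l * l = -d) (hd : 0 < d) (v : V) :
    conjC V (eigenpart D l v) = eigenpart D (-l) v := by
  rw [eigenpart, conjC_smul, map_add, conjC_tmul, conjC_tmul, map_one, map_inv₀,
    conj_of_mul_self hd hl, eigenpart, map_div₀, map_one, map_ofNat]

theorem eigenpart_add (v w : V) : eigenpart D l (v + w) = eigenpart D l v + eigenpart D l w := by
  simp only [eigenpart, map_add, TensorProduct.tmul_add]
  module

theorem eigenpart_add_eigenpart_neg (v : V) :
    eigenpart D l v + eigenpart D (-l) v = 1 ⊗ₜ v := by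
  simp only [eigenpart, inv_neg, TensorProduct.neg_tmul]
  module

theorem tmul_apply_eq (hl0 : l ≠ 0) (v : V) :
    (1 : ℂ) ⊗ₜ D v = l • (eigenpart D l v - eigenpart D (-l) v) := by
  have : (1 : ℂ) ⊗ₜ[ℚ] D v = (l * l⁻¹) ⊗ₜ D v := by rw [mul_inv_cancel₀ hl0]
  rw [this, ← smul_eq_mul, ← TensorProduct.smul_tmul']
  simp only [eigenpart, inv_neg, TensorProduct.neg_tmul]
  module

/-- On products of components for the same eigenvalue the term d⁻¹c(δv)c(δw) contributes l²/d = -1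
and cancels; on opposite components it doubles. -/
theorem tmul_unitary (hl : l * l = -d) (hd : 0 < d) (v w : V) (x : M) :
    (1 : ℂ) ⊗ₜ[ℚ] C.unitary D d v w x = (2 : ℂ) •
      (endC C.c (eigenpart D l v) (endC C.c (eigenpart D (-l) w) (1 ⊗ₜ x)) +
        endC C.c (eigenpart D (-l) v) (endC C.c (eigenpart D l w) (1 ⊗ₜ x))) := by
  have hd' : (d : ℂ) ≠ 0 := by exact_mod_cast hd.ne'
  have hl0 : l ≠ 0 := by
    rintro rfl
    simp at hl
    exact hd.ne' hl
  have h1 : ∀ (v w : V) (x : M), (1 : ℂ) ⊗ₜ[ℚ] C.c v (C.c w x) =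
      endC C.c (1 ⊗ₜ v) (endC C.c (1 ⊗ₜ w) (1 ⊗ₜ x)) := fun v w x => by
    rw [endC_tmul_tmul, endC_tmul_tmul, mul_one, mul_one]
  have h2 : ∀ y : M, (1 : ℂ) ⊗ₜ[ℚ] (d⁻¹ • y) = (d⁻¹ : ℂ) • (1 : ℂ) ⊗ₜ[ℚ] y := fun y => by
    rw [TensorProduct.tmul_smul, ← Rat.cast_inv, ← eq_ratCast (algebraMap ℚ ℂ), algebraMap_smul]
  simp only [CliffordRep.unitary, LinearMap.add_apply, LinearMap.smul_apply,
    Module.End.mul_apply, TensorProduct.tmul_add, h2, h1, tmul_apply_eq (D := D) hl0,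
    ← eigenpart_add_eigenpart_neg (D := D) (l := l), map_add, map_sub, map_smul,
    LinearMap.sub_apply, LinearMap.smul_apply]
  match_scalars <;> field_simp <;>
    first | linear_combination hl | linear_combination 2 * hl | linear_combination -2 * hl |
      linear_combination -hl

theorem baseChange_form_left (hDQ : ∀ v w, Q (D v) w = -Q v (D w)) (x y : ℂ ⊗[ℚ] V) :
    LinearMap.BilinForm.baseChange ℂ Q (D.baseChange ℂ x) y =
      -LinearMap.BilinForm.baseChange ℂ Q x (D.baseChange ℂ y) := by
  induction x with
  | zero => simp
  | add x x' h h' => simp only [map_add, LinearMap.add_apply, h, h']; ring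
  | tmul z v =>
  induction y with
  | zero => simp
  | add y y' h h' => simp only [map_add, h, h']; ring
  | tmul t w => simp [hDQ]

/-- D is skew for Q, so a pair with eigenvalue k satisfies k Q(x,y) = -k Q(x,y). -/
theorem form_eq_zero_of_eigen (hDQ : ∀ v w, Q (D v) w = -Q v (D w)) {k : ℂ} (hk : k ≠ 0)
    {x y : ℂ ⊗[ℚ] V} (hx : D.baseChange ℂ x = k • x) (hy : D.baseChange ℂ y = k • y) :
    LinearMap.BilinForm.baseChange ℂ Q x y = 0 := by
  have h1 := baseChange_form_left hDQ x y
  rw [hx, hy, map_smul, map_smul, LinearMap.smul_apply, smul_eq_mul] at h1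
  have h2 : k * LinearMap.BilinForm.baseChange ℂ Q x y = 0 := by linear_combination h1 / 2
  exact (mul_eq_zero.1 h2).resolve_left hk

theorem mem_of_rankC_le [FiniteDimensional ℚ M] (hl : l * l = -d) (hd : 0 < d)
    (hD : ∀ v, D (D v) = -d • v) (hDQ : ∀ v w, Q (D v) w = -Q v (D w))
    (hQ : ∀ w, w ≠ 0 → ∃ u, Q u w + Q w u ≠ 0) {W : Submodule ℚ M}
    (hW : ∀ ω η : ℂ ⊗[ℚ] V, D.baseChange ℂ ω = l • ω → D.baseChange ℂ η = -l • η →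
      rankC C.c W ω + rankC C.c W η ≤ Module.finrank ℂ (W.baseChange ℂ))
    (v w : V) {x : M} (hx : x ∈ W) : C.unitary D d v w x ∈ W := by
  have hl0 : l ≠ 0 := by
    rintro rfl
    simp at hl
    exact hd.ne' hl
  have hl' : -l * -l = -d := by rw [neg_mul_neg, hl]
  have hp := baseChange_eigenpart (V := V) hl hd hD
  have hn := baseChange_eigenpart (V := V) hl' hd hD
  let S (x y : ℂ ⊗[ℚ] V) : ℂ :=
    LinearMap.BilinForm.baseChange ℂ Q x y + LinearMap.BilinForm.baseChange ℂ Q y x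
  have hiso : ∀ {k : ℂ}, k ≠ 0 → ∀ x y, D.baseChange ℂ x = k • x → D.baseChange ℂ y = k • y →
      LinearMap.BilinForm.baseChange ℂ Q x y = 0 :=
    fun hk _ _ => form_eq_zero_of_eigen hDQ hk
  have key : ∀ ω η : ℂ ⊗[ℚ] V, D.baseChange ℂ ω = l • ω → D.baseChange ℂ η = -l • η →
      S ω η ≠ 0 → ∀ x ∈ W.baseChange ℂ, endC C.c ω (endC C.c η x) ∈ W.baseChange ℂ ∧
        endC C.c η (endC C.c ω x) ∈ W.baseChange ℂ := by
    intro ω η hω hη hs x hx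
    refine ⟨endC_endC_mem C (by rw [add_comm]; exact hW ω η hω hη) ?_ hx,
      endC_endC_mem C (hW ω η hω hη) hs hx⟩
    rwa [add_comm]
  -- Were all these pairings zero, conjugation would kill the other mixed pairing as well; the pure
  -- ones vanish since eigenspaces are isotropic, and Q would degenerate at w.
  have hex : ∀ w, w ≠ 0 → ∃ u, S (eigenpart D l u) (eigenpart D (-l) w) ≠ 0 := by
    intro w hw
    obtain ⟨u, hu⟩ := hQ w hw
    refine ⟨u, fun h0 => hu ?_⟩
    have h1 := congrArg (starRingEnd ℂ) h0
    simp only [S, map_add, ← conjC_form, map_zero] at h1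
    rw [conjC_eigenpart hl hd, conjC_eigenpart hl' hd, neg_neg] at h1
    have h2 : LinearMap.BilinForm.baseChange ℂ Q (1 ⊗ₜ u) (1 ⊗ₜ w) +
        LinearMap.BilinForm.baseChange ℂ Q (1 ⊗ₜ w) (1 ⊗ₜ u) = 0 := by
      rw [← eigenpart_add_eigenpart_neg (D := D) (l := l) u,
        ← eigenpart_add_eigenpart_neg (D := D) (l := l) w]
      simp only [map_add, LinearMap.add_apply]
      have hln : -l ≠ 0 := neg_ne_zero.2 hl0
      rw [hiso hl0 _ _ (hp u) (hp w), hiso hl0 _ _ (hp w) (hp u), hiso hln _ _ (hn u) (hn w),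
        hiso hln _ _ (hn w) (hn u)]
      simp only [S] at h0
      linear_combination h0 + h1
    rw [LinearMap.BilinForm.baseChange_tmul, LinearMap.BilinForm.baseChange_tmul] at h2
    simp only [mul_one, Algebra.smul_def, eq_ratCast] at h2
    exact_mod_cast h2
  have hall : ∀ v w, ∀ x ∈ W.baseChange ℂ,
      endC C.c (eigenpart D l v) (endC C.c (eigenpart D (-l) w) x) ∈ W.baseChange ℂ ∧
      endC C.c (eigenpart D (-l) w) (endC C.c (eigenpart D l v) x) ∈ W.baseChange ℂ := by
    intro v w x hx
    -- For an orthogonal pair, write v = (v + u) - u where u pairs nontrivially with w; both terms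
    -- are covered by `key`.
    by_cases hs : S (eigenpart D l v) (eigenpart D (-l) w) = 0
    · by_cases hw : w = 0
      · have : eigenpart D (-l) w = 0 := by simp [hw, eigenpart]
        simp [this]
      · obtain ⟨u, hu⟩ := hex w hw
        have h1 := key _ _ (hp (v + u)) (hn w) (by
          rw [eigenpart_add]
          simp only [S, map_add, LinearMap.add_apply] at hs hu ⊢
          intro h0
          apply hu
          linear_combination h0 - hs) x hx
        have h2 := key _ _ (hp u) (hn w) hu x hx
        rw [eigenpart_add] at h1
        simp only [map_add, LinearMap.add_apply] at h1
        exact ⟨(Submodule.add_mem_iff_left _ h2.1).1 h1.1,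
          (Submodule.add_mem_iff_left _ h2.2).1 h1.2⟩
    · exact key _ _ (hp v) (hn w) hs x hx
  rw [← tmul_mem_baseChange_iff, tmul_unitary C hl hd]
  have hx' := (tmul_mem_baseChange_iff W x).2 hx
  exact Submodule.smul_mem _ _ (Submodule.add_mem _ (hall v w _ hx').1 (hall w v _ hx').2)

end Generic

/-! ### Sub-Hodge structures for general Hodge structures -/

section SubHodge

variable {V M X : Type*} [AddCommGroup V] [Module ℚ V] [AddCommGroup M] [Module ℚ M]
  [AddCommGroup X] [Module ℚ X] {Q : LinearMap.BilinForm ℚ V}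
  {K : Type*} [Field K] [Algebra ℚ K] [Module K V] [IsScalarTower ℚ K V]

theorem baseChange_map_mem {U : Submodule ℚ X} (f : X →ₗ[ℚ] M) {x : ℂ ⊗[ℚ] X}
    (hx : x ∈ U.baseChange ℂ) : f.baseChange ℂ x ∈ (U.map f).baseChange ℂ := by
  rw [Submodule.baseChange_eq_span] at hx
  induction hx using Submodule.span_induction with
  | mem x hx =>
    obtain ⟨y, hy, rfl⟩ := hx
    rw [TensorProduct.mk_apply, LinearMap.baseChange_tmul]
    exact Submodule.tmul_mem_baseChange_of_mem _ (Submodule.mem_map_of_mem hy)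
  | zero => simp
  | add x y _ _ hx hy => rw [map_add]; exact Submodule.add_mem _ hx hy
  | smul a x _ hx => rw [map_smul]; exact Submodule.smul_mem _ _ hx

theorem exists_baseChange_of_mem_map {U : Submodule ℚ X} {f : X →ₗ[ℚ] M} {y : ℂ ⊗[ℚ] M}
    (hy : y ∈ (U.map f).baseChange ℂ) : ∃ x ∈ U.baseChange ℂ, f.baseChange ℂ x = y := by
  rw [Submodule.baseChange_eq_span] at hy
  induction hy using Submodule.span_induction with
  | mem y hy =>
    obtain ⟨_, ⟨x, hx, rfl⟩, rfl⟩ := hy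
    exact ⟨1 ⊗ₜ x, Submodule.tmul_mem_baseChange_of_mem _ hx, rfl⟩
  | zero => exact ⟨0, Submodule.zero_mem _, map_zero _⟩
  | add y z _ _ hy hz =>
    obtain ⟨y, hy, rfl⟩ := hy
    obtain ⟨z, hz, rfl⟩ := hz
    exact ⟨y + z, Submodule.add_mem _ hy hz, map_add _ _ _⟩
  | smul a y _ hy =>
    obtain ⟨y, hy, rfl⟩ := hy
    exact ⟨a • y, Submodule.smul_mem _ _ hy, map_smul _ _ _⟩

/-- For general `h`, sub-Hodge structures are stable under the unitary Lie algebra. -/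
theorem Retract.unitary_mem_of_isSub [FiniteDimensional ℚ M] (q : ImagQuad K) {n : ℕ}
    {b : Module.Basis (Fin n) ℚ V} {h : HodgeStructure V 2}
    (hg : h.IsGeneral b (exceptionalFamily K b)) (P : PeriodVector Q (kAct V q.δ) q.d)
    (hP : P.IsPeriod h) (hDQ : ∀ v w, Q (q.δ • v) w = -Q v (q.δ • w))
    (hQ : ∀ w, w ≠ 0 → ∃ u, Q u w + Q w u ≠ 0) {C : CliffordRep Q M} (R : Retract M X)
    (hR : C.Commutes (kAct V q.δ) q.d R.proj) {U : Submodule ℚ X}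
    (hU : (R.hodge P hR).IsSub U) (v w : V) {x : M} (hx : x ∈ U.map R.ι) :
    C.unitary (kAct V q.δ) q.d v w x ∈ U.map R.ι := by
  have hω0 : P.ω ≠ 0 := by
    intro h0
    have := P.conj
    rw [h0, map_zero, LinearMap.zero_apply] at this
    norm_num at this
  have hωm : P.ω ∈ h.comp 2 0 := by rw [hP]; exact Submodule.mem_span_singleton_self _
  -- Hodge splitting of U: its (1,0) part is killed by c(ω) and its (0,1) part by c(ω̄).
  have h1 : rankC C.c (U.map R.ι) P.ω + rankC C.c (U.map R.ι) (conjC V P.ω) ≤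
      Module.finrank ℂ ((U.map R.ι).baseChange ℂ) := by
    refine rankC_add_rankC_le C fun x hx => ?_
    obtain ⟨x', hx', rfl⟩ := exists_baseChange_of_mem_map hx
    obtain ⟨y, hy, z, hz, hy', hz', rfl⟩ := HodgeStructure.isSub_ofComplexStructure hU hx'
    refine ⟨_, baseChange_map_mem R.ι hy, _, baseChange_map_mem R.ι hz, ?_, ?_, map_add _ _ _⟩
    · exact (R.mem_hodge_one_zero P hR).1 (HodgeStructure.mem_ofComplexStructure_one_zero.2 hy')
    · exact (R.mem_hodge_zero_one P hR).1 (HodgeStructure.mem_ofComplexStructure_zero_one.2 hz')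
  have hD : ∀ v : V, kAct V q.δ (kAct V q.δ v) = -q.d • v := fun v => by
    change q.δ • q.δ • v = _
    rw [smul_smul, q.δ_mul_δ, algebraMap_smul]
  refine mem_of_rankC_le C P.l_mul_l P.d_pos hD hDQ hQ (fun ω η hω hη => ?_) v w hx
  refine le_trans (add_le_add ?_ ?_) h1
  · exact rankC_le_of_isGeneral q hg C.c _ hωm hω0 P.l_mul_l hω
  · refine le_trans ?_ (rankC_le_conjC b C.c _ P.ω)
    exact rankC_le_of_isGeneral q hg C.c _ hωm hω0 (l := -P.l)
      (by rw [neg_mul_neg, P.l_mul_l]) hη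

end SubHodge

/-! ### Orthogonal bases -/

section OrthBasis

variable {K : Type*} [Field K] [Algebra ℚ K] (q : ImagQuad K) {V : Type*} [AddCommGroup V]
  [Module ℚ V] [Module K V] [IsScalarTower ℚ K V] {Q : LinearMap.BilinForm ℚ V}

theorem ImagQuad.norm_δ : Algebra.norm ℚ q.δ = q.d := by
  apply (algebraMap ℚ K).injective
  rw [q.norm_eq, q.τ_δ, mul_neg, q.δ_sq, neg_neg]

theorem ImagQuad.norm_one_add_δ : Algebra.norm ℚ (1 + q.δ) = 1 + q.d := by
  apply (algebraMap ℚ K).injective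
  rw [q.norm_eq, map_add, map_one, q.τ_δ, map_add, map_one]
  linear_combination -q.δ_sq

section Herm

variable (hKQ : ∀ (x : K) (v w : V), Q (x • v) (x • w) = Algebra.norm ℚ x * Q v w)

include hKQ

/-- Comparing the norm identity for 1 + δ, of norm 1 + d, with those for 1 and δ leaves only the
mixed terms. -/
theorem form_δ_smul (v w : V) : Q (q.δ • v) w = -Q v (q.δ • w) := by
  have h1 := hKQ (1 + q.δ) v w
  have h2 := hKQ q.δ v w
  rw [q.norm_δ] at h2
  rw [q.norm_one_add_δ] at h1
  simp only [add_smul, one_smul, map_add, LinearMap.add_apply, h2] at h1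
  linear_combination h1

theorem form_smul_left (x : K) (v w : V) : Q (x • v) w = Q v (q.τ x • w) := by
  obtain ⟨r, s, rfl⟩ := q.exists_eq x
  simp only [map_add, map_mul, q.τ_rat, q.τ_δ, add_smul, mul_smul, algebraMap_smul, map_smul,
    LinearMap.add_apply, LinearMap.smul_apply, form_δ_smul q hKQ, neg_smul, map_neg]

theorem form_δ_self (hs : ∀ v w, Q v w = Q w v) (v : V) : Q (q.δ • v) v = 0 := by
  have := form_δ_smul q hKQ v v
  rw [hs v] at this
  linarith

theorem form_smul_smul_self (hs : ∀ v w, Q v w = Q w v) (x y : K) (v : V) :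
    algebraMap ℚ K (Q (x • v) (y • v) + Q (y • v) (x • v)) =
      algebraMap ℚ K (Q v v) * (x * q.τ y + q.τ x * y) := by
  obtain ⟨r, s, rfl⟩ := q.exists_eq x
  obtain ⟨r', s', rfl⟩ := q.exists_eq y
  have h2 := hKQ q.δ v v
  rw [q.norm_δ] at h2
  have h3 := form_δ_self q hKQ hs v
  have h4 : Q v (q.δ • v) = 0 := by rw [hs, h3]
  simp only [map_add, map_mul, q.τ_rat, q.τ_δ, add_smul, mul_smul, algebraMap_smul, map_smul,
    LinearMap.add_apply, LinearMap.smul_apply, h2, h3, h4, smul_eq_mul, mul_zero, add_zero,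
    zero_add]
  linear_combination (2 * algebraMap ℚ K s * algebraMap ℚ K s' * algebraMap ℚ K (Q v v)) * q.δ_sq

/-- An orthogonal basis consisting of anisotropic vectors is a `HermBasis`. -/
noncomputable def hermBasisOfOrthogonal (hs : ∀ v w, Q v w = Q w v) {m : ℕ}
    (b : Module.Basis (Fin m) K V) (hb : ∀ i j, i ≠ j → ∀ x : K, Q (x • b i) (b j) = 0)
    (hb0 : ∀ i, Q (b i) (b i) ≠ 0) : HermBasis q Q m where
  b := b
  h i := Q (b i) (b i)
  h_ne_zero := hb0
  polar v w := by
    have key : ∀ v w, Q v w = ∑ i, Q (b.repr v i • b i) (b.repr w i • b i) := by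
      intro v w
      conv_lhs => rw [← b.sum_repr v, ← b.sum_repr w]
      simp only [map_sum, LinearMap.sum_apply]
      refine Finset.sum_congr rfl fun i _ => ?_
      refine Finset.sum_eq_single i (fun j _ hji => ?_) (by simp)
      rw [hs, form_smul_left q hKQ, hs, smul_smul, hb j i hji]
    rw [key v w, key w v, ← Finset.sum_add_distrib, map_sum]
    exact Finset.sum_congr rfl fun i _ => form_smul_smul_self q hKQ hs _ _ _

include q in
-- Gram-Schmidt for H. As H is indefinite, the first vector is found by polarization: a symmetric
-- form vanishing on the diagonal of N would vanish on N.
theorem exists_orthogonal_family [FiniteDimensional K V] (hs : ∀ v w, Q v w = Q w v) (n : ℕ) :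
    ∀ N : Submodule K V, Module.finrank K N = n → (∀ w ∈ N, w ≠ 0 → ∃ u ∈ N, Q u w ≠ 0) →
      ∃ f : Fin n → V, (∀ i, f i ∈ N) ∧ LinearIndependent K f ∧
        ∀ i j, i ≠ j → ∀ x : K, Q (x • f i) (f j) = 0 := by
  induction n with
  | zero =>
    intro N _ _
    exact ⟨Fin.elim0, fun i => i.elim0, linearIndependent_empty_type, fun i => i.elim0⟩
  | succ n ih =>
    intro N hN hnd
    obtain ⟨v, hv, hv0⟩ : ∃ v ∈ N, Q v v ≠ 0 := by
      by_contra! hcon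
      obtain ⟨w, hw⟩ : ∃ w : N, w ≠ 0 := by
        have : Nontrivial N := Module.nontrivial_of_finrank_pos (R := K) (by omega)
        exact exists_ne 0
      obtain ⟨u, hu, hu'⟩ := hnd w w.2 (by simpa using hw)
      have h1 := hcon (u + w) (N.add_mem hu w.2)
      simp only [map_add, LinearMap.add_apply, hcon u hu, hcon w w.2, hs w u] at h1
      apply hu'
      linarith
    let N' : Submodule K V :=
      { carrier := {w | w ∈ N ∧ ∀ x : K, Q (x • v) w = 0}
        add_mem' := fun ha hb => ⟨N.add_mem ha.1 hb.1, fun x => by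
          rw [map_add, ha.2, hb.2, add_zero]⟩
        zero_mem' := ⟨N.zero_mem, fun x => map_zero _⟩
        smul_mem' := fun y a ha => ⟨N.smul_mem _ ha.1, fun x => by
          rw [hs, form_smul_left q hKQ, hs, smul_smul, ha.2]⟩ }
    have hproj : ∀ w ∈ N, ∃ y : K, w - y • v ∈ N' := by
      intro w hw
      -- The Hermitian projection coefficient read off from Q: for w = (r + sδ)v one has Q(v,w) = r
      -- Q(v,v) and Q(δv,w) = s d Q(v,v).
      refine ⟨algebraMap ℚ K (Q v w / Q v v) + algebraMap ℚ K (Q (q.δ • v) w / (q.d * Q v v)) * q.δ,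
        N.sub_mem hw (N.smul_mem _ hv), fun x => ?_⟩
      obtain ⟨r, s, rfl⟩ := q.exists_eq x
      have h2 := hKQ q.δ v v
      rw [q.norm_δ] at h2
      have h3 := form_δ_self q hKQ hs v
      have h4 : Q v (q.δ • v) = 0 := by rw [hs, h3]
      have hd := q.d_pos.ne'
      simp only [map_add, map_sub, add_smul, mul_smul, algebraMap_smul, map_smul,
        LinearMap.add_apply, LinearMap.smul_apply, h2, h3, h4, smul_eq_mul, mul_zero, add_zero,
        zero_add]
      field_simp
      ring
    have hvN' : v ∉ N' := fun h => hv0 (by simpa using h.2 1)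
    have hsup : Submodule.span K {v} ⊔ N' = N := by
      apply le_antisymm
      · refine sup_le ?_ fun w hw => hw.1
        rw [Submodule.span_singleton_le_iff_mem]
        exact hv
      · intro w hw
        obtain ⟨y, hy⟩ := hproj w hw
        rw [← add_sub_cancel (y • v) w]
        exact Submodule.add_mem_sup (Submodule.smul_mem _ _ (Submodule.mem_span_singleton_self _)) hy
    have hinf : Submodule.span K {v} ⊓ N' = ⊥ := by
      rw [eq_bot_iff]
      rintro w ⟨hw, hw'⟩
      obtain ⟨y, rfl⟩ := Submodule.mem_span_singleton.1 hw
      by_cases hy : y = 0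
      · simp [hy]
      · exact absurd ((Submodule.smul_mem_iff _ hy).1 hw') hvN'
    have hv00 : v ≠ 0 := by
      rintro rfl
      exact hvN' N'.zero_mem
    have hN' : Module.finrank K N' = n := by
      have := Submodule.finrank_sup_add_finrank_inf_eq (Submodule.span K {v}) N'
      rw [hsup, hinf, finrank_bot, finrank_span_singleton hv00, hN] at this
      omega
    obtain ⟨f, hf, hli, hort⟩ := ih N' hN' (by
      intro w hw hw0
      obtain ⟨u, hu, hu'⟩ := hnd w hw.1 hw0
      obtain ⟨y, hy⟩ := hproj u hu
      refine ⟨_, hy, ?_⟩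
      rw [map_sub, LinearMap.sub_apply, hw.2, sub_zero]
      exact hu')
    refine ⟨Fin.cons v f, ?_, ?_, ?_⟩
    · intro i
      refine Fin.cases hv (fun i => ?_) i
      rw [Fin.cons_succ]
      exact (hf i).1
    · refine linearIndependent_finCons.2 ⟨hli, fun h => hvN' ?_⟩
      refine (Submodule.span_le.2 ?_ : _ ≤ N') h
      rintro _ ⟨i, rfl⟩
      exact hf i
    · intro i j
      refine Fin.cases ?_ (fun i => ?_) i <;> refine Fin.cases ?_ (fun j => ?_) j
      · intro h; exact absurd rfl h
      · intro _ x
        rw [Fin.cons_zero, Fin.cons_succ]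
        exact (hf j).2 x
      · intro _ x
        rw [Fin.cons_zero, Fin.cons_succ, form_smul_left q hKQ, hs]
        exact (hf i).2 _
      · intro hij x
        rw [Fin.cons_succ, Fin.cons_succ]
        exact hort i j (fun h => hij (by rw [h])) x

/-- There is an orthogonal basis, with discriminant adapted to the discriminant condition. -/
theorem exists_hermBasis [FiniteDimensional K V] (hs : ∀ v w, Q v w = Q w v)
    (hnd : ∀ w, w ≠ 0 → ∃ u, Q u w ≠ 0) {m : ℕ} (hm : Module.finrank K V = m) :
    ∃ B : HermBasis q Q m, (∀ i, B.h i = Q (B.b i) (B.b i)) ∧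
      (∀ i j, i ≠ j → ∀ x : K, Q (x • B.b i) (B.b j) = 0) ∧
      (NegDiscIsNorm K Q m → ∃ c : K, Algebra.norm ℚ c = -∏ i, B.h i) := by
  have hanis : ∀ b : Module.Basis (Fin m) K V,
      (∀ i j, i ≠ j → ∀ x : K, Q (x • b i) (b j) = 0) → ∀ i, Q (b i) (b i) ≠ 0 := by
    intro b hb i h0
    obtain ⟨u, hu⟩ := hnd (b i) (b.ne_zero i)
    apply hu
    rw [← b.sum_repr u]
    simp only [map_sum, LinearMap.sum_apply]
    refine Finset.sum_eq_zero fun j _ => ?_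
    by_cases hji : j = i
    · subst hji
      obtain ⟨r, s, hrs⟩ := q.exists_eq (b.repr u j)
      rw [hrs, add_smul, mul_smul, algebraMap_smul, algebraMap_smul, map_add, map_smul, map_smul,
        LinearMap.add_apply, LinearMap.smul_apply, LinearMap.smul_apply, h0,
        form_δ_self q hKQ hs, smul_zero, smul_zero, add_zero]
    · exact hb j i hji _
  -- When the condition holds, its own basis is used, so that independence of the discriminant from
  -- the basis is never needed.
  by_cases hdisc : NegDiscIsNorm K Q m
  · obtain ⟨b, hb, c, hc⟩ := id hdisc
    exact ⟨hermBasisOfOrthogonal q hKQ hs b hb (hanis b hb), fun _ => rfl, hb, fun _ => ⟨c, hc⟩⟩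
  · obtain ⟨f, -, hli, hort⟩ := exists_orthogonal_family q hKQ hs m ⊤ (by rw [finrank_top, hm])
      (fun w _ hw => by simpa using hnd w hw)
    let b := basisOfLinearIndependentOfCardEqFinrank' f hli (by rw [Fintype.card_fin, hm])
    have hb : ∀ i j, i ≠ j → ∀ x : K, Q (x • b i) (b j) = 0 := by
      intro i j hij x
      simpa [b] using hort i j hij x
    exact ⟨hermBasisOfOrthogonal q hKQ hs b hb (hanis b hb), fun _ => rfl, hb,
      fun h => absurd h hdisc⟩

end Herm

end OrthBasis

/-! ### Consequences of polarization -/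

section Polarization

variable {V : Type*} [AddCommGroup V] [Module ℚ V] {Q : LinearMap.BilinForm ℚ V}
  {h : HodgeStructure V 2}

namespace HodgeStructure.IsPolarization

theorem symm' (hQ : h.IsPolarization Q) (v w : V) : Q v w = Q w v := by
  rw [hQ.symm v w]; norm_num

theorem exists_decomposition (hQ : h.IsPolarization Q) (x : ℂ ⊗[ℚ] V) :
    ∃ f : (ℕ × ℕ) →₀ ℂ ⊗[ℚ] V, (∀ i, f i ∈ h.comp i.1 i.2) ∧ f.sum (fun _ y => y) = x ∧
      ∀ p q, ∀ y ∈ h.comp p q, LinearMap.BilinForm.baseChange ℂ Q (conjC V y) x =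
        LinearMap.BilinForm.baseChange ℂ Q (conjC V y) (f (p, q)) := by
  have hx : x ∈ ⨆ pq : ℕ × ℕ, h.comp pq.1 pq.2 := by rw [h.iSup_comp]; trivial
  obtain ⟨f, hf, hfx⟩ := (Submodule.mem_iSup_iff_exists_finsupp _ _).1 hx
  refine ⟨f, hf, hfx, fun p q y hy => ?_⟩
  rw [← hfx, Finsupp.sum, map_sum]
  refine Finset.sum_eq_single (p, q) (fun i _ hi => ?_) fun hi => ?_
  · exact hQ.orth q p i.1 i.2 hi _ (h.conj_mem p q y hy) _ (hf i)
  · rw [Finsupp.notMem_support_iff.1 hi, map_zero]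

theorem eq_zero_of_conj (hQ : h.IsPolarization Q) {p q : ℕ} {x : ℂ ⊗[ℚ] V}
    (hx : x ∈ h.comp p q) (h0 : LinearMap.BilinForm.baseChange ℂ Q (conjC V x) x = 0) :
    x = 0 := by
  by_contra hne
  obtain ⟨t, ht, hte⟩ := hQ.pos p q x hx hne
  rw [h0, mul_zero] at hte
  exact ht.ne (by exact_mod_cast hte)

/-- A vector in the radical pairs to zero with the conjugate of each of its Hodge components, and
definiteness on each type kills them one by one. -/
theorem nondegenerate (hQ : h.IsPolarization Q) (w : V) (hw : w ≠ 0) : ∃ u, Q u w ≠ 0 := by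
  by_contra! hcon
  have h1 : ∀ y, LinearMap.BilinForm.baseChange ℂ Q y (1 ⊗ₜ w) = 0 := by
    intro y
    induction y with
    | zero => simp
    | add x y hx hy => rw [map_add, LinearMap.add_apply, hx, hy, add_zero]
    | tmul z v => rw [LinearMap.BilinForm.baseChange_tmul, hcon, zero_smul]
  obtain ⟨f, hf, hfx, hfo⟩ := hQ.exists_decomposition (1 ⊗ₜ w)
  have h2 : ∀ i, f i = 0 := fun i => hQ.eq_zero_of_conj (hf i) (by
    rw [← hfo i.1 i.2 _ (hf i), h1])
  have h3 : (1 : ℂ) ⊗ₜ[ℚ] w = 0 := by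
    rw [← hfx]
    exact Finset.sum_eq_zero fun i _ => h2 i
  have := Module.Flat.tensorProduct_mk_injective (R := ℚ) (S := ℂ) (M := V)
  exact hw (this (by rw [map_zero]; exact h3))

/-- The space `V^{1,1}` is the orthogonal complement of `V^{2,0} ⊕ V^{0,2}`. -/
theorem mem_one_one (hQ : h.IsPolarization Q) {D : V →ₗ[ℚ] V} {d : ℚ} {P : PeriodVector Q D d}
    (hP : P.IsPeriod h) {x : ℂ ⊗[ℚ] V} (h1 : LinearMap.BilinForm.baseChange ℂ Q P.ω x = 0)
    (h2 : LinearMap.BilinForm.baseChange ℂ Q (conjC V P.ω) x = 0) : x ∈ h.comp 1 1 := by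
  obtain ⟨f, hf, hfx, hfo⟩ := hQ.exists_decomposition x
  have hωm : P.ω ∈ h.comp 2 0 := by rw [hP]; exact Submodule.mem_span_singleton_self _
  have h20 : f (2, 0) = 0 := by
    apply hQ.eq_zero_of_conj (hf (2, 0))
    have h3 : f (2, 0) ∈ h.comp 2 0 := hf (2, 0)
    have h4 := h3
    rw [hP] at h4
    obtain ⟨c, hc⟩ := Submodule.mem_span_singleton.1 h4
    rw [← hfo 2 0 _ h3, ← hc, conjC_smul, map_smul, LinearMap.smul_apply, h2, smul_zero]
  have h02 : f (0, 2) = 0 := by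
    apply hQ.eq_zero_of_conj (hf (0, 2))
    have h3 : f (0, 2) ∈ h.comp 0 2 := hf (0, 2)
    have h4 := h.conj_mem _ _ _ h3
    rw [hP] at h4
    obtain ⟨c, hc⟩ := Submodule.mem_span_singleton.1 h4
    rw [← hfo 0 2 _ h3, ← hc, map_smul, LinearMap.smul_apply, h1, smul_zero]
  rw [← hfx]
  refine Submodule.sum_mem _ fun i _ => ?_
  obtain ⟨p, q⟩ := i
  by_cases hpq : p + q = 2
  · have : (p, q) = (2, 0) ∨ (p, q) = (0, 2) ∨ (p, q) = (1, 1) := by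
      simp only [Prod.mk.injEq]; omega
    rcases this with e | e | e
    · rw [e, h20]; exact Submodule.zero_mem _
    · rw [e, h02]; exact Submodule.zero_mem _
    · rw [e]; exact hf (1, 1)
  · have h3 := hf (p, q)
    rw [h.comp_eq_bot p q hpq, Submodule.mem_bot] at h3
    change f (p, q) ∈ _
    rw [h3]
    exact Submodule.zero_mem _

end HodgeStructure.IsPolarization

end Polarization

/-! ### The signature -/

section Signature

variable {K : Type*} [Field K] [Algebra ℚ K] {q : ImagQuad K} {V : Type*} [AddCommGroup V]
  [Module ℚ V] [Module K V] [IsScalarTower ℚ K V] {Q : LinearMap.BilinForm ℚ V} {m : ℕ}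

theorem kAct_kAct (q : ImagQuad K) (v : V) : kAct V q.δ (kAct V q.δ v) = -q.d • v := by
  change q.δ • q.δ • v = _
  rw [smul_smul, q.δ_mul_δ, algebraMap_smul]

theorem ne_zero_of_mul_self {l : ℂ} {d : ℚ} (hd : 0 < d) (hl : l * l = -d) : l ≠ 0 := by
  rintro rfl
  simp at hl
  exact hd.ne' hl

/-- The projection (1 + l⁻¹δ)/2 onto the eigenspace sends V into the span of the components of the
b_j, because x ∈ K acts on such a component by a complex scalar. -/
theorem mem_span_eigenpart (B : HermBasis q Q m) {l : ℂ} (hl : l * l = -q.d) {x : ℂ ⊗[ℚ] V}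
    (hx : (kAct V q.δ).baseChange ℂ x = l • x) :
    x ∈ Submodule.span ℂ (Set.range fun j => eigenpart (kAct V q.δ) l (B.b j)) := by
  set N := Submodule.span ℂ (Set.range fun j => eigenpart (kAct V q.δ) l (B.b j))
  have hl0 := ne_zero_of_mul_self q.d_pos hl
  have h1 : ∀ v : V, eigenpart (kAct V q.δ) l v ∈ N := by
    intro v
    induction v using B.vector_induction with
    | h0 => simp [eigenpart]
    | hadd v w hv hw => rw [eigenpart_add]; exact N.add_mem hv hw
    | hb x j =>
      obtain ⟨r, s, rfl⟩ := q.exists_eq x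
      have h2 : eigenpart (kAct V q.δ) l ((algebraMap ℚ K r + algebraMap ℚ K s * q.δ) • B.b j) =
          ((r : ℂ) + s * l) • eigenpart (kAct V q.δ) l (B.b j) := by
        have h3 := baseChange_eigenpart hl q.d_pos (kAct_kAct q) (B.b j)
        have h4 : ∀ (r : ℚ) (v : V), eigenpart (kAct V q.δ) l (r • v) =
            (r : ℂ) • eigenpart (kAct V q.δ) l v := fun r v => by
          have hr : ∀ y : ℂ ⊗[ℚ] V, r • y = (r : ℂ) • y := fun y => by
            rw [← eq_ratCast (algebraMap ℚ ℂ), algebraMap_smul]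
          simp only [eigenpart, map_smul, TensorProduct.tmul_smul, hr]
          module
        have h5 : eigenpart (kAct V q.δ) l (kAct V q.δ (B.b j)) =
            l • eigenpart (kAct V q.δ) l (B.b j) := by
          rw [← h3]
          simp only [eigenpart, map_smul, map_add, LinearMap.baseChange_tmul]
        rw [add_smul, mul_smul, algebraMap_smul, algebraMap_smul, eigenpart_add, h4, h4]
        change _ + (s : ℂ) • eigenpart (kAct V q.δ) l (kAct V q.δ (B.b j)) = _
        rw [h5]
        module
      rw [h2]
      exact N.smul_mem _ (Submodule.subset_span ⟨j, rfl⟩)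
  have h2 : ∀ y : ℂ ⊗[ℚ] V, y + l⁻¹ • (kAct V q.δ).baseChange ℂ y ∈ N := by
    intro y
    induction y with
    | zero => simp
    | add y z hy hz =>
      have := N.add_mem hy hz
      rw [map_add, smul_add]
      rwa [add_add_add_comm]
    | tmul z v =>
      have h3 : z ⊗ₜ[ℚ] v + l⁻¹ • (kAct V q.δ).baseChange ℂ (z ⊗ₜ v) =
          (2 * z) • eigenpart (kAct V q.δ) l v := by
        have e1 : z ⊗ₜ[ℚ] v = z • (1 : ℂ) ⊗ₜ[ℚ] v := by
          rw [TensorProduct.smul_tmul', smul_eq_mul, mul_one]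
        have e2 : l⁻¹ ⊗ₜ[ℚ] kAct V q.δ v = l⁻¹ • (1 : ℂ) ⊗ₜ[ℚ] kAct V q.δ v := by
          rw [TensorProduct.smul_tmul', smul_eq_mul, mul_one]
        rw [eigenpart, e2, e1, map_smul, LinearMap.baseChange_tmul]
        module
      rw [h3]
      exact N.smul_mem _ (h1 v)
  have h3 := N.smul_mem (1 / 2 : ℂ) (h2 x)
  rw [hx, smul_smul, inv_mul_cancel₀ hl0, one_smul, ← two_smul ℂ x, smul_smul] at h3
  norm_num at h3
  exact h3

theorem form_eigenpart {D : V →ₗ[ℚ] V} {d : ℚ} {l : ℂ} (hl : l * l = -d) (hd : 0 < d)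
    (hD : ∀ v, D (D v) = -d • v) (hDQ : ∀ v w, Q (D v) w = -Q v (D w)) (v w : V) :
    LinearMap.BilinForm.baseChange ℂ Q (eigenpart D l v) (eigenpart D (-l) w) =
      1 / 2 * (Q v w + l⁻¹ * Q (D v) w) := by
  have hl0 := ne_zero_of_mul_self hd hl
  have h1 : Q v (D w) = -Q (D v) w := by rw [hDQ, neg_neg]
  have h2 : Q (D v) (D w) = d * Q v w := by rw [hDQ, hD, map_smul, smul_eq_mul]; ring
  simp only [eigenpart, map_smul, map_add, LinearMap.smul_apply, LinearMap.add_apply,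
    LinearMap.BilinForm.baseChange_tmul, h1, h2, smul_eq_mul]
  simp only [Algebra.smul_def, eq_ratCast,
    Rat.cast_neg, Rat.cast_mul, mul_one, one_mul, inv_neg]
  have hd' : (d : ℂ) = -(l * l) := by rw [hl, neg_neg]
  rw [hd']
  field_simp
  ring

/-- On the eigenspace of ω the form Q(x, x̄) is diagonal with entries h_j/2. It is negative at ω and
positive on the complement of ω, which lies in V^{1,1}; so it has exactly one negative entry. -/
theorem exists_unique_neg (hKQ : ∀ (x : K) (v w : V), Q (x • v) (x • w) = Algebra.norm ℚ x * Q v w)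
    {h : HodgeStructure V 2} (hQ : h.IsPolarization Q) (P : PeriodVector Q (kAct V q.δ) q.d)
    (hP : P.IsPeriod h) (B : HermBasis q Q m) (hB : ∀ i, B.h i = Q (B.b i) (B.b i))
    (hort : ∀ i j, i ≠ j → ∀ x : K, Q (x • B.b i) (B.b j) = 0) :
    ∃ j, B.h j < 0 ∧ ∀ k, k ≠ j → 0 < B.h k := by
  have hDQ : ∀ v w, Q (kAct V q.δ v) w = -Q v (kAct V q.δ w) := form_δ_smul q hKQ
  let e (j : Fin m) := eigenpart (kAct V q.δ) P.l (B.b j)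
  let f (j : Fin m) := eigenpart (kAct V q.δ) (-P.l) (B.b j)
  have hl0 := ne_zero_of_mul_self q.d_pos P.l_mul_l
  have hef : ∀ j, conjC V (e j) = f j := fun j => conjC_eigenpart P.l_mul_l q.d_pos _
  have hgram : ∀ j k, LinearMap.BilinForm.baseChange ℂ Q (e j) (f k) =
      if j = k then 1 / 2 * (B.h j : ℂ) else 0 := by
    intro j k
    rw [form_eigenpart P.l_mul_l q.d_pos (kAct_kAct q) hDQ]
    split_ifs with hjk
    · subst hjk
      have : Q (kAct V q.δ (B.b j)) (B.b j) = 0 := form_δ_self q hKQ hQ.symm' _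
      rw [this, hB]
      simp
    · have h1 : Q (kAct V q.δ (B.b j)) (B.b k) = 0 := hort j k hjk q.δ
      have h2 := hort j k hjk 1
      rw [one_smul] at h2
      rw [h1, h2]
      simp
  have hnorm : ∀ α : Fin m → ℂ, LinearMap.BilinForm.baseChange ℂ Q (∑ j, α j • e j)
      (conjC V (∑ j, α j • e j)) = ((∑ j, 1 / 2 * B.h j * Complex.normSq (α j) : ℝ) : ℂ) := by
    intro α
    simp only [map_sum, conjC_smul, hef, LinearMap.sum_apply, map_smul, LinearMap.smul_apply, hgram,
      smul_eq_mul]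
    simp only [mul_ite, mul_zero, Finset.sum_ite_eq', Finset.mem_univ, if_true]
    push_cast
    refine Finset.sum_congr rfl fun j _ => ?_
    rw [Complex.normSq_eq_conj_mul_self]
    ring
  obtain ⟨j, hj⟩ : ∃ j, B.h j < 0 := by
    by_contra! hcon
    obtain ⟨α, hα⟩ := (Submodule.mem_span_range_iff_exists_fun ℂ).1
      (mem_span_eigenpart B P.l_mul_l P.D_ω)
    have h1 := hnorm α
    have h2 : ∑ j, α j • e j = P.ω := hα
    rw [h2, P.conj] at h1
    have h3 : (-2 : ℝ) = ∑ j, 1 / 2 * B.h j * Complex.normSq (α j) := by exact_mod_cast h1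
    have h4 : 0 ≤ ∑ j, 1 / 2 * (B.h j : ℝ) * Complex.normSq (α j) :=
      Finset.sum_nonneg fun j _ => mul_nonneg
        (mul_nonneg (by norm_num) (by exact_mod_cast hcon j)) (Complex.normSq_nonneg _)
    linarith
  refine ⟨j, hj, fun k hkj => ?_⟩
  by_contra! hk
  have hk := lt_of_le_of_ne hk (B.h_ne_zero k)
  -- Two negative entries would span a negative plane; orthogonality to ω is one linear condition,
  -- so some nonzero vector of the plane satisfies it.
  obtain ⟨α, β, hαβ, h0⟩ : ∃ α β : ℂ, (α ≠ 0 ∨ β ≠ 0) ∧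
      LinearMap.BilinForm.baseChange ℂ Q (conjC V P.ω) (α • e j + β • e k) = 0 := by
    by_cases ha : LinearMap.BilinForm.baseChange ℂ Q (conjC V P.ω) (e j) = 0
    · exact ⟨1, 0, Or.inl one_ne_zero, by simp [ha]⟩
    · refine ⟨LinearMap.BilinForm.baseChange ℂ Q (conjC V P.ω) (e k),
        -LinearMap.BilinForm.baseChange ℂ Q (conjC V P.ω) (e j), Or.inr (neg_ne_zero.2 ha), ?_⟩
      simp only [map_add, map_smul, smul_eq_mul]
      ring
  set x := α • e j + β • e k with hx
  have hDx : (kAct V q.δ).baseChange ℂ x = P.l • x := by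
    have he := fun j => baseChange_eigenpart P.l_mul_l q.d_pos (kAct_kAct q) (B.b j)
    rw [hx, map_add, map_smul, map_smul, he, he]
    module
  -- Bilinear orthogonality to ω is automatic, as ω and x lie in the same isotropic eigenspace;
  -- orthogonality to ω̄ was arranged.
  have hx11 := hQ.mem_one_one hP (form_eq_zero_of_eigen hDQ hl0 P.D_ω hDx) h0
  have hxx : LinearMap.BilinForm.baseChange ℂ Q (conjC V x) x =
      ((1 / 2 * B.h j * Complex.normSq α + 1 / 2 * B.h k * Complex.normSq β : ℝ) : ℂ) := by
    rw [hQ.symmC, hx]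
    simp only [map_add, conjC_smul, hef, LinearMap.add_apply, map_smul, LinearMap.smul_apply, hgram,
      smul_eq_mul, if_neg hkj, if_neg hkj.symm, if_true]
    push_cast
    rw [Complex.normSq_eq_conj_mul_self, Complex.normSq_eq_conj_mul_self]
    ring
  have hneg : 1 / 2 * (B.h j : ℝ) * Complex.normSq α + 1 / 2 * B.h k * Complex.normSq β < 0 := by
    have hj' : (B.h j : ℝ) < 0 := by exact_mod_cast hj
    have hk' : (B.h k : ℝ) < 0 := by exact_mod_cast hk
    have hα := Complex.normSq_nonneg α
    have hβ := Complex.normSq_nonneg β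
    rcases hαβ with h1 | h1
    · have := Complex.normSq_pos.2 h1
      nlinarith [mul_pos_of_neg_of_neg hj' (neg_neg_of_pos this), mul_nonneg (neg_nonneg.2 hk'.le) hβ]
    · have := Complex.normSq_pos.2 h1
      nlinarith [mul_pos_of_neg_of_neg hk' (neg_neg_of_pos this), mul_nonneg (neg_nonneg.2 hj'.le) hα]
  have hx0 : x ≠ 0 := by
    intro h1
    rw [h1, map_zero] at hxx
    have : (0 : ℝ) = 1 / 2 * (B.h j : ℝ) * Complex.normSq α + 1 / 2 * B.h k * Complex.normSq β := by
      exact_mod_cast hxx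
    linarith
  obtain ⟨t, ht, hte⟩ := hQ.pos 1 1 x hx11 hx0
  rw [hxx, pow_one, pow_one, mul_neg, Complex.I_mul_I, neg_neg, one_mul] at hte
  have : 1 / 2 * (B.h j : ℝ) * Complex.normSq α + 1 / 2 * B.h k * Complex.normSq β = t := by
    exact_mod_cast hte
  linarith

theorem prod_neg_of_unique_neg {B : HermBasis q Q m}
    (hB : ∃ j, B.h j < 0 ∧ ∀ k, k ≠ j → 0 < B.h k) : ∏ j, B.h j < 0 := by
  obtain ⟨j, hj, hk⟩ := hB
  rw [← Finset.mul_prod_erase _ _ (Finset.mem_univ j)]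
  exact mul_neg_of_neg_of_pos hj (Finset.prod_pos fun k hk' => hk k (Finset.ne_of_mem_erase hk'))

end Signature

/-! ### The embedding of `V` -/

theorem HodgeStructure.tmulC_mem_tensor {X Y : Type*} [AddCommGroup X] [Module ℚ X]
    [AddCommGroup Y] [Module ℚ Y] {k l : ℕ} {h : HodgeStructure X k} {h' : HodgeStructure Y l}
    {p q r s : ℕ} {x : ℂ ⊗[ℚ] X} {y : ℂ ⊗[ℚ] Y} {P N : ℕ}
    (hp : p + r = P) (hq : q + s = N) (hx : x ∈ h.comp p q) (hy : y ∈ h'.comp r s) :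
    tmulC X Y x y ∈ (h.tensor h').comp P N := by
  subst hp hq
  refine SetLike.le_def.1 ?_ (Submodule.apply_mem_map₂ (tmulC X Y) hx hy)
  refine le_iSup_of_le p (le_iSup_of_le q (le_iSup_of_le r (le_iSup_of_le s ?_)))
  exact le_iSup_of_le rfl (le_iSup_of_le rfl le_rfl)

section Embedding

variable {K : Type*} [Field K] [Algebra ℚ K] {q : ImagQuad K} {V : Type*} [AddCommGroup V]
  [Module ℚ V] [Module K V] [IsScalarTower ℚ K V] {Q : LinearMap.BilinForm ℚ V} {m : ℕ}

namespace HermBasis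

variable (B : HermBasis q Q m)

theorem cliff_vacuum (v : V) (z : K) : B.cliff v (Pi.single ∅ z) =
    ∑ j, Pi.single {j} (B.b.repr v j * z) := by
  rw [cliff_apply]
  refine Finset.sum_congr rfl fun j _ => ?_
  rw [op, fermi_single]
  have h1 : toggle j (∅ : Finset (Fin m)) = {j} := bot_symmDiff _
  simp [h1, fermiSign]

theorem cliff_vacuum_δ (v : V) :
    B.cliff v (Pi.single ∅ q.δ) = B.cliff (kAct V q.δ v) (Pi.single ∅ 1) := by
  rw [cliff_vacuum, cliff_vacuum]
  refine Finset.sum_congr rfl fun j _ => ?_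
  have h1 : kAct V q.δ v = q.δ • v := rfl
  rw [h1, map_smul, Finsupp.smul_apply, smul_eq_mul, mul_one, mul_comm]

theorem grade_cliff_vacuum (v : V) (z : K) :
    grade K m 1 (B.cliff v (Pi.single ∅ z)) = B.cliff v (Pi.single ∅ z) := by
  rw [cliff_vacuum, map_sum]
  exact Finset.sum_congr rfl fun j _ => by rw [grade_single, if_pos (Finset.card_singleton j)]

theorem eq_zero_of_cliff_vacuum {v : V} (hv : B.cliff v (Pi.single ∅ 1) = 0) : v = 0 := by
  rw [← B.b.sum_repr v]
  refine Finset.sum_eq_zero fun j _ => ?_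
  have h1 := congrFun hv {j}
  rw [cliff_vacuum, Finset.sum_apply, Finset.sum_eq_single j] at h1
  · rw [Pi.single_eq_same, mul_one] at h1
    rw [h1, Pi.zero_apply, zero_smul]
  · intro k _ hk
    rw [Pi.single_eq_of_ne]
    simpa using hk.symm
  · simp

variable {X Y : Type*} [AddCommGroup X] [Module ℚ X] [AddCommGroup Y] [Module ℚ Y]
  (R : Retract (FockSpace K m) X) (R' : Retract (FockSpace K m) Y)

/-- The map `V → S₀ ⊗ S₁`. -/
noncomputable def embed : V →ₗ[ℚ] X ⊗[ℚ] Y :=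
  TensorProduct.mk ℚ X Y (R.π (Pi.single ∅ 1)) ∘ₗ R'.π ∘ₗ
      LinearMap.applyₗ (Pi.single ∅ 1 : FockSpace K m) ∘ₗ B.cliff +
    q.d⁻¹ • (TensorProduct.mk ℚ X Y (R.π (Pi.single ∅ q.δ)) ∘ₗ R'.π ∘ₗ
      LinearMap.applyₗ (Pi.single ∅ 1 : FockSpace K m) ∘ₗ B.cliff ∘ₗ kAct V q.δ)

theorem embed_apply (v : V) : B.embed R R' v =
    R.π (Pi.single ∅ 1) ⊗ₜ R'.π (B.cliff v (Pi.single ∅ 1)) +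
      q.d⁻¹ • (R.π (Pi.single ∅ q.δ) ⊗ₜ R'.π (B.cliff (kAct V q.δ v) (Pi.single ∅ 1))) := rfl

variable {R R'} (hR : R.proj = grade K m 0) (hR' : R'.proj = grade K m 1)

theorem exists_rationalPart (q : ImagQuad K) : ∃ φ : K →ₗ[ℚ] ℚ, φ q.δ = 0 ∧ φ 1 ≠ 0 := by
  have hlt : Submodule.span ℚ {q.δ} < ⊤ := by
    rw [lt_top_iff_ne_top]
    intro h
    have h1 : (1 : K) ∈ Submodule.span ℚ {q.δ} := by rw [h]; trivial
    obtain ⟨r, hr⟩ := Submodule.mem_span_singleton.1 h1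
    have h2 := congrArg q.τ hr
    rw [map_smul, q.τ_δ, map_one, smul_neg, hr] at h2
    exact q.two_ne_zero (by linear_combination h2 * (-1 : K))
  obtain ⟨φ, hφ, hle⟩ := Submodule.exists_le_ker_of_lt_top _ hlt
  have h0 : φ q.δ = 0 := hle (Submodule.mem_span_singleton_self _)
  refine ⟨φ, h0, fun h1 => hφ (LinearMap.ext fun x => ?_)⟩
  obtain ⟨r, s, rfl⟩ := q.exists_eq x
  rw [← Algebra.smul_def, Algebra.algebraMap_eq_smul_one, map_add, map_smul, map_smul, h0, h1]
  simp

include hR hR' in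
-- Contracting the first factor with a functional on K that kills δ but not 1 leaves a nonzero
-- multiple of c(v)1, the vector with coordinates v.
theorem embed_injective : Function.Injective (B.embed R R') := by
  obtain ⟨φ, hφδ, hφ1⟩ := exists_rationalPart q
  rw [← LinearMap.ker_eq_bot, LinearMap.ker_eq_bot']
  intro v hv
  let Φ : X →ₗ[ℚ] ℚ := φ ∘ₗ LinearMap.proj ∅ ∘ₗ R.ι
  have hΦ : ∀ z : K, Φ (R.π (Pi.single ∅ z)) = φ z := by
    intro z
    change φ (R.proj (Pi.single ∅ z) ∅) = _
    rw [hR, grade_single, if_pos Finset.card_empty, Pi.single_eq_same]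
  have h1 := congrArg ((TensorProduct.lid ℚ Y).toLinearMap ∘ₗ Φ.rTensor Y) hv
  rw [embed_apply, map_zero, map_add, map_smul] at h1
  simp only [LinearMap.comp_apply, LinearMap.rTensor_tmul, LinearEquiv.coe_coe,
    TensorProduct.lid_tmul, hΦ, hφδ, zero_smul, smul_zero, add_zero] at h1
  have h2 := (smul_eq_zero.1 h1).resolve_left hφ1
  apply B.eq_zero_of_cliff_vacuum
  rw [← B.grade_cliff_vacuum, ← hR', R'.proj_apply, h2, map_zero]

/-- The eigenvectors of `δ` on the degree zero part of the Fock space. -/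
noncomputable def vac (q : ImagQuad K) (m : ℕ) (k : ℂ) : ℂ ⊗[ℚ] FockSpace K m :=
  1 ⊗ₜ Pi.single ∅ 1 - k⁻¹ ⊗ₜ Pi.single ∅ q.δ

theorem endC_vacuum_δ (a : ℂ ⊗[ℚ] V) (t : ℂ) : endC B.cliff a (t ⊗ₜ Pi.single ∅ q.δ) =
    endC B.cliff ((kAct V q.δ).baseChange ℂ a) (t ⊗ₜ Pi.single ∅ 1) := by
  induction a with
  | zero => simp
  | add a b ha hb => simp only [map_add, LinearMap.add_apply, ha, hb]
  | tmul z v => rw [LinearMap.baseChange_tmul, endC_tmul_tmul, endC_tmul_tmul, cliff_vacuum_δ]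

theorem tmul_eq_smul_one {E : Type*} [AddCommGroup E] [Module ℚ E] (t : ℂ) (x : E) :
    t ⊗ₜ[ℚ] x = t • (1 : ℂ) ⊗ₜ[ℚ] x := by
  rw [TensorProduct.smul_tmul', smul_eq_mul, mul_one]

/-- On the vacuum c(a) only creates, K-linearly, so c(a)δ = c(δa)1 = k c(a)1, and the two terms of
vac_k cancel. -/
theorem endC_vac {k : ℂ} (hk : k ≠ 0) {a : ℂ ⊗[ℚ] V}
    (ha : (kAct V q.δ).baseChange ℂ a = k • a) : endC B.cliff a (vac q m k) = 0 := by
  rw [vac, map_sub, endC_vacuum_δ, ha, map_smul, LinearMap.smul_apply, tmul_eq_smul_one k⁻¹,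
    map_smul, smul_smul, mul_inv_cancel₀ hk, one_smul, sub_self]

theorem vac_add_vac_neg (k : ℂ) :
    (1 : ℂ) ⊗ₜ Pi.single ∅ 1 = (1 / 2 : ℂ) • (vac q m k + vac q m (-k)) := by
  simp only [vac, inv_neg, TensorProduct.neg_tmul]
  module

/-- The vacuum vector is annihilated by `c(a) c(b)`, if `a` and `b` are orthogonal
eigenvectors for different eigenvalues. -/
theorem endC_endC_vacuum {k : ℂ} (hk : k ≠ 0) {a b : ℂ ⊗[ℚ] V}
    (ha : (kAct V q.δ).baseChange ℂ a = k • a) (hb : (kAct V q.δ).baseChange ℂ b = -k • b)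
    (hab : LinearMap.BilinForm.baseChange ℂ Q a b + LinearMap.BilinForm.baseChange ℂ Q b a = 0) :
    endC B.cliff a (endC B.cliff b (1 ⊗ₜ Pi.single ∅ 1)) = 0 := by
  have h1 := B.rep.antiC a b (vac q m k)
  change endC B.cliff a (endC B.cliff b _) + endC B.cliff b (endC B.cliff a _) = _ at h1
  rw [hab, zero_smul, B.endC_vac hk ha, map_zero, add_zero] at h1
  rw [vac_add_vac_neg k, map_smul, map_smul, map_add, map_add,
    B.endC_vac (neg_ne_zero.2 hk) hb, map_zero, add_zero, h1, smul_zero]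

/-- For δa = ka the second summand acquires the coefficient k/d = -k⁻¹, which turns the first factor
into vac_k; on each eigenspace the image is thus a pure tensor. -/
theorem embed_eigen (R : Retract (FockSpace K m) X) (R' : Retract (FockSpace K m) Y) {k : ℂ}
    (hk : k * k = -q.d) {a : ℂ ⊗[ℚ] V}
    (ha : (kAct V q.δ).baseChange ℂ a = k • a) : (B.embed R R').baseChange ℂ a =
      HodgeStructure.tmulC X Y (R.π.baseChange ℂ (vac q m k))
        (R'.π.baseChange ℂ (endC B.cliff a (1 ⊗ₜ Pi.single ∅ 1))) := by
  have hk0 := ne_zero_of_mul_self q.d_pos hk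
  have h1 : ∀ a : ℂ ⊗[ℚ] V, (B.embed R R').baseChange ℂ a =
      HodgeStructure.tmulC X Y (1 ⊗ₜ R.π (Pi.single ∅ 1))
        (R'.π.baseChange ℂ (endC B.cliff a (1 ⊗ₜ Pi.single ∅ 1))) +
      (q.d⁻¹ : ℂ) • HodgeStructure.tmulC X Y (1 ⊗ₜ R.π (Pi.single ∅ q.δ)) (R'.π.baseChange ℂ
        (endC B.cliff ((kAct V q.δ).baseChange ℂ a) (1 ⊗ₜ Pi.single ∅ 1))) := by
    intro a
    induction a with
    | zero => simp
    | add a b ha hb =>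
      simp only [map_add, LinearMap.add_apply, ha, hb, smul_add]
      abel
    | tmul z v =>
      have hd : ∀ y : X ⊗[ℚ] Y, z ⊗ₜ[ℚ] (q.d⁻¹ • y) = (q.d⁻¹ : ℂ) • z ⊗ₜ[ℚ] y := fun y => by
        rw [TensorProduct.tmul_smul, ← Rat.cast_inv, ← eq_ratCast (algebraMap ℚ ℂ), algebraMap_smul]
      simp only [LinearMap.baseChange_tmul, endC_tmul_tmul, HodgeStructure.tmulC_tmul, one_mul, mul_one,
        embed_apply, TensorProduct.tmul_add, hd]
  have h2 : (q.d⁻¹ : ℂ) * k = -k⁻¹ := by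
    have : (q.d : ℂ) = -(k * k) := by rw [hk, neg_neg]
    rw [this]
    field_simp
  rw [h1, ha, map_smul, LinearMap.smul_apply, map_smul, map_smul, smul_smul, h2, vac, map_sub,
    LinearMap.baseChange_tmul, LinearMap.baseChange_tmul, tmul_eq_smul_one k⁻¹, map_sub, map_smul,
    LinearMap.sub_apply, LinearMap.smul_apply]
  module

/-- vac_l has type (1,0) and vac_{-l} type (0,1). A vector of V^{1,1} in the l-eigenspace gives
c(a)1 of type (0,1), one in the other eigenspace type (1,0), so either tensor is of type (1,1); ω
and ω̄ give (2,0) and (0,2). -/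
theorem isHom_embed_of_mem {h : HodgeStructure V 2} (hQ : h.IsPolarization Q)
    (P : PeriodVector Q (kAct V q.δ) q.d) (hP : P.IsPeriod h) (hDh : h.IsHom h (kAct V q.δ))
    {h₀ : HodgeStructure X 1} {h₁ : HodgeStructure Y 1}
    (v10 : R.π.baseChange ℂ (vac q m P.l) ∈ h₀.comp 1 0)
    (v01 : R.π.baseChange ℂ (vac q m (-P.l)) ∈ h₀.comp 0 1)
    (c10 : ∀ a, endC B.cliff P.ω (endC B.cliff a (1 ⊗ₜ Pi.single ∅ 1)) = 0 →
      R'.π.baseChange ℂ (endC B.cliff a (1 ⊗ₜ Pi.single ∅ 1)) ∈ h₁.comp 1 0)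
    (c01 : ∀ a, endC B.cliff (conjC V P.ω) (endC B.cliff a (1 ⊗ₜ Pi.single ∅ 1)) = 0 →
      R'.π.baseChange ℂ (endC B.cliff a (1 ⊗ₜ Pi.single ∅ 1)) ∈ h₁.comp 0 1) :
    h.IsHom (h₀.tensor h₁) (B.embed R R') := by
  have hl0 := ne_zero_of_mul_self q.d_pos P.l_mul_l
  have hl' : -P.l * -P.l = -q.d := by rw [neg_mul_neg, P.l_mul_l]
  have hωm : P.ω ∈ h.comp 2 0 := by rw [hP]; exact Submodule.mem_span_singleton_self _
  intro r s x hx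
  by_cases hrs : r + s = 2
  · have : (r = 2 ∧ s = 0) ∨ (r = 0 ∧ s = 2) ∨ (r = 1 ∧ s = 1) := by omega
    rcases this with ⟨rfl, rfl⟩ | ⟨rfl, rfl⟩ | ⟨rfl, rfl⟩
    · rw [hP] at hx
      obtain ⟨c, rfl⟩ := Submodule.mem_span_singleton.1 hx
      rw [map_smul, B.embed_eigen R R' P.l_mul_l P.D_ω]
      have hy := c10 P.ω (P.sq_ω B.rep _)
      exact Submodule.smul_mem _ _ (HodgeStructure.tmulC_mem_tensor rfl rfl v10 hy)
    · have h1 := h.conj_mem _ _ _ hx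
      rw [hP] at h1
      obtain ⟨c, hcx⟩ := Submodule.mem_span_singleton.1 h1
      have h2 := congrArg (conjC V) hcx
      rw [conjC_conjC, conjC_smul] at h2
      rw [← h2, map_smul, B.embed_eigen R R' hl' P.D_conj]
      have hy := c01 (conjC V P.ω) (P.sq_conj B.rep _)
      exact Submodule.smul_mem _ _ (HodgeStructure.tmulC_mem_tensor rfl rfl v01 hy)
    · have hDD : ∀ y : ℂ ⊗[ℚ] V, (kAct V q.δ).baseChange ℂ ((kAct V q.δ).baseChange ℂ y) =
          (P.l * P.l) • y := by
        intro y
        rw [← LinearMap.comp_apply, ← LinearMap.baseChange_comp]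
        have : kAct V q.δ ∘ₗ kAct V q.δ = (-q.d) • LinearMap.id := LinearMap.ext (kAct_kAct q)
        rw [this, LinearMap.baseChange_smul, LinearMap.baseChange_id, LinearMap.smul_apply,
          LinearMap.id_apply, ← algebraMap_smul ℂ (-q.d), P.l_mul_l]
        simp
      have hDx := hDh 1 1 x hx
      have hpart : ∀ k : ℂ, k ≠ 0 → k * k = P.l * P.l →
          (kAct V q.δ).baseChange ℂ (x + k⁻¹ • (kAct V q.δ).baseChange ℂ x) =
            k • (x + k⁻¹ • (kAct V q.δ).baseChange ℂ x) := by
        intro k hk hkl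
        rw [map_add, map_smul, hDD, ← hkl]
        match_scalars <;> field_simp
      have hx11 : ∀ k : ℂ, x + k⁻¹ • (kAct V q.δ).baseChange ℂ x ∈ h.comp 1 1 := fun k =>
        Submodule.add_mem _ hx (Submodule.smul_mem _ _ hDx)
      have horth : ∀ y ∈ h.comp 1 1,
          LinearMap.BilinForm.baseChange ℂ Q P.ω y + LinearMap.BilinForm.baseChange ℂ Q y P.ω = 0 := by
        intro y hy
        rw [hQ.symmC y, hQ.orth 2 0 1 1 (by simp) _ hωm _ hy, add_zero]
      have horth' : ∀ y ∈ h.comp 1 1, LinearMap.BilinForm.baseChange ℂ Q (conjC V P.ω) y +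
          LinearMap.BilinForm.baseChange ℂ Q y (conjC V P.ω) = 0 := by
        intro y hy
        rw [hQ.symmC y, hQ.orth 0 2 1 1 (by simp) _ (h.conj_mem _ _ _ hωm) _ hy, add_zero]
      -- The eigencomponents of x stay in V^{1,1} since δ is a Hodge endomorphism.
      have hsplit : x = (1 / 2 : ℂ) • ((x + P.l⁻¹ • (kAct V q.δ).baseChange ℂ x) +
          (x + (-P.l)⁻¹ • (kAct V q.δ).baseChange ℂ x)) := by
        rw [inv_neg]
        module
      rw [hsplit, map_smul, map_add, B.embed_eigen R R' P.l_mul_l (hpart _ hl0 rfl),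
        B.embed_eigen R R' hl' (hpart _ (neg_ne_zero.2 hl0) (neg_mul_neg _ _))]
      refine Submodule.smul_mem _ _ (Submodule.add_mem _ ?_ ?_)
      · refine HodgeStructure.tmulC_mem_tensor rfl rfl v10 (c01 _ ?_)
        refine B.endC_endC_vacuum (neg_ne_zero.2 hl0) P.D_conj ?_ (horth' _ (hx11 _))
        rw [neg_neg]
        exact hpart _ hl0 rfl
      · refine HodgeStructure.tmulC_mem_tensor rfl rfl v01 (c10 _ ?_)
        exact B.endC_endC_vacuum hl0 P.D_ω
          (hpart _ (neg_ne_zero.2 hl0) (neg_mul_neg _ _)) (horth _ (hx11 _))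
  · rw [h.comp_eq_bot r s hrs, Submodule.mem_bot] at hx
    rw [hx, map_zero]
    exact Submodule.zero_mem _

theorem isHom_embed {h : HodgeStructure V 2} (hQ : h.IsPolarization Q) (P : PeriodVector Q (kAct V q.δ) q.d)
    (hP : P.IsPeriod h) (hDh : h.IsHom h (kAct V q.δ))
    (hc : B.rep.Commutes (kAct V q.δ) q.d R.proj) (hc' : B.rep.Commutes (kAct V q.δ) q.d R'.proj)
    (hR : R.proj = grade K m 0) (hR' : R'.proj = grade K m 1) :
    h.IsHom ((R.hodge P hc).tensor (R'.hodge P hc')) (B.embed R R') := by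
  have hl0 := ne_zero_of_mul_self q.d_pos P.l_mul_l
  have hιvac : ∀ k, R.ι.baseChange ℂ (R.π.baseChange ℂ (vac q m k)) = vac q m k := by
    intro k
    rw [R.ιC_πC, hR, vac, map_sub, LinearMap.baseChange_tmul, LinearMap.baseChange_tmul,
      grade_single, grade_single, if_pos Finset.card_empty, if_pos Finset.card_empty]
  have hιc : ∀ a : ℂ ⊗[ℚ] V, R'.ι.baseChange ℂ (R'.π.baseChange ℂ
      (endC B.cliff a (1 ⊗ₜ Pi.single ∅ 1))) = endC B.cliff a (1 ⊗ₜ Pi.single ∅ 1) := by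
    intro a
    rw [R'.ιC_πC, hR']
    induction a with
    | zero => simp
    | add a b ha hb => simp only [map_add, LinearMap.add_apply, ha, hb]
    | tmul z v => rw [endC_tmul_tmul, LinearMap.baseChange_tmul, grade_cliff_vacuum]
  refine B.isHom_embed_of_mem hQ P hP hDh ?_ ?_ (fun a ha => ?_) fun a ha => ?_
  · rw [R.mem_hodge_one_zero P hc, hιvac]
    exact B.endC_vac hl0 P.D_ω
  · rw [R.mem_hodge_zero_one P hc, hιvac]
    exact B.endC_vac (neg_ne_zero.2 hl0) P.D_conj
  · rw [R'.mem_hodge_one_zero P hc', hιc]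
    exact ha
  · rw [R'.mem_hodge_zero_one P hc', hιc]
    exact ha

end HermBasis

end Embedding

/-! ### The summands of the Fock space -/

/-- The summands are modelled on lifted coordinate spaces because the S_i must live in the universe
of V, while the Fock space lives in that of K. -/
theorem exists_retract {M : Type*} [AddCommGroup M] [Module ℚ M] [FiniteDimensional ℚ M]
    {p : Module.End ℚ M} (hp : ∀ x, p (p x) = p x) {n : ℕ}
    (hn : Module.finrank ℚ (LinearMap.range p) = n) :
    ∃ R : Retract M (ULift.{u} (Fin n → ℚ)), R.proj = p := by
  obtain ⟨e⟩ := FiniteDimensional.nonempty_linearEquiv_of_finrank_eq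
    (R := ℚ) (M := LinearMap.range p) (M' := ULift.{u} (Fin n → ℚ)) (by simp [hn])
  refine ⟨⟨(LinearMap.range p).subtype ∘ₗ e.symm.toLinearMap,
    e.toLinearMap ∘ₗ p.rangeRestrict, fun x => ?_⟩, LinearMap.ext fun x => ?_⟩
  · obtain ⟨y, hy⟩ := (e.symm x).2
    have : p.rangeRestrict (e.symm x : M) = e.symm x := by
      apply Subtype.ext
      change p (e.symm x : M) = _
      rw [← hy]
      exact hp y
    change e (p.rangeRestrict (e.symm x : M)) = x
    rw [this, LinearEquiv.apply_symm_apply]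
  · change ((e.symm (e (p.rangeRestrict x)) : LinearMap.range p) : M) = p x
    rw [LinearEquiv.symm_apply_apply]
    rfl

section Summands

variable {K : Type v} [Field K] [Algebra ℚ K] {q : ImagQuad K} {V : Type*} [AddCommGroup V]
  [Module ℚ V] [Module K V] [IsScalarTower ℚ K V] {Q : LinearMap.BilinForm ℚ V} {m : ℕ}

namespace HermBasis

theorem finrank_range_grade (hK : Module.finrank ℚ K = 2) (i : ℕ) :
    Module.finrank ℚ (LinearMap.range (grade K m i)) = 2 * m.choose i := by
  have : Module.Finite ℚ K := Module.finite_of_finrank_eq_succ hK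
  let ρ : LinearMap.range (grade K m i) →ₗ[ℚ] ({I : Finset (Fin m) // I.card = i} → K) :=
    LinearMap.funLeft ℚ K Subtype.val ∘ₗ (LinearMap.range (grade K m i)).subtype
  have hρ : Function.Bijective ρ := by
    constructor
    · rw [← LinearMap.ker_eq_bot, LinearMap.ker_eq_bot']
      rintro ⟨_, f, rfl⟩ hf
      apply Subtype.ext
      funext I
      change grade K m i f I = 0
      by_cases hI : I.card = i
      · exact congrFun hf ⟨I, hI⟩
      · rw [grade_apply, if_neg hI]
    · intro g
      refine ⟨⟨_, fun I => if h : I.card = i then g ⟨I, h⟩ else 0, rfl⟩, funext fun I => ?_⟩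
      change grade K m i (fun I => if h : I.card = i then g ⟨I, h⟩ else 0) I.1 = g I
      rw [grade_apply, if_pos I.2, dif_pos I.2]
  rw [(LinearEquiv.ofBijective ρ hρ).finrank_eq, Module.finrank_pi_fintype]
  simp [hK, mul_comm]

variable (B : HermBasis q Q m) {X : Type*} [AddCommGroup X] [Module ℚ X]
  {P : PeriodVector Q (kAct V q.δ) q.d} {R : Retract (FockSpace K m) X}

/-- For general h a sub-Hodge structure of X maps to a stable subspace of the Fock space, so the
classification of stable subspaces, here the hypothesis `H`, decides simplicity. -/
theorem isSimple_hodge [FiniteDimensional ℚ (FockSpace K m)] [Nontrivial X] {n : ℕ}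
    {b : Module.Basis (Fin n) ℚ V} {h : HodgeStructure V 2}
    (hg : h.IsGeneral b (exceptionalFamily K b)) (hP : P.IsPeriod h)
    (hDQ : ∀ v w, Q (q.δ • v) w = -Q v (q.δ • w))
    (hQ : ∀ w, w ≠ 0 → ∃ u, Q u w + Q w u ≠ 0) (hR : B.Commutes R.proj)
    (H : ∀ W : Submodule ℚ (FockSpace K m), B.IsStable W → (∀ f ∈ W, R.proj f = f) →
      W = ⊥ ∨ ∀ f, R.proj f ∈ W) : (R.hodge P hR).IsSimple := by
  refine ⟨inferInstance, fun U hU => ?_⟩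
  have h0 : ∀ f ∈ U.map R.ι, R.proj f = f := by
    rintro _ ⟨x, -, rfl⟩
    rw [R.proj_apply, R.π_ι]
  rcases H (U.map R.ι) (fun v w x hx => R.unitary_mem_of_isSub q hg P hP hDQ hQ hR hU v w hx) h0
    with h1 | h1
  · left
    rw [eq_bot_iff]
    intro x hx
    have h2 := Submodule.mem_map_of_mem (f := R.ι) hx
    rw [h1, Submodule.mem_bot] at h2
    exact R.ι_injective (h2.trans (map_zero _).symm)
  · right
    rw [eq_top_iff]
    intro x _
    obtain ⟨y, hy, hyx⟩ := h1 (R.ι x)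
    rw [R.proj_apply, R.π_ι] at hyx
    rwa [← R.ι_injective hyx]

theorem grade_smul (i : ℕ) (x : K) (f : FockSpace K m) :
    grade K m i (x • f) = x • grade K m i f := by
  funext I
  rw [Pi.smul_apply, grade_apply, grade_apply, Pi.smul_apply]
  split_ifs <;> simp

theorem exists_algHom (hR : B.Commutes R.proj) {i : ℕ} (hRi : R.proj = grade K m i) :
    ∃ φ : K →ₐ[ℚ] Module.End ℚ X, ∀ x, (R.hodge P hR).IsHom (R.hodge P hR) (φ x) := by
  let ψ : K →ₗ[ℚ] Module.End ℚ X :=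
    { toFun := fun x => R.π ∘ₗ scalar m x ∘ₗ R.ι
      map_add' := fun x y => LinearMap.ext fun z => by
        simp only [LinearMap.comp_apply, scalar_apply, add_smul, map_add, LinearMap.add_apply]
      map_smul' := fun r x => LinearMap.ext fun z => by
        simp only [LinearMap.comp_apply, scalar_apply, smul_assoc, map_smul, LinearMap.smul_apply,
          RingHom.id_apply] }
  refine ⟨AlgHom.ofLinearMap ψ (LinearMap.ext fun z => ?_) fun x y => LinearMap.ext fun z => ?_,
    fun x => R.isHom_hodge R P hR hR (B.commutes_scalar x)⟩
  · change R.π (scalar m 1 (R.ι z)) = z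
    rw [scalar_apply, one_smul, R.π_ι]
  · change R.π (scalar m (x * y) (R.ι z)) = R.π (scalar m x (R.ι (R.π (scalar m y (R.ι z)))))
    have h1 : grade K m i (R.ι z) = R.ι z := by rw [← hRi, R.proj_apply, R.π_ι]
    rw [← R.proj_apply, hRi, scalar_apply, scalar_apply, scalar_apply, grade_smul, h1, mul_smul]

theorem isIso_star {Y : Type*} [AddCommGroup Y] [Module ℚ Y] {R' : Retract (FockSpace K m) Y}
    [FiniteDimensional ℚ X] [FiniteDimensional ℚ Y]
    (hXY : Module.finrank ℚ X = Module.finrank ℚ Y) (hR : B.Commutes R.proj)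
    (hR' : B.Commutes R'.proj) {i j : ℕ} (hij : i + j = m) (hRi : R.proj = grade K m i)
    (hRj : R'.proj = grade K m j) : (R.hodge P hR).IsIso (R'.hodge P hR') := by
  have hinj : Function.Injective (R'.π ∘ₗ B.star ∘ₗ R.ι) := by
    rw [← LinearMap.ker_eq_bot, LinearMap.ker_eq_bot']
    intro x hx
    have h1 : grade K m i (R.ι x) = R.ι x := by rw [← hRi, R.proj_apply, R.π_ι]
    have h2 : B.star (R.ι x) = 0 := by
      rw [← h1, B.star_grade hij, ← hRj, R'.proj_apply]
      change R'.ι ((R'.π ∘ₗ B.star ∘ₗ R.ι) x) = 0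
      rw [hx, map_zero]
    apply R.ι_injective
    apply B.star_injective
    rw [h2, map_zero, map_zero]
  refine HodgeStructure.isIso_of_isHom (LinearEquiv.ofInjectiveOfFinrankEq _ hinj hXY) ?_
  exact R.isHom_hodge R' P hR hR' B.commutes_star

/-- Labels for the seeds: the subsets of an (m-2)-element set. -/
theorem exists_injective_avoiding {p z : Fin m} (hpz : p ≠ z) :
    ∃ T : Fin (2 ^ (m - 2)) → Finset (Fin m), Function.Injective T ∧
      ∀ k, p ∉ T k ∧ z ∉ T k := by
  have hcard : ((Finset.univ : Finset (Fin m)) \ {p, z}).powerset.card = 2 ^ (m - 2) := by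
    rw [Finset.card_powerset, Finset.card_sdiff_of_subset (Finset.subset_univ _),
      Finset.card_pair hpz, Finset.card_univ, Fintype.card_fin]
  let e := Finset.equivFinOfCardEq hcard
  refine ⟨fun k => (e.symm k).1, Subtype.val_injective.comp e.symm.injective, fun k => ?_⟩
  have h1 := Finset.mem_powerset.1 (e.symm k).2
  constructor
  · intro h; simpa using h1 h
  · intro h; simpa using h1 h

/-- Acting on all seeds at once is surjective, and 2^(m-2)·2^(m+1) = 2^(2m-1) is the upper bound for
dim C⁺(Q), so the map is bijective. It is a Hodge morphism because J acts by left multiplication on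
both sides. -/
theorem isIso_kugaSatake (hm : 2 ≤ m) (b : Module.Basis (Fin (2 * m)) ℚ V)
    {h : HodgeStructure V 2} (hQ : h.IsPolarization Q)
    (h20 : Module.finrank ℂ (h.comp 2 0) = 1)
    (hP : (exists_isKugaSatakeElement hQ h20).choose =
      (-Complex.I / 4) • (cliffordMulC Q (conjC V P.ω) P.ω - cliffordMulC Q P.ω (conjC V P.ω)))
    {S : Fin (m + 1) → Type*} [∀ i, AddCommGroup (S i)] [∀ i, Module ℚ (S i)]
    [∀ i, FiniteDimensional ℚ (S i)] (hS : Module.finrank ℚ (∀ i, S i) = 2 ^ (m + 1))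
    (R : ∀ i, Retract (FockSpace K m) (S i)) (hR : ∀ i, B.Commutes (R i).proj)
    (hRi : ∀ i, (R i).proj = grade K m i) :
    (kugaSatake h Q hQ h20).IsIso (HodgeStructure.pi fun _ : Fin (2 ^ (m - 2)) =>
      HodgeStructure.pi fun i => (R i).hodge P (hR i)) := by
  let p : Fin m := ⟨0, by omega⟩
  let z : Fin m := ⟨1, by omega⟩
  have hpz : p ≠ z := by simp [p, z]
  obtain ⟨T, hT, hT'⟩ := exists_injective_avoiding hpz
  let Φ : EvenClifford Q →ₗ[ℚ] (Fin (2 ^ (m - 2)) → ∀ i, S i) :=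
    LinearMap.pi fun k => LinearMap.pi fun i => (R i).π ∘ₗ B.rep.evenAct (seed K p (T k))
  have hsurj : Function.Surjective Φ := by
    intro y
    obtain ⟨x, hx⟩ := B.exists_even_forall_seed hpz hT hT' fun k => ∑ i, (R i).ι (y k i)
    refine ⟨x, funext fun k => funext fun i => ?_⟩
    change (R i).π (B.rep.evenHom x (seed K p (T k))) = y k i
    have h1 : ∀ (j : Fin (m + 1)) s, grade K m j ((R j).ι s) = (R j).ι s := fun j s => by
      rw [← hRi, (R j).proj_apply, (R j).π_ι]
    rw [hx, map_sum, Finset.sum_eq_single i]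
    · rw [(R i).π_ι]
    · intro j _ hji
      apply (R i).ι_injective
      rw [← (R i).proj_apply, hRi, ← h1 j, map_zero]
      exact grade_grade_of_ne (fun h => hji (Fin.ext h.symm)) _
    · simp
  obtain ⟨v, hv⟩ : ∃ v, Q.toQuadraticMap v ≠ 0 := by
    by_contra! hcon
    apply B.h_ne_zero p
    have h1 := B.polar (B.b p) (B.b p)
    rw [Finset.sum_eq_single p (fun j _ hj => by simp [hj]) (by simp)] at h1
    have h2 : Q (B.b p) (B.b p) = 0 := hcon (B.b p)
    rw [h2] at h1
    simp only [add_zero, map_zero, Module.Basis.repr_self, Finsupp.single_eq_same, map_one,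
      mul_one] at h1
    have h3 : algebraMap ℚ K (B.h p * 2) = 0 := by
      rw [map_mul, map_ofNat]
      linear_combination -h1
    rw [map_eq_zero] at h3
    linarith
  obtain ⟨hfin, hdim⟩ := finrank_even_le b Q.toQuadraticMap hv
  have hfin' : Module.Finite ℚ (EvenClifford Q) := hfin
  have hdim' : 2 * Module.finrank ℚ (EvenClifford Q) ≤ 2 ^ (2 * m) := hdim
  have hfr : Module.finrank ℚ (Fin (2 ^ (m - 2)) → ∀ i, S i) = 2 ^ (m - 2) * 2 ^ (m + 1) := by
    rw [Module.finrank_pi_fintype]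
    simp [hS]
  have hpow : 2 * (2 ^ (m - 2) * 2 ^ (m + 1)) = 2 ^ (2 * m) := by
    rw [← pow_add, ← pow_succ']
    congr 1
    omega
  have heq : Module.finrank ℚ (EvenClifford Q) =
      Module.finrank ℚ (Fin (2 ^ (m - 2)) → ∀ i, S i) := by
    have := LinearMap.finrank_le_finrank_of_surjective (f := Φ) hsurj
    omega
  have hinj := (LinearMap.injective_iff_surjective_of_finrank_eq_finrank heq).2 hsurj
  refine HodgeStructure.isIso_of_isHom (LinearEquiv.ofBijective Φ ⟨hinj, hsurj⟩) ?_
  refine HodgeStructure.isHom_pi fun k => HodgeStructure.isHom_pi fun i => ?_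
  exact isHom_evenAct hQ h20 P hP (R i) (hR i) (seed K p (T k))

/-- The idempotent onto the part of degree `i` fixed by the involution `star ∘ t`. -/
noncomputable def fixedProj (t : K) (i : ℕ) : Module.End ℚ (FockSpace K m) :=
  (1 / 2 : ℚ) • ((1 + B.star * scalar m t) * grade K m i)

theorem fixedProj_apply (t : K) (i : ℕ) (f : FockSpace K m) : B.fixedProj t i f =
    (1 / 2 : ℚ) • (grade K m i f + B.star (t • grade K m i f)) := rfl

theorem commutes_fixedProj (t : K) (i : ℕ) : B.Commutes (B.fixedProj t i) := by
  intro v w f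
  have h1 := B.commutes_grade i v w
  have h2 := (B.commutes_star.mul (B.commutes_scalar t)) v w
  have h3 : ∀ f, B.fixedProj t i f =
      (1 / 2 : ℚ) • (grade K m i f + (B.star * scalar m t) (grade K m i f)) := fun _ => rfl
  rw [h3, h3, h1, h2, map_smul, map_add]

section Fixed

variable {t : K} (ht : algebraMap ℚ K B.starSq * (t * q.τ t) = 1) {i : ℕ} (hi : 2 * i = m)

include ht in
theorem star_smul_star_smul (f : FockSpace K m) : B.star (t • B.star (t • f)) = f := by
  rw [star_scalar_star_scalar, ht, one_smul]

include hi in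
theorem grade_star_smul (t : K) (f : FockSpace K m) :
    grade K m i (B.star (t • grade K m i f)) = B.star (t • grade K m i f) := by
  rw [← B.star_grade (by omega : i + i = m), grade_smul, grade_grade]

include hi in
theorem grade_fixedProj (t : K) (f : FockSpace K m) :
    grade K m i (B.fixedProj t i f) = B.fixedProj t i f := by
  rw [fixedProj_apply, map_smul, map_add, B.grade_star_smul hi, grade_grade]

include ht in
theorem star_fixedProj (f : FockSpace K m) : B.star (t • B.fixedProj t i f) = B.fixedProj t i f := by
  rw [fixedProj_apply, smul_comm, map_smul, smul_add, map_add, B.star_smul_star_smul ht, add_comm]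

include ht hi in
theorem fixedProj_fixedProj (f : FockSpace K m) :
    B.fixedProj t i (B.fixedProj t i f) = B.fixedProj t i f := by
  rw [fixedProj_apply _ _ _ (B.fixedProj t i f), B.grade_fixedProj hi, B.star_fixedProj ht]
  module

/-- star∘t is τ-semilinear, so δ exchanges its fixed and anti-fixed vectors. -/
theorem fixedProj_δ_smul (f : FockSpace K m) : B.fixedProj t i (q.δ • f) =
    q.δ • (grade K m i f - B.fixedProj t i f) := by
  rw [fixedProj_apply, fixedProj_apply, grade_smul, smul_comm t, star_smul, q.τ_δ, neg_smul,
    ← sub_eq_add_neg, ← smul_sub, smul_comm]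
  congr 1
  module

-- Degree i is the sum of the fixed part Y and δY; the two coordinates are obtained by projecting x
-- and δx to Y.
include ht hi in
theorem isIso_fixed {Y : Type*} [AddCommGroup Y] [Module ℚ Y] {R' : Retract (FockSpace K m) Y}
    (hR : B.Commutes R.proj) (hR' : B.Commutes R'.proj) (hRi : R.proj = grade K m i)
    (hRf : R'.proj = B.fixedProj t i) :
    (R.hodge P hR).IsIso (HodgeStructure.pi fun _ : Fin 2 => R'.hodge P hR') := by
  let g : Fin 2 → Module.End ℚ (FockSpace K m) := ![1, scalar m q.δ]
  have hg : ∀ k, B.Commutes (g k) := by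
    intro k
    fin_cases k
    · exact B.commutes_one
    · exact B.commutes_scalar q.δ
  let Φ : X →ₗ[ℚ] (Fin 2 → Y) := LinearMap.pi fun k => R'.π ∘ₗ g k ∘ₗ R.ι
  have hΦ0 : ∀ x, Φ x 0 = R'.π (R.ι x) := fun x => rfl
  have hΦ1 : ∀ x, Φ x 1 = R'.π (q.δ • R.ι x) := fun x => rfl
  have hι : ∀ x, grade K m i (R.ι x) = R.ι x := fun x => by rw [← hRi, R.proj_apply, R.π_ι]
  have hι' : ∀ y, B.fixedProj t i (R'.ι y) = R'.ι y := fun y => by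
    rw [← hRf, R'.proj_apply, R'.π_ι]
  have hιg : ∀ y, grade K m i (R'.ι y) = R'.ι y := fun y => by
    rw [← hι', B.grade_fixedProj hi]
  have hπ : ∀ f, R'.π f = 0 → B.fixedProj t i f = 0 := fun f hf => by
    rw [← hRf, R'.proj_apply, hf, map_zero]
  have hδ := q.δ_ne_zero
  have hinj : Function.Injective Φ := by
    rw [← LinearMap.ker_eq_bot, LinearMap.ker_eq_bot']
    intro x hx
    have h0 := hπ (R.ι x) (by rw [← hΦ0, hx]; rfl)
    have h1 := hπ (q.δ • R.ι x) (by rw [← hΦ1, hx]; rfl)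
    rw [fixedProj_δ_smul, h0, sub_zero, hι] at h1
    apply R.ι_injective
    rw [map_zero]
    exact (smul_eq_zero.1 h1).resolve_left hδ
  have hsurj : Function.Surjective Φ := by
    intro y
    have hδι : ∀ y, B.fixedProj t i (q.δ • R'.ι y) = 0 := fun y => by
      rw [fixedProj_δ_smul, hι', hιg, sub_self, smul_zero]
    have hδι' : ∀ y, B.fixedProj t i (q.δ⁻¹ • R'.ι y) = 0 := fun y => by
      have h1 : q.δ • B.fixedProj t i (q.δ⁻¹ • R'.ι y) = 0 := by
        have := B.fixedProj_δ_smul (t := t) (i := i) (q.δ⁻¹ • R'.ι y)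
        rw [smul_smul, mul_inv_cancel₀ hδ, one_smul, hι', grade_smul, hιg, smul_sub, smul_smul,
          mul_inv_cancel₀ hδ, one_smul] at this
        exact sub_eq_self.1 this.symm
      exact (smul_eq_zero.1 h1).resolve_left hδ
    have hR0 : ∀ f, B.fixedProj t i f = 0 → R'.π f = 0 := fun f hf => by
      apply R'.ι_injective
      rw [← R'.proj_apply, hRf, hf, map_zero]
    refine ⟨R.π (R'.ι (y 0) + q.δ⁻¹ • R'.ι (y 1)), ?_⟩
    have hx : R.ι (R.π (R'.ι (y 0) + q.δ⁻¹ • R'.ι (y 1))) = R'.ι (y 0) + q.δ⁻¹ • R'.ι (y 1) := by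
      rw [← R.proj_apply, hRi, map_add, grade_smul, hιg, hιg]
    funext k
    fin_cases k
    · change Φ _ 0 = y 0
      rw [hΦ0, hx, map_add, R'.π_ι, hR0 _ (hδι' _), add_zero]
    · change Φ _ 1 = y 1
      rw [hΦ1, hx, smul_add, map_add, smul_smul, mul_inv_cancel₀ hδ, one_smul, R'.π_ι,
        hR0 _ (hδι _), zero_add]
  refine HodgeStructure.isIso_of_isHom (LinearEquiv.ofBijective Φ ⟨hinj, hsurj⟩) ?_
  exact HodgeStructure.isHom_pi fun k => R.isHom_hodge R' P hR hR' (hg k)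

end Fixed

/-! ### The discriminant condition -/

theorem norm_nonneg (q : ImagQuad K) (x : K) : 0 ≤ Algebra.norm ℚ x := by
  obtain ⟨r, s, rfl⟩ := q.exists_eq x
  have h1 : Algebra.norm ℚ (algebraMap ℚ K r + algebraMap ℚ K s * q.δ) = r * r + q.d * (s * s) := by
    apply (algebraMap ℚ K).injective
    rw [q.norm_eq]
    simp only [map_add, map_mul, q.τ_rat, q.τ_δ]
    linear_combination (-(algebraMap ℚ K s * algebraMap ℚ K s)) * q.δ_sq
  rw [h1]
  exact add_nonneg (mul_self_nonneg r) (mul_nonneg q.d_pos.le (mul_self_nonneg s))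

theorem _root_.ImagQuad.norm_inv (q : ImagQuad K) (x : K) :
    Algebra.norm ℚ x⁻¹ = (Algebra.norm ℚ x)⁻¹ := by
  apply (algebraMap ℚ K).injective
  rw [q.norm_eq, map_inv₀, map_inv₀, q.norm_eq, mul_inv]

theorem even_sum_range_four_mul (k : ℕ) : Even (∑ i ∈ Finset.range (4 * k), i) := by
  induction k with
  | zero => simp
  | succ k ih =>
    obtain ⟨n, hn⟩ := ih
    refine ⟨n + 8 * k + 3, ?_⟩
    rw [show 4 * (k + 1) = 4 * k + 1 + 1 + 1 + 1 by ring, Finset.sum_range_succ,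
      Finset.sum_range_succ, Finset.sum_range_succ, Finset.sum_range_succ, hn]
    ring

theorem starSq_of_mod_four_eq_zero (hm : m % 4 = 0) : B.starSq = ∏ j, B.h j := by
  rw [starSq, Even.neg_one_pow, one_mul]
  obtain ⟨k, rfl⟩ : ∃ k, m = 4 * k := ⟨m / 4, by omega⟩
  exact even_sum_range_four_mul k

theorem starSq_of_mod_four_eq_two (hm : m % 4 = 2) : B.starSq = -∏ j, B.h j := by
  rw [starSq, Odd.neg_one_pow, neg_one_mul]
  obtain ⟨k, rfl⟩ : ∃ k, m = 4 * k + 2 := ⟨m / 4, by omega⟩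
  obtain ⟨n, hn⟩ := even_sum_range_four_mul k
  refine ⟨n + 4 * k, ?_⟩
  rw [Finset.sum_range_succ, Finset.sum_range_succ, hn]
  ring

end HermBasis

end Summands

/-! ### The main theorem -/

theorem theorem11p2 {K : Type v} [Field K] [NumberField K] [NumberField.IsTotallyComplex K]
    (hK : Module.finrank ℚ K = 2)
    {V : Type u} [AddCommGroup V] [Module ℚ V] [Module K V] [IsScalarTower ℚ K V]
    (m : ℕ) (hm : 2 ≤ m) (hV : Module.finrank ℚ V = 2 * m)
    (b : Module.Basis (Fin (2 * m)) ℚ V)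
    (Q : LinearMap.BilinForm ℚ V)
    (hKQ : ∀ (x : K) (v w : V), Q (x • v) (x • w) = Algebra.norm ℚ x * Q v w) :
    ∃ E : Set (MvPolynomial (Fin (2 * m)) ℂ), IsExceptionalFamily K b E ∧
      ∀ (h : HodgeStructure V 2) (hQ : h.IsPolarization Q)
        (h20 : Module.finrank ℂ (h.comp 2 0) = 1),
        (∀ x : K, h.IsHom h (kAct V x)) →
        ∃ (S : Fin (m + 1) → Type u) (_ : ∀ i, AddCommGroup (S i)) (_ : ∀ i, Module ℚ (S i))
          (hS : ∀ i, HodgeStructure (S i) 1),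
          -- `C⁺(Q) ≅ S ^ (2 ^ (m - 2))` with `S = S₀ ⊕ ⋯ ⊕ S_m`
          (kugaSatake h Q hQ h20).IsIso
            (HodgeStructure.pi fun _ : Fin (2 ^ (m - 2)) => HodgeStructure.pi hS) ∧
          Module.finrank ℚ (∀ i, S i) = 2 ^ (m + 1) ∧
          (∀ i, (hS i).IsIso (hS i.rev)) ∧
          (∀ i, Module.finrank ℚ (S i) = 2 * m.choose i) ∧
          -- `K` acts on `Sᵢ` by Hodge endomorphisms
          (∀ i, ∃ φ : K →ₐ[ℚ] Module.End ℚ (S i), ∀ x, (hS i).IsHom (hS i) (φ x)) ∧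
          -- `V` embeds in `S₀ ⊗ S₁`
          (∃ f : V →ₗ[ℚ] (S 0 ⊗[ℚ] S 1), Function.Injective f ∧
            h.IsHom ((hS 0).tensor (hS 1)) f) ∧
          -- for general `h`, all `Sᵢ` outside the exceptional case are simple
          (∀ i : Fin (m + 1), ¬ (2 * (i : ℕ) = m ∧ m % 4 = 2 ∧ NegDiscIsNorm K Q m) →
            h.IsGeneral b E → (hS i).IsSimple) ∧
          -- the exceptional case: `S_l ≅ S_l' ^ 2`, with `S_l'` simple for general `h`
          (∀ i : Fin (m + 1), 2 * (i : ℕ) = m → m % 4 = 2 → NegDiscIsNorm K Q m →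
            ∃ (S' : Type u) (_ : AddCommGroup S') (_ : Module ℚ S') (hS' : HodgeStructure S' 1),
              (hS i).IsIso (HodgeStructure.pi fun _ : Fin 2 => hS') ∧
              (h.IsGeneral b E → hS'.IsSimple)) := by
  obtain ⟨q⟩ := exists_imagQuad hK
  refine ⟨exceptionalFamily K b, isExceptionalFamily b, fun h hQ h20 hKh => ?_⟩
  have hfinV : Module.Finite ℚ V := Module.Finite.of_basis b
  have hfinKV : Module.Finite K V := Module.Finite.of_restrictScalars_finite ℚ K V
  have hVK : Module.finrank K V = m := by
    have := Module.finrank_mul_finrank ℚ K V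
    rw [hK, hV] at this
    omega
  have hfinM : FiniteDimensional ℚ (FockSpace K m) := inferInstance
  obtain ⟨B, hB, hort, hdisc⟩ := exists_hermBasis q hKQ hQ.symm' hQ.nondegenerate hVK
  obtain ⟨P, hP, hJ⟩ := exists_periodVector q.d_pos (kAct_kAct q) hQ h20 (hKh q.δ)
  have hneg := prod_neg_of_unique_neg (exists_unique_neg hKQ hQ P hP B hB hort)
  have hDQ : ∀ v w, Q (q.δ • v) w = -Q v (q.δ • w) := form_δ_smul q hKQ
  have hnd : ∀ w, w ≠ 0 → ∃ u, Q u w + Q w u ≠ 0 := by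
    intro w hw
    obtain ⟨u, hu⟩ := hQ.nondegenerate w hw
    refine ⟨u, ?_⟩
    rw [hQ.symm' w, ← two_mul]
    exact mul_ne_zero two_ne_zero hu
  let j : Fin m := ⟨0, by omega⟩
  choose R hR using fun i : Fin (m + 1) => exists_retract.{u} (p := HermBasis.grade K m i)
    (fun f => HermBasis.grade_grade _ f) (HermBasis.finrank_range_grade hK i)
  have hRc : ∀ i, B.Commutes (R i).proj := fun i => by
    rw [hR]
    exact B.commutes_grade i
  have hdim : ∀ n : ℕ, Module.finrank ℚ (ULift.{u} (Fin n → ℚ)) = n := by simp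
  have hdimS : Module.finrank ℚ (∀ i : Fin (m + 1), ULift.{u} (Fin (2 * m.choose i) → ℚ)) =
      2 ^ (m + 1) := by
    rw [Module.finrank_pi_fintype]
    simp only [hdim]
    rw [Fin.sum_univ_eq_sum_range fun i => 2 * m.choose i, ← Finset.mul_sum,
      Nat.sum_range_choose, ← pow_succ']
  have hnontriv : ∀ i : Fin (m + 1), Nontrivial (ULift.{u} (Fin (2 * m.choose i) → ℚ)) := by
    intro i
    apply Module.nontrivial_of_finrank_pos (R := ℚ)
    rw [hdim]
    have := Nat.choose_pos (Nat.lt_succ_iff.1 i.2)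
    omega
  refine ⟨fun i => ULift.{u} (Fin (2 * m.choose i) → ℚ), inferInstance, inferInstance,
    fun i => (R i).hodge P (hRc i), B.isIso_kugaSatake hm b hQ h20 hJ hdimS R hRc hR, hdimS,
    fun i => ?_, fun i => hdim _, fun i => B.exists_algHom (hRc i) (hR i), ?_,
    fun i hi hg => ?_, fun i hi hm4 hnorm => ?_⟩
  · have hrev : (i.rev : ℕ) = m - i := by rw [Fin.val_rev]; omega
    refine B.isIso_star ?_ (hRc i) (hRc i.rev) (by omega : (i : ℕ) + i.rev = m) (hR i) (hR i.rev)
    rw [hdim, hdim, hrev, Nat.choose_symm (Nat.lt_succ_iff.1 i.2)]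
  · have h1 : ((1 : Fin (m + 1)) : ℕ) = 1 := by
      rw [Fin.val_one']
      exact Nat.mod_eq_of_lt (by omega)
    have hR1 : (R 1).proj = HermBasis.grade K m 1 := by rw [hR, h1]
    exact ⟨B.embed (R 0) (R 1), B.embed_injective (hR 0) hR1,
      B.isHom_embed hQ P hP (hKh q.δ) (hRc 0) (hRc 1) (hR 0) hR1⟩
  · have := hnontriv i
    refine B.isSimple_hodge hg hP hDQ hnd (hRc i) fun W hW hWi => ?_
    rw [hR] at hWi ⊢
    refine hW.eq_bot_or_top j (Nat.lt_succ_iff.1 i.2) hWi fun him t ht => ?_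
    rw [← q.norm_eq, ← map_mul, ← map_one (algebraMap ℚ K)] at ht
    have ht := (algebraMap ℚ K).injective ht
    have h0 := HermBasis.norm_nonneg q t
    -- A proper stable subspace would need 2i = m and N(t)·star² = 1. For 4 ∣ m, star² = ∏h_j is
    -- negative and N(t) ≥ 0; otherwise star² = -∏h_j is the norm of t⁻¹, which is the exceptional
    -- case.
    have hmod : m % 4 = 0 ∨ m % 4 = 2 := by omega
    rcases hmod with h4 | h4
    · rw [B.starSq_of_mod_four_eq_zero h4] at ht
      nlinarith
    · rw [B.starSq_of_mod_four_eq_two h4] at ht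
      refine hi ⟨him, h4, B.b, hort, t⁻¹, ?_⟩
      rw [q.norm_inv, ← Finset.prod_congr rfl fun i _ => hB i]
      exact inv_eq_of_mul_eq_one_left ht
  · obtain ⟨c, hc⟩ := hdisc hnorm
    have hc0 : Algebra.norm ℚ c ≠ 0 := by rw [hc]; linarith
    -- With N(c) = -∏h_j = star², the element t = c⁻¹ makes star∘t an involution.
    have ht : algebraMap ℚ K B.starSq * (c⁻¹ * q.τ c⁻¹) = 1 := by
      rw [← q.norm_eq, ← map_mul, B.starSq_of_mod_four_eq_two hm4, ← hc, q.norm_inv,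
        mul_inv_cancel₀ hc0, map_one]
    obtain ⟨R', hR'⟩ := exists_retract.{u} (B.fixedProj_fixedProj ht hi) rfl
    have hRc' : B.Commutes R'.proj := by
      rw [hR']
      exact B.commutes_fixedProj _ _
    have hiso := B.isIso_fixed (P := P) ht hi (hRc i) hRc' (hR i) hR'
    refine ⟨_, inferInstance, inferInstance, R'.hodge P hRc', hiso, fun hg => ?_⟩
    -- The fixed part is nonzero since two copies of it make up the nonzero S_i.
    have hnt : Nontrivial (ULift.{u} (Fin (Module.finrank ℚ
        (LinearMap.range (B.fixedProj c⁻¹ (i : ℕ)))) → ℚ)) := by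
      by_contra hcon
      rw [not_nontrivial_iff_subsingleton] at hcon
      obtain ⟨e, -⟩ := hiso
      have := hnontriv i
      exact not_subsingleton _ e.toEquiv.subsingleton
    refine B.isSimple_hodge hg hP hDQ hnd hRc' fun W hW hWi => ?_
    rw [hR'] at hWi ⊢
    have h1 : ∀ f ∈ W, HermBasis.grade K m i f = f := fun f hf => by
      rw [← hWi f hf, B.grade_fixedProj hi]
    have h2 : ∀ f ∈ W, B.star (c⁻¹ • f) = f := fun f hf => by
      rw [← hWi f hf, B.star_fixedProj ht]
    exact (hW.eq_bot_or_fixed j hi h1 c⁻¹ h2).imp_right fun h3 f =>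
      W.smul_mem (1 / 2 : ℚ) (h3 f)
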